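/- **Setting.** Let $T>0$, $\sigma_T>0$, $d\in\mathbb N$; let $f,s_\theta:\mathbb R^d\times[0,T]\to\mathbb R^d$ be measurable ($\theta$ is fixed) and $g:[0,T]\to\mathbb R$. Let $(x_t)_{t\in[0,T]}$ be a continuous (weak) solution of the forward SDE $$\mathrm dx_t=f(x_t,t)\,\mathrm dt+g(t)\,\mathrm dw_t ,$$ i.e. a continuous adapted process such that $\varphi(x_t)-\int_0^t\big(f(x_u,u)^\top\nabla\varphi(x_u)+\tfrac12 g(u)^2\Delta\varphi(x_u)\big)\mathrm du$ is a martingale for every $\varphi\in C_c^\infty(\mathbb R^d)$, and suppose that the law of $x_t$ has a density $q_t$ for every $t\in[0,T]$ ($q_0$ is the data density). Let $(y_t)_{t\in[0,T]}$ be a random solution of the ScoreODE $$\frac{\mathrm dy_t}{\mathrm dt}=h_p(y_t,t):=f(y_t,t)-\tfrac12 g(t)^2s_\theta(y_t,t),\qquad y_T\sim\mathcal N(0,\sigma_T^2I)$$ (the equation being understood in integral form), and suppose that the law of $y_t$ has a density $p_t^{\mathrm{ODE}}$ for every $t\in[0,T]$. Put $$\mathcal J_{\mathrm{ODE}}=\tfrac12\int_0^T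 g(t)^2\,\mathbb E_{q_t}\big[(s_\theta-\nabla\log q_t)^\top(\nabla\log p_t^{\mathrm{ODE}}-\nabla\log q_t)\big]\mathrm dt,$$ $$\mathcal J_{\mathrm{SM}}=\tfrac12\int_0^T g(t)^2\,\mathbb E_{q_t}\big[\|s_\theta-\nabla\log q_t\|_2^2\big]\mathrm dt,$$ $$\mathcal J_{\mathrm{Diff}}=\tfrac12\int_0^T g(t)^2\,\mathbb E_{q_t}\big[(s_\theta-\nabla\log q_t)^\top(\nabla\log p_t^{\mathrm{ODE}}-s_\theta)\big]\mathrm dt.$$ **Assumptions.** For all $t\in[0,T]$ the densities $q_t$ and $p_t^{\mathrm{ODE}}$ are $C^1$ and $q_t>0$, and the integral defining $\mathcal J_{\mathrm{ODE}}$ converges absolutely (as an integral over $[0,T]\times\mathbb R^d$). Moreover, with constants $C>0$ that do not depend on $x,y\in\mathbb R^d$ and $t\in[0,T]$: 1. $q_0\in C^3$ and $\mathbb E_{q_0}\|x\|_2^2<\infty$. 2. $f(\cdot,t)\in C^2$ for every $t$, and $\|f(x,t)\|_2\le C(1+\|x\|_2)$. 3. $\|f(x,t)-f(y,t)\|_2\le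 C\|x-y\|_2$. 4. $g$ is continuous and $|g(t)|>0$ on $[0,T]$. 5. $\int_0^T\int_{\mathcal O}\big(|q_t(x)|^2+d\,g(t)^2\|\nabla q_t(x)\|_2^2\big)\mathrm dx\,\mathrm dt<\infty$ for every bounded open $\mathcal O\subset\mathbb R^d$. 6. $\|\nabla q_t(x)\|_2^2\le C(1+\|x\|_2)$. 7. $\|\nabla\log q_t(x)-\nabla\log q_t(y)\|_2\le C\|x-y\|_2$. 8. $\|s_\theta(x,t)\|_2\le C(1+\|x\|_2)$. 9. $\|s_\theta(x,t)-s_\theta(y,t)\|_2\le C\|x-y\|_2$. 10. For every $t\in[0,T]$ there is $k>0$ with $q_t(x)=O(e^{-\|x\|_2^k})$ and $p_t^{\mathrm{ODE}}(x)=O(e^{-\|x\|_2^k})$ as $\|x\|_2\to\infty$. **Theorem (KL divergence of ScoreODEs).** Under these assumptions $D_{\mathrm{KL}}(q_0\|p_0^{\mathrm{ODE}})$ and $D_{\mathrm{KL}}(q_T\|p_T^{\mathrm{ODE}})$ are finite, the integrals defining $\mathcal J_{\mathrm{SM}}$ and $\mathcal J_{\mathrm{Diff}}$ converge absolutely, and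 $$D_{\mathrm{KL}}(q_0\|p_0^{\mathrm{ODE}})=D_{\mathrm{KL}}(q_T\|p_T^{\mathrm{ODE}})+\mathcal J_{\mathrm{ODE}} =D_{\mathrm{KL}}(q_T\|p_T^{\mathrm{ODE}})+\mathcal J_{\mathrm{SM}}+\mathcal J_{\mathrm{Diff}} .$$ -/

import Mathlib

open MeasureTheory ProbabilityTheory Set Filter Topology

noncomputable section

namespace ScoreODE

/-- The measure on `ℝ^d` with Lebesgue density `ρ`. -/
def densityMeasure {d : ℕ} (ρ : EuclideanSpace ℝ (Fin d) → ℝ) :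
    Measure (EuclideanSpace ℝ (Fin d)) :=
  volume.withDensity (fun x => ENNReal.ofReal (ρ x))

/-- `ρ` is a (nonnegative, measurable) probability density function of the measure `μ`. -/
def IsDensityOf {d : ℕ} (ρ : EuclideanSpace ℝ (Fin d) → ℝ)
    (μ : Measure (EuclideanSpace ℝ (Fin d))) : Prop :=
  Measurable ρ ∧ (∀ x, 0 ≤ ρ x) ∧ μ = densityMeasure ρ

/-- The score `∇ log ρ` of a density `ρ`. -/
def score {d : ℕ} (ρ : EuclideanSpace ℝ (Fin d) → ℝ) (x : EuclideanSpace ℝ (Fin d)) :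
    EuclideanSpace ℝ (Fin d) :=
  gradient (fun y => Real.log (ρ y)) x

/-- The generator `(L_t φ)(x) = ⟨f(x,t), ∇φ(x)⟩ + (1/2) g(t)² Δφ(x)` of the forward diffusion
`dx = f(x,t) dt + g(t) dw`. -/
def generator {d : ℕ} (f : EuclideanSpace ℝ (Fin d) → ℝ → EuclideanSpace ℝ (Fin d)) (g : ℝ → ℝ)
    (φ : EuclideanSpace ℝ (Fin d) → ℝ) (t : ℝ) (x : EuclideanSpace ℝ (Fin d)) : ℝ :=
  inner ℝ (f x t) (gradient φ x) + (1 / 2) * g t ^ 2 * Laplacian.laplacian φ x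

/-- `X` is, on `[0,T]`, a (weak) solution of the stochastic differential equation
`dX_t = f(X_t,t) dt + g(t) dw_t` on the filtered probability space `(Ω, ℱ, P)`, in the sense of the
martingale problem of Stroock and Varadhan: `X` is adapted with continuous paths and
`φ(X_t) - ∫_0^t (L_u φ)(X_u) du` is a martingale for every smooth compactly supported `φ`. -/
structure IsForwardDiffusion {d : ℕ} (T : ℝ)
    (f : EuclideanSpace ℝ (Fin d) → ℝ → EuclideanSpace ℝ (Fin d)) (g : ℝ → ℝ)
    {Ω : Type*} [mΩ : MeasurableSpace Ω] (ℱ : Filtration (Icc (0 : ℝ) T) mΩ)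
    (P : Measure Ω) (X : ℝ → Ω → EuclideanSpace ℝ (Fin d)) : Prop where
  adapted : ∀ t : Icc (0 : ℝ) T, Measurable[ℱ t] (X t)
  continuous_paths : ∀ᵐ ω ∂P, ContinuousOn (fun t => X t ω) (Icc 0 T)
  martingale : ∀ φ : EuclideanSpace ℝ (Fin d) → ℝ, ContDiff ℝ (⊤ : ℕ∞) φ → HasCompactSupport φ →
    Martingale (fun (t : Icc (0 : ℝ) T) ω =>
      φ (X t ω) - ∫ u in (0 : ℝ)..(t : ℝ), generator f g φ u (X u ω)) ℱ P

/-- The vector field `h_p(x,t) = f(x,t) - (1/2) g(t)² s(x,t)` of the ScoreODE. -/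
def odeField {d : ℕ} (f : EuclideanSpace ℝ (Fin d) → ℝ → EuclideanSpace ℝ (Fin d)) (g : ℝ → ℝ)
    (s : EuclideanSpace ℝ (Fin d) → ℝ → EuclideanSpace ℝ (Fin d))
    (x : EuclideanSpace ℝ (Fin d)) (t : ℝ) : EuclideanSpace ℝ (Fin d) :=
  f x t - ((1 / 2) * g t ^ 2) • s x t

/-- The Gaussian law `N(0, σ² I)` on `ℝ^d`, as the law of `σ Z` with `Z` standard Gaussian. -/
def centeredGaussian (d : ℕ) (σ : ℝ) : Measure (EuclideanSpace ℝ (Fin d)) :=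
  (stdGaussian (EuclideanSpace ℝ (Fin d))).map (fun x => σ • x)

/-- `Y` is, on `[0,T]`, a random solution of the ScoreODE `dY_t/dt = h_p(Y_t,t)` with terminal law
`Y_T ~ N(0, σ² I)`. The equation is written in integral form, because the coefficients are only
measurable in time; for continuous coefficients this is the classical equation. -/
structure IsScoreODESolution {d : ℕ} (T σ : ℝ)
    (f : EuclideanSpace ℝ (Fin d) → ℝ → EuclideanSpace ℝ (Fin d)) (g : ℝ → ℝ)
    (s : EuclideanSpace ℝ (Fin d) → ℝ → EuclideanSpace ℝ (Fin d))
    {Ω : Type*} [MeasurableSpace Ω] (P : Measure Ω)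
    (Y : ℝ → Ω → EuclideanSpace ℝ (Fin d)) : Prop where
  measurable : ∀ t ∈ Icc (0 : ℝ) T, Measurable (Y t)
  continuous_paths : ∀ᵐ ω ∂P, ContinuousOn (fun t => Y t ω) (Icc 0 T)
  terminal_law : P.map (Y T) = centeredGaussian d σ
  equation : ∀ᵐ ω ∂P, ∀ t ∈ Icc (0 : ℝ) T,
    Y t ω = Y T ω - ∫ u in t..T, odeField f g s (Y u ω) u

/-- The functional `(1/2) ∫_0^T g(t)² E_{q_t}[F(t,x)] dt`. -/
def weightedIntegral {d : ℕ} (T : ℝ) (g : ℝ → ℝ) (q : ℝ → EuclideanSpace ℝ (Fin d) → ℝ)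
    (F : ℝ → EuclideanSpace ℝ (Fin d) → ℝ) : ℝ :=
  (1 / 2) * ∫ t in (0 : ℝ)..T, g t ^ 2 * ∫ x, F t x ∂(densityMeasure (q t))

/-- The integral `∫_0^T ∫ g(t)² q_t(x) F(t,x) dx dt` converges absolutely. -/
def ConvergesAbsolutely {d : ℕ} (T : ℝ) (g : ℝ → ℝ) (q : ℝ → EuclideanSpace ℝ (Fin d) → ℝ)
    (F : ℝ → EuclideanSpace ℝ (Fin d) → ℝ) : Prop :=
  Integrable (fun z : ℝ × EuclideanSpace ℝ (Fin d) => g z.1 ^ 2 * (q z.1 z.2 * F z.1 z.2))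
    ((volume.restrict (Icc (0 : ℝ) T)).prod volume)

/-- The integrand `(s - ∇log q_t)ᵀ (∇log p_t - ∇log q_t)`. -/
def odeIntegrand {d : ℕ} (s : EuclideanSpace ℝ (Fin d) → ℝ → EuclideanSpace ℝ (Fin d))
    (q p : ℝ → EuclideanSpace ℝ (Fin d) → ℝ) (t : ℝ) (x : EuclideanSpace ℝ (Fin d)) : ℝ :=
  inner ℝ (s x t - score (q t) x) (score (p t) x - score (q t) x)

/-- The integrand `‖s - ∇log q_t‖²`. -/
def smIntegrand {d : ℕ} (s : EuclideanSpace ℝ (Fin d) → ℝ → EuclideanSpace ℝ (Fin d))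
    (q : ℝ → EuclideanSpace ℝ (Fin d) → ℝ) (t : ℝ) (x : EuclideanSpace ℝ (Fin d)) : ℝ :=
  ‖s x t - score (q t) x‖ ^ 2

/-- The integrand `(s - ∇log q_t)ᵀ (∇log p_t - s)`. -/
def diffIntegrand {d : ℕ} (s : EuclideanSpace ℝ (Fin d) → ℝ → EuclideanSpace ℝ (Fin d))
    (q p : ℝ → EuclideanSpace ℝ (Fin d) → ℝ) (t : ℝ) (x : EuclideanSpace ℝ (Fin d)) : ℝ :=
  inner ℝ (s x t - score (q t) x) (score (p t) x - s x t)

/-- `J_ODE`. -/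
def JODE {d : ℕ} (T : ℝ) (g : ℝ → ℝ)
    (s : EuclideanSpace ℝ (Fin d) → ℝ → EuclideanSpace ℝ (Fin d))
    (q p : ℝ → EuclideanSpace ℝ (Fin d) → ℝ) : ℝ :=
  weightedIntegral T g q (odeIntegrand s q p)

/-- `J_SM` (first-order score matching objective with weight `g²`). -/
def JSM {d : ℕ} (T : ℝ) (g : ℝ → ℝ)
    (s : EuclideanSpace ℝ (Fin d) → ℝ → EuclideanSpace ℝ (Fin d))
    (q : ℝ → EuclideanSpace ℝ (Fin d) → ℝ) : ℝ :=
  weightedIntegral T g q (smIntegrand s q)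

/-- `J_Diff`. -/
def JDiff {d : ℕ} (T : ℝ) (g : ℝ → ℝ)
    (s : EuclideanSpace ℝ (Fin d) → ℝ → EuclideanSpace ℝ (Fin d))
    (q p : ℝ → EuclideanSpace ℝ (Fin d) → ℝ) : ℝ :=
  weightedIntegral T g q (diffIntegrand s q p)

end ScoreODE

end

set_option linter.unusedSectionVars false

/-! Both families of marginals are transported by velocity fields. The Fokker-Planck equation for
`q_t` becomes `∂ₜq + div(q h) = 0` with `h = f - ½g²∇log q`, because `Δq = div(q∇log q)`; the
ScoreODE gives `∂ₜp + div(p k) = 0` with `k = f - ½g²s`. Formally, `d/dt ∫ q log(q/p) = ∫ q ⟨h - k,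
∇log q - ∇log p⟩`, and since `h - k = ½g²(s - ∇log q)`, integrating over `[0,T]` produces `-J_ODE`.
The second formula is the pointwise splitting `∇log p - ∇log q = (s - ∇log q) + (∇log p - s)`.

The work is to justify the formal derivative. The densities are `C¹` in space and have no regularity
in time, and `h`, `k` are only Lipschitz. The equations are therefore used weakly
(`continuityEquation_of_diffusion`, from the martingale problem, and `continuityEquation_of_flow`)
and mollified in space at scale `ε`. The mollified densities are Lipschitz in time, so the chain
rule applies at each point (`mollified_entropy_evolution`). The terms singular in `ε` combine into
commutators of DiPerna-Lions type, which stay bounded because the fields are Lipschitz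
(`abs_molComm_le`, `tendsto_molComm`).

No bound on `∇p_t` uniform in time is at hand, so `entropyRate_eq` moves every derivative off the
mollification of `p` before `ε → 0`. In the limit, at a fixed time, where `p_t` is `C¹`, a second
integration by parts restores `∇p_t` (`tendsto_entropyRate`). This gives the identity localized by a
cutoff, `entropy_evolution`.

Removing the cutoff (`relative_entropy_evolution`) uses linear growth of `h` and `k`, quadratic
growth of the log-densities and second moments bounded in time, besides absolute convergence of
`J_ODE`. For `q`, the growth follows from the Lipschitz score, tightness of a continuous process and
the gradient bound (`exists_score_and_log_bound`). For `p`, it follows by comparing small balls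
along the flow with balls under the Gaussian terminal law (`exists_abs_log_density_flow_le`). The
moments come from a Grönwall argument with a truncated square (`exists_second_moment_bound`). The
same bounds make the two divergences finite and `J_SM` absolutely convergent. -/

namespace ScoreODE

/-! ### Divergence of Lipschitz fields and integration by parts -/

section Divergence

variable {E : Type*} [NormedAddCommGroup E] [InnerProductSpace ℝ E] [FiniteDimensional ℝ E]

/-- The divergence of a vector field. -/
noncomputable def dvg (b : E → E) (x : E) : ℝ :=
  ∑ i, inner ℝ (stdOrthonormalBasis ℝ E i) (fderiv ℝ b x (stdOrthonormalBasis ℝ E i))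

/-- The bound holds everywhere and not just almost everywhere: `fderiv` takes the value zero where
`b` is not differentiable, so its norm never exceeds `L`. -/
lemma abs_dvg_le {b : E → E} {L : NNReal} (hb : LipschitzWith L b) (x : E) :
    |dvg b x| ≤ Module.finrank ℝ E * L := by
  unfold dvg
  refine (Finset.abs_sum_le_sum_abs _ _).trans ?_
  refine (Finset.sum_le_card_nsmul _ _ (L : ℝ) fun i _ => ?_).trans (by simp)
  refine (abs_real_inner_le_norm _ _).trans ?_
  have h1 := (fderiv ℝ b x).le_opNorm (stdOrthonormalBasis ℝ E i)
  have h2 := norm_fderiv_le_of_lipschitz ℝ hb (x₀ := x)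
  simp only [OrthonormalBasis.norm_eq_one, mul_one, one_mul] at h1 ⊢
  exact h1.trans h2

lemma dvg_sub {b c : E → E} {x : E} (hb : DifferentiableAt ℝ b x) (hc : DifferentiableAt ℝ c x) :
    dvg (fun y => b y - c y) x = dvg b x - dvg c x := by
  unfold dvg
  rw [fderiv_fun_sub hb hc]
  simp [inner_sub_right]

variable [MeasurableSpace E] [BorelSpace E]

lemma measurable_dvg (b : E → E) : Measurable (dvg b) := by
  unfold dvg
  refine Finset.measurable_fun_sum _ fun i _ => ?_
  exact (measurable_fderiv_apply_const ℝ b _).const_inner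

/-- Integration by parts for a Lipschitz vector field and a compactly supported function. -/
theorem integral_mul_dvg {ψ : E → ℝ} (hψ : ContDiff ℝ 1 ψ) (hc : HasCompactSupport ψ)
    {b : E → E} {L : NNReal} (hb : LipschitzWith L b) :
    ∫ x, ψ x * dvg b x = - ∫ x, fderiv ℝ ψ x (b x) := by
  obtain ⟨D, hD⟩ := hψ.lipschitzWith_of_hasCompactSupport hc one_ne_zero
  set e := stdOrthonormalBasis ℝ E
  have hbi : ∀ i, LipschitzWith L (fun x => inner ℝ (e i) (b x)) := fun i => by
    refine LipschitzWith.of_dist_le_mul fun x y => ?_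
    rw [Real.dist_eq, ← inner_sub_right]
    refine (abs_real_inner_le_norm _ _).trans ?_
    rw [e.norm_eq_one, one_mul, ← dist_eq_norm]
    exact hb.dist_le_mul x y
  have hae : ∀ᵐ x : E, DifferentiableAt ℝ b x := hb.ae_differentiableAt
  have hint1 : ∀ i, Integrable (fun x => ψ x * inner ℝ (e i) (fderiv ℝ b x (e i))) := fun i => by
    refine (hψ.continuous.integrable_of_hasCompactSupport hc).mul_bdd (c := L) ?_ ?_
    · exact ((measurable_fderiv_apply_const ℝ b _).const_inner).aestronglyMeasurable
    · refine Eventually.of_forall fun x => ?_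
      refine (abs_real_inner_le_norm _ _).trans ?_
      have h1 := (fderiv ℝ b x).le_opNorm (e i)
      have h2 := norm_fderiv_le_of_lipschitz ℝ hb (x₀ := x)
      simp only [OrthonormalBasis.norm_eq_one, mul_one, one_mul] at h1 ⊢
      exact h1.trans h2
  have hcf : ∀ i, Continuous fun x => fderiv ℝ ψ x (e i) := fun i =>
    (hψ.continuous_fderiv one_ne_zero).clm_apply continuous_const
  have hint2 : ∀ i, Integrable (fun x => inner ℝ (e i) (b x) * fderiv ℝ ψ x (e i)) := fun i => by
    refine Continuous.integrable_of_hasCompactSupport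
      ((continuous_const.inner hb.continuous).mul (hcf i)) ?_
    exact (hc.fderiv_apply ℝ (e i)).mul_left
  -- One coordinate at a time, this is integration by parts for two Lipschitz functions, one of them
  -- compactly supported. Rademacher's theorem (`hae`) identifies the line derivative with `fderiv`
  -- almost everywhere.
  have key : ∀ i, ∫ x, ψ x * inner ℝ (e i) (fderiv ℝ b x (e i)) =
      - ∫ x, inner ℝ (e i) (b x) * fderiv ℝ ψ x (e i) := fun i => by
    have := LipschitzWith.integral_lineDeriv_mul_eq (μ := (volume : Measure E)) (hbi i) hD hc (e i)
    rw [← integral_neg]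
    refine Eq.trans (integral_congr_ae ?_) (this.trans (integral_congr_ae ?_))
    · filter_upwards [hae] with x hx
      have h1 : HasFDerivAt (fun x => inner ℝ (e i) (b x))
          ((innerSL ℝ (e i)).comp (fderiv ℝ b x)) x :=
        (innerSL ℝ (e i)).hasFDerivAt.comp x hx.hasFDerivAt
      rw [(h1.hasLineDerivAt (e i)).lineDeriv]
      simp [mul_comm]
    · refine Eventually.of_forall fun x => ?_
      have h1 := ((hψ.differentiable one_ne_zero x).hasFDerivAt.hasLineDerivAt (-(e i))).lineDeriv
      simp only [h1, map_neg]
      ring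
  have hexp : ∀ x, fderiv ℝ ψ x (b x) = ∑ i, inner ℝ (e i) (b x) * fderiv ℝ ψ x (e i) := fun x => by
    conv_lhs => rw [← e.sum_repr' (b x)]
    simp
  simp_rw [hexp]
  rw [integral_finsetSum _ fun i _ => hint2 i, ← Finset.sum_neg_distrib]
  simp_rw [← key]
  rw [← integral_finsetSum _ fun i _ => hint1 i]
  simp [dvg, Finset.mul_sum, e]

end Divergence

/-! ### Mollification in space and the transport commutator -/

section Mollification

variable {E : Type*} [NormedAddCommGroup E] [InnerProductSpace ℝ E] [FiniteDimensional ℝ E]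
  [MeasurableSpace E] [BorelSpace E]

/-- Dominated convergence for functions that are bounded and supported in a fixed ball. -/
lemma tendsto_integral_of_bounded_on_ball {G : Type*} [NormedAddCommGroup G] [NormedSpace ℝ G]
    {ι : Type*} {l : Filter ι} [l.IsCountablyGenerated] {F : ι → E → G} {f : E → G} (r K : ℝ)
    (hmeas : ∀ᶠ i in l, AEStronglyMeasurable (F i) volume)
    (hz : ∀ᶠ i in l, ∀ z, r < ‖z‖ → F i z = 0)
    (hb : ∀ᶠ i in l, ∀ z, ‖z‖ ≤ r → ‖F i z‖ ≤ K)
    (hlim : ∀ᵐ z, Tendsto (fun i => F i z) l (𝓝 (f z))) :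
    Tendsto (fun i => ∫ z, F i z) l (𝓝 (∫ z, f z)) := by
  refine tendsto_integral_filter_of_dominated_convergence
    ((Metric.closedBall (0 : E) r).indicator fun _ => K) hmeas ?_ ?_ hlim
  · filter_upwards [hz, hb] with i h1 h2
    refine Eventually.of_forall fun z => ?_
    by_cases hzr : ‖z‖ ≤ r
    · rw [indicator_of_mem (by simpa using hzr)]
      exact h2 z hzr
    · rw [indicator_of_notMem (by simpa using hzr), h1 z (not_le.1 hzr), norm_zero]
  · rw [integrable_indicator_iff Metric.isClosed_closedBall.measurableSet]
    exact integrableOn_const (measure_closedBall_lt_top.ne)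

lemma norm_integral_le_of_bounded_on_ball {G : Type*} [NormedAddCommGroup G] [NormedSpace ℝ G]
    {F : E → G} (r K : ℝ) (hz : ∀ z, r < ‖z‖ → F z = 0) (hb : ∀ z, ‖z‖ ≤ r → ‖F z‖ ≤ K) :
    ‖∫ z, F z‖ ≤ K * (volume : Measure E).real (Metric.closedBall 0 r) := by
  rw [← setIntegral_eq_integral_of_forall_compl_eq_zero (s := Metric.closedBall (0 : E) r)
    fun z h => hz z (by simpa using h)]
  exact norm_setIntegral_le_of_norm_le_const measure_closedBall_lt_top
    fun z h => hb z (by simpa using h)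

lemma continuous_integral_of_ball {X : Type*} [TopologicalSpace X] [FirstCountableTopology X]
    [LocallyCompactSpace X] {G : Type*} [NormedAddCommGroup G] [NormedSpace ℝ G]
    {F : X → E → G} (hF : Continuous F.uncurry) (r : ℝ) (hz : ∀ x z, r < ‖z‖ → F x z = 0) :
    Continuous fun x => ∫ z, F x z := by
  have := continuous_parametric_integral_of_continuous (μ := (volume : Measure E)) hF
    (isCompact_closedBall (0 : E) r)
  refine this.congr fun x => ?_
  exact setIntegral_eq_integral_of_forall_compl_eq_zero
    fun z h => hz x z (by simpa using h)

/-- A smooth nonnegative averaging kernel supported in the closed unit ball. -/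
structure IsMollifier (ρ : E → ℝ) : Prop where
  smooth : ContDiff ℝ (⊤ : ℕ∞) ρ
  nonneg : ∀ z, 0 ≤ ρ z
  zero_of_lt : ∀ z, 1 < ‖z‖ → ρ z = 0
  integral_eq : ∫ z, ρ z = 1

variable (E) in
lemma exists_isMollifier : ∃ ρ : E → ℝ, IsMollifier ρ := by
  let φ : ContDiffBump (0 : E) := ⟨1 / 2, 1, by norm_num, by norm_num⟩
  refine ⟨φ.normed volume, φ.contDiff_normed, φ.nonneg_normed, fun z hz => ?_, φ.integral_normed⟩
  have : z ∉ Function.support (φ.normed volume) := by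
    rw [φ.support_normed_eq]
    simpa [φ] using hz.le
  simpa using this

namespace IsMollifier

variable {ρ : E → ℝ} (hρ : IsMollifier ρ)
include hρ

lemma continuous : Continuous ρ := hρ.smooth.continuous

lemma continuous_fderiv : Continuous (fderiv ℝ ρ) := hρ.smooth.continuous_fderiv (by simp)

lemma hasCompactSupport : HasCompactSupport ρ :=
  HasCompactSupport.intro (isCompact_closedBall (0 : E) 1) fun z hz =>
    hρ.zero_of_lt z (by simpa using hz)

lemma fderiv_zero_of_lt (z : E) (hz : 1 < ‖z‖) : fderiv ℝ ρ z = 0 := by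
  have : ρ =ᶠ[𝓝 z] fun _ => 0 := by
    filter_upwards [(isOpen_lt continuous_const continuous_norm).mem_nhds hz] with y hy
    exact hρ.zero_of_lt y hy
  rw [this.fderiv_eq]
  simp

lemma integrable : Integrable ρ :=
  hρ.continuous.integrable_of_hasCompactSupport hρ.hasCompactSupport

lemma exists_bound : ∃ K : ℝ, 0 ≤ K ∧ ∀ z, ‖fderiv ℝ ρ z‖ ≤ K := by
  obtain ⟨K, hK⟩ := (hρ.hasCompactSupport.fderiv ℝ).exists_bound_of_continuous hρ.continuous_fderiv
  exact ⟨K, (norm_nonneg _).trans (hK 0), hK⟩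

end IsMollifier

/-- Mollification of `u` at scale `ε`. -/
noncomputable def mol (ρ : E → ℝ) (ε : ℝ) (u : E → ℝ) (x : E) : ℝ :=
  ∫ z, ρ z * u (x - ε • z)

/-- Mollification of `- div (u h)`, with the derivative on the kernel. -/
noncomputable def molDiv (ρ : E → ℝ) (ε : ℝ) (u : E → ℝ) (h : E → E) (x : E) : ℝ :=
  - ε⁻¹ * ∫ z, u (x - ε • z) * fderiv ℝ ρ z (h (x - ε • z))

/-- The commutator of mollification and transport along `h`. -/
noncomputable def molComm (ρ : E → ℝ) (ε : ℝ) (u : E → ℝ) (h : E → E) (x : E) : ℝ :=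
  ∫ z, u (x - ε • z) * fderiv ℝ ρ z (ε⁻¹ • (h x - h (x - ε • z)))

variable {ρ : E → ℝ} {ε : ℝ} {u : E → ℝ} {h : E → E}

lemma mol_fun (hρ : IsMollifier ρ) (hu : Continuous u) : Continuous (mol ρ ε u) := by
  have := hρ.continuous
  exact continuous_integral_of_ball (F := fun x z => ρ z * u (x - ε • z)) (by fun_prop) 1
    fun x z hz => by simp [hρ.zero_of_lt z hz]

lemma continuous_molComm (hρ : IsMollifier ρ) (hu : Continuous u) (hh : Continuous h) :
    Continuous (molComm ρ ε u h) := by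
  have := hρ.continuous_fderiv
  exact continuous_integral_of_ball
    (F := fun x z => u (x - ε • z) * fderiv ℝ ρ z (ε⁻¹ • (h x - h (x - ε • z)))) (by fun_prop) 1
    fun x z hz => by simp [hρ.fderiv_zero_of_lt z hz]

lemma hasFDerivAt_mol (hρ : IsMollifier ρ) (hu : ContDiff ℝ 1 u) (x : E) :
    HasFDerivAt (mol ρ ε u) (∫ z, ρ z • fderiv ℝ u (x - ε • z)) x := by
  have c1 := hρ.continuous
  have c2 := hu.continuous
  have c3 := hu.continuous_fderiv one_ne_zero
  obtain ⟨K, hK⟩ := (isCompact_closedBall (0 : E) (‖x‖ + 1 + |ε|)).exists_bound_of_continuousOn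
    c3.continuousOn
  refine hasFDerivAt_integral_of_dominated_of_fderiv_le (𝕜 := ℝ) (s := Metric.ball x 1)
    (F := fun x z => ρ z * u (x - ε • z)) (F' := fun x z => ρ z • fderiv ℝ u (x - ε • z))
    (bound := fun z => ρ z * K) (Metric.ball_mem_nhds x one_pos) ?_ ?_ ?_ ?_ ?_ ?_
  · exact Eventually.of_forall fun y => by
      apply Continuous.aestronglyMeasurable
      fun_prop
  · refine Continuous.integrable_of_hasCompactSupport (by fun_prop) ?_
    exact hρ.hasCompactSupport.mul_right
  · apply Continuous.aestronglyMeasurable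
    fun_prop
  · refine Eventually.of_forall fun z y hy => ?_
    rw [norm_smul, Real.norm_of_nonneg (hρ.nonneg z)]
    by_cases hz : 1 < ‖z‖
    · simp [hρ.zero_of_lt z hz]
    refine mul_le_mul_of_nonneg_left (hK _ ?_) (hρ.nonneg z)
    rw [mem_closedBall_zero_iff]
    have h1 : ‖y‖ ≤ ‖x‖ + 1 := by
      have := norm_le_norm_add_norm_sub x y
      rw [Metric.mem_ball, dist_eq_norm, norm_sub_rev] at hy
      linarith
    have h2 : ‖ε • z‖ ≤ |ε| := by
      rw [norm_smul, Real.norm_eq_abs]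
      exact mul_le_of_le_one_right (abs_nonneg _) (not_lt.1 hz)
    exact (norm_sub_le _ _).trans (by linarith)
  · exact hρ.integrable.mul_const K
  · refine Eventually.of_forall fun z y _ => ?_
    have : HasFDerivAt (fun y => u (y - ε • z)) (fderiv ℝ u (y - ε • z)) y :=
      ((hu.differentiable one_ne_zero _).hasFDerivAt.comp y
        ((hasFDerivAt_id y).sub_const (ε • z))).congr_fderiv (by ext; simp)
    simpa using this.const_mul (ρ z)

lemma fderiv_mol_apply (hρ : IsMollifier ρ) (hu : ContDiff ℝ 1 u) (x w : E) :
    fderiv ℝ (mol ρ ε u) x w = ∫ z, ρ z * fderiv ℝ u (x - ε • z) w := by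
  have c1 := hρ.continuous
  have c3 := hu.continuous_fderiv one_ne_zero
  rw [(hasFDerivAt_mol hρ hu x).fderiv, ContinuousLinearMap.integral_apply]
  · simp
  · refine Continuous.integrable_of_hasCompactSupport (by fun_prop) ?_
    exact hρ.hasCompactSupport.smul_right

lemma contDiff_mol (hρ : IsMollifier ρ) (hu : ContDiff ℝ 1 u) : ContDiff ℝ 1 (mol ρ ε u) := by
  rw [contDiff_one_iff_fderiv]
  refine ⟨fun x => (hasFDerivAt_mol hρ hu x).differentiableAt, ?_⟩
  have h1 : fderiv ℝ (mol ρ ε u) = fun x => ∫ z, ρ z • fderiv ℝ u (x - ε • z) :=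
    funext fun x => (hasFDerivAt_mol hρ hu x).fderiv
  rw [h1]
  have c1 := hρ.continuous
  have c3 := hu.continuous_fderiv one_ne_zero
  exact continuous_integral_of_ball (F := fun x z => ρ z • fderiv ℝ u (x - ε • z)) (by fun_prop) 1
    fun x z hz => by simp [hρ.zero_of_lt z hz]

/-- Integration by parts in `z` against the constant field `w`, whose divergence vanishes. With the
derivative on the kernel, the expression can be combined with `molDiv` under one integral. -/
lemma fderiv_mol_apply' (hρ : IsMollifier ρ) (hu : ContDiff ℝ 1 u) (hε : ε ≠ 0) (x w : E) :
    fderiv ℝ (mol ρ ε u) x w = ε⁻¹ * ∫ z, u (x - ε • z) * fderiv ℝ ρ z w := by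
  have c0 := hρ.continuous
  have c1 := hρ.continuous_fderiv
  have c2 := hu.continuous
  have c3 := hu.continuous_fderiv one_ne_zero
  have hd : ∀ z, HasFDerivAt (fun z => ρ z * u (x - ε • z))
      (ρ z • (-ε • fderiv ℝ u (x - ε • z)) + u (x - ε • z) • fderiv ℝ ρ z) z := fun z => by
    have h1 : HasFDerivAt (fun z => u (x - ε • z)) (-ε • fderiv ℝ u (x - ε • z)) z :=
      ((hu.differentiable one_ne_zero _).hasFDerivAt.comp z
        (((hasFDerivAt_id z).const_smul ε).const_sub x)).congr_fderiv (by ext; simp)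
    exact (hρ.smooth.differentiable (by simp) z).hasFDerivAt.mul h1
  have hψ : ContDiff ℝ 1 fun z => ρ z * u (x - ε • z) :=
    (hρ.smooth.of_le (by simp)).mul (hu.comp (contDiff_const.sub (contDiff_id.const_smul ε)))
  have key := integral_mul_dvg hψ hρ.hasCompactSupport.mul_right
    (LipschitzWith.const (α := E) w)
  have h0 : ∀ z : E, dvg (fun _ : E => w) z = 0 := fun z => by simp [dvg]
  simp only [h0, mul_zero, integral_zero] at key
  have h2 : ∫ z, fderiv ℝ (fun z => ρ z * u (x - ε • z)) z w
      = ∫ z, (u (x - ε • z) * fderiv ℝ ρ z w - ε * (ρ z * fderiv ℝ u (x - ε • z) w)) := by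
    refine integral_congr_ae (Eventually.of_forall fun z => ?_)
    simp only [(hd z).fderiv, add_apply, FunLike.coe_smul, Pi.smul_apply, smul_eq_mul]
    ring
  rw [integral_sub, integral_const_mul] at h2
  · rw [fderiv_mol_apply hρ hu]
    have h3 : ∫ z, u (x - ε • z) * fderiv ℝ ρ z w
        = ε * ∫ z, ρ z * fderiv ℝ u (x - ε • z) w := by linarith
    rw [h3, inv_mul_cancel_left₀ hε]
  · refine Continuous.integrable_of_hasCompactSupport (by fun_prop) ?_
    exact (hρ.hasCompactSupport.fderiv_apply ℝ w).mul_left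
  · refine (Continuous.integrable_of_hasCompactSupport (by fun_prop) ?_).const_mul ε
    exact hρ.hasCompactSupport.mul_right

/-- This is the reason for `molComm`: `molDiv` and the transport term each carry a factor `ε⁻¹`, and
their sum contains only the difference quotient of `h`. -/
lemma molComm_eq (hρ : IsMollifier ρ) (hu : ContDiff ℝ 1 u) (hh : Continuous h) (hε : ε ≠ 0)
    (x : E) : molComm ρ ε u h x = molDiv ρ ε u h x + fderiv ℝ (mol ρ ε u) x (h x) := by
  have c1 := hρ.continuous_fderiv
  have c2 := hu.continuous
  rw [fderiv_mol_apply' hρ hu hε, molDiv, molComm, neg_mul, neg_add_eq_sub, ← mul_sub,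
    ← integral_sub, ← integral_const_mul]
  · refine integral_congr_ae (Eventually.of_forall fun z => ?_)
    simp only [map_smul, map_sub, smul_eq_mul]
    ring
  · refine Continuous.integrable_of_hasCompactSupport (by fun_prop) ?_
    exact (hρ.hasCompactSupport.fderiv_apply ℝ (h x)).mul_left
  · refine Continuous.integrable_of_hasCompactSupport (by fun_prop) ?_
    refine HasCompactSupport.intro (isCompact_closedBall (0 : E) 1) fun z hz => ?_
    simp [hρ.fderiv_zero_of_lt z (by simpa using hz)]

lemma norm_sub_smul_le {R : ℝ} {x z : E} (hx : ‖x‖ ≤ R) (hz : ‖z‖ ≤ 1) (h0 : 0 < ε) (h1 : ε ≤ 1) :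
    ‖x - ε • z‖ ≤ R + 1 := by
  refine (norm_sub_le _ _).trans (add_le_add hx ?_)
  rw [norm_smul, Real.norm_of_nonneg h0.le]
  exact mul_le_one₀ h1 (norm_nonneg _) hz

/-- An average over a ball of radius `ε ≤ 1` centred in the ball of radius `R` only sees values in
the ball of radius `R + 1`. -/
lemma mol_mem_Icc (hρ : IsMollifier ρ) (hu : Continuous u) {R m M : ℝ} (h0 : 0 < ε) (h1 : ε ≤ 1)
    (hb : ∀ y, ‖y‖ ≤ R + 1 → u y ∈ Icc m M) {x : E} (hx : ‖x‖ ≤ R) : mol ρ ε u x ∈ Icc m M := by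
  have c0 := hρ.continuous
  have hi : Integrable fun z => ρ z * u (x - ε • z) :=
    Continuous.integrable_of_hasCompactSupport (by fun_prop) hρ.hasCompactSupport.mul_right
  have hle : ∀ z, ρ z * m ≤ ρ z * u (x - ε • z) ∧ ρ z * u (x - ε • z) ≤ ρ z * M := fun z => by
    by_cases hz : 1 < ‖z‖
    · simp [hρ.zero_of_lt z hz]
    have := hb _ (norm_sub_smul_le hx (not_lt.1 hz) h0 h1)
    exact ⟨mul_le_mul_of_nonneg_left this.1 (hρ.nonneg z),
      mul_le_mul_of_nonneg_left this.2 (hρ.nonneg z)⟩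
  have e : ∀ c, ∫ z, ρ z * c = c := fun c => by rw [integral_mul_const, hρ.integral_eq, one_mul]
  constructor
  · rw [← e m]
    exact integral_mono (hρ.integrable.mul_const m) hi fun z => (hle z).1
  · rw [← e M]
    exact integral_mono hi (hρ.integrable.mul_const M) fun z => (hle z).2

lemma norm_fderiv_mol_le (hρ : IsMollifier ρ) (hu : ContDiff ℝ 1 u) {R M : ℝ} (h0 : 0 < ε)
    (h1 : ε ≤ 1) (hb : ∀ y, ‖y‖ ≤ R + 1 → ‖fderiv ℝ u y‖ ≤ M) {x : E} (hx : ‖x‖ ≤ R) :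
    ‖fderiv ℝ (mol ρ ε u) x‖ ≤ M := by
  rw [(hasFDerivAt_mol hρ hu x).fderiv]
  have : ∫ z, ρ z * M = M := by rw [integral_mul_const, hρ.integral_eq, one_mul]
  rw [← this]
  refine norm_integral_le_of_norm_le (hρ.integrable.mul_const M) (Eventually.of_forall fun z => ?_)
  by_cases hz : 1 < ‖z‖
  · simp [hρ.zero_of_lt z hz]
  rw [norm_smul, Real.norm_of_nonneg (hρ.nonneg z)]
  exact mul_le_mul_of_nonneg_left (hb _ (norm_sub_smul_le hx (not_lt.1 hz) h0 h1)) (hρ.nonneg z)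

lemma norm_smul_sub_le {L : NNReal} (hh : LipschitzWith L h) (h0 : 0 < ε) (x z : E) :
    ‖ε⁻¹ • (h x - h (x - ε • z))‖ ≤ L * ‖z‖ := by
  rw [norm_smul, norm_inv, Real.norm_of_nonneg h0.le, inv_mul_le_iff₀ h0, ← dist_eq_norm]
  refine (hh.dist_le_mul _ _).trans_eq ?_
  rw [dist_eq_norm, sub_sub_cancel, norm_smul, Real.norm_of_nonneg h0.le]
  ring

/-- The Lipschitz constant of `h` absorbs the factor `ε⁻¹`, so the bound does not depend on `ε`;
this supplies the domination as `ε → 0`. -/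
lemma abs_molComm_le (hρ : IsMollifier ρ) {K : ℝ} (hK : ∀ z, ‖fderiv ℝ ρ z‖ ≤ K) {L : NNReal}
    (hh : LipschitzWith L h) {R M : ℝ} (h0 : 0 < ε) (h1 : ε ≤ 1)
    (hb : ∀ y, ‖y‖ ≤ R + 1 → |u y| ≤ M) {x : E} (hx : ‖x‖ ≤ R) :
    |molComm ρ ε u h x| ≤ M * (K * L) * (volume : Measure E).real (Metric.closedBall 0 1) := by
  rw [molComm, ← Real.norm_eq_abs]
  refine norm_integral_le_of_bounded_on_ball 1 _
    (fun z hz => by simp [hρ.fderiv_zero_of_lt z hz]) fun z hz => ?_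
  have hu1 := hb _ (norm_sub_smul_le hx hz h0 h1)
  rw [norm_mul]
  refine mul_le_mul hu1 ?_ (norm_nonneg _) ((abs_nonneg _).trans hu1)
  refine ((fderiv ℝ ρ z).le_opNorm _).trans ?_
  refine mul_le_mul (hK z) ?_ (norm_nonneg _) ((norm_nonneg _).trans (hK z))
  exact (norm_smul_sub_le hh h0 x z).trans (mul_le_of_le_one_right L.2 hz)

/-- This bound explodes as `ε → 0`. It is used at fixed `ε`, to make mollified solutions Lipschitz
in time and to apply Fubini. -/
lemma abs_molDiv_le (hρ : IsMollifier ρ) {K : ℝ} (hK : ∀ z, ‖fderiv ℝ ρ z‖ ≤ K)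
    {R M H : ℝ} (h0 : 0 < ε) (h1 : ε ≤ 1)
    (hb : ∀ y, ‖y‖ ≤ R + 1 → |u y| ≤ M) (hh : ∀ y, ‖y‖ ≤ R + 1 → ‖h y‖ ≤ H) {x : E}
    (hx : ‖x‖ ≤ R) :
    |molDiv ρ ε u h x| ≤
      ε⁻¹ * (M * (K * H) * (volume : Measure E).real (Metric.closedBall 0 1)) := by
  rw [molDiv, abs_mul, abs_neg, abs_of_pos (inv_pos.2 h0)]
  refine mul_le_mul_of_nonneg_left ?_ (inv_pos.2 h0).le
  rw [← Real.norm_eq_abs]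
  refine norm_integral_le_of_bounded_on_ball 1 _
    (fun z hz => by simp [hρ.fderiv_zero_of_lt z hz]) fun z hz => ?_
  have hu1 := hb _ (norm_sub_smul_le hx hz h0 h1)
  rw [norm_mul]
  refine mul_le_mul hu1 ?_ (norm_nonneg _) ((abs_nonneg _).trans hu1)
  refine ((fderiv ℝ ρ z).le_opNorm _).trans ?_
  exact mul_le_mul (hK z) (hh _ (norm_sub_smul_le hx hz h0 h1)) (norm_nonneg _)
    ((norm_nonneg _).trans (hK z))

lemma tendsto_sub_smul (x z : E) : Tendsto (fun ε : ℝ => x - ε • z) (𝓝[>] 0) (𝓝 x) := by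
  have : Continuous fun ε : ℝ => x - ε • z := by fun_prop
  simpa using (this.tendsto 0).mono_left nhdsWithin_le_nhds

lemma eventually_mem_Ioc : ∀ᶠ ε : ℝ in 𝓝[>] 0, ε ∈ Ioc (0 : ℝ) 1 := Ioc_mem_nhdsGT one_pos

lemma exists_abs_le_of_continuous {G : Type*} [NormedAddCommGroup G] {w : E → G}
    (hw : Continuous w) (r : ℝ) :
    ∃ K, ∀ y, ‖y‖ ≤ r → ‖w y‖ ≤ K := by
  obtain ⟨K, hK⟩ := (isCompact_closedBall (0 : E) r).exists_bound_of_continuousOn hw.continuousOn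
  exact ⟨K, fun y hy => hK y (by simpa using hy)⟩

lemma tendsto_mol (hρ : IsMollifier ρ) (hu : Continuous u) (x : E) :
    Tendsto (fun ε => mol ρ ε u x) (𝓝[>] 0) (𝓝 (u x)) := by
  have c0 := hρ.continuous
  have e : u x = ∫ z, ρ z * u x := by rw [integral_mul_const, hρ.integral_eq, one_mul]
  rw [e]
  obtain ⟨K, hK⟩ := exists_abs_le_of_continuous hu (‖x‖ + 1)
  obtain ⟨K', hK'⟩ := exists_abs_le_of_continuous c0 1
  refine tendsto_integral_of_bounded_on_ball 1 (K' * K) ?_ ?_ ?_ ?_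
  · exact Eventually.of_forall fun ε => by
      apply Continuous.aestronglyMeasurable
      fun_prop
  · exact Eventually.of_forall fun ε z hz => by simp [hρ.zero_of_lt z hz]
  · filter_upwards [eventually_mem_Ioc] with ε hε z hz
    rw [norm_mul]
    exact mul_le_mul (hK' z hz) (hK _ (norm_sub_smul_le le_rfl hz hε.1 hε.2)) (norm_nonneg _)
      ((norm_nonneg _).trans (hK' z hz))
  · exact Eventually.of_forall fun z =>
      ((hu.tendsto x).comp (tendsto_sub_smul x z)).const_mul (ρ z)

lemma tendsto_fderiv_mol (hρ : IsMollifier ρ) (hu : ContDiff ℝ 1 u) (x w : E) :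
    Tendsto (fun ε => fderiv ℝ (mol ρ ε u) x w) (𝓝[>] 0) (𝓝 (fderiv ℝ u x w)) := by
  simp_rw [fderiv_mol_apply hρ hu]
  have c3 := hu.continuous_fderiv one_ne_zero
  exact tendsto_mol hρ (u := fun y => fderiv ℝ u y w) (by fun_prop) x

/-- The linear field `z ↦ A z` has constant divergence `tr A` and `ρ` has integral one, so
integration by parts leaves `-tr A`. -/
lemma integral_fderiv_apply_fderiv (hρ : IsMollifier ρ) (A : E →L[ℝ] E) :
    ∫ z, fderiv ℝ ρ z (A z) =
      - ∑ i, inner ℝ (stdOrthonormalBasis ℝ E i) (A (stdOrthonormalBasis ℝ E i)) := by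
  have key := integral_mul_dvg (hρ.smooth.of_le (by simp)) hρ.hasCompactSupport A.lipschitz
  have h0 : ∀ z : E, dvg A z =
      ∑ i, inner ℝ (stdOrthonormalBasis ℝ E i) (A (stdOrthonormalBasis ℝ E i)) := fun z => by
    simp [dvg]
  simp_rw [h0, integral_mul_const, hρ.integral_eq, one_mul] at key
  linarith

/-- At a point of differentiability the difference quotient tends to `Dh(x) z`, and the kernel
derivative integrated against a linear field gives minus its trace. By Rademacher's theorem almost
every point qualifies. -/
lemma tendsto_molComm (hρ : IsMollifier ρ) (hu : Continuous u) {L : NNReal}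
    (hh : LipschitzWith L h) {x : E} (hx : DifferentiableAt ℝ h x) :
    Tendsto (fun ε => molComm ρ ε u h x) (𝓝[>] 0) (𝓝 (- (u x * dvg h x))) := by
  have c1 := hρ.continuous_fderiv
  have c2 := hh.continuous
  have e : - (u x * dvg h x) = ∫ z, u x * fderiv ℝ ρ z (fderiv ℝ h x z) := by
    rw [integral_const_mul, integral_fderiv_apply_fderiv hρ, dvg, mul_neg]
  rw [e]
  obtain ⟨K, hK⟩ := exists_abs_le_of_continuous hu (‖x‖ + 1)
  obtain ⟨K', -, hK'⟩ := hρ.exists_bound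
  refine tendsto_integral_of_bounded_on_ball 1 (K * (K' * L)) ?_ ?_ ?_ ?_
  · exact Eventually.of_forall fun ε => by
      apply Continuous.aestronglyMeasurable
      fun_prop
  · exact Eventually.of_forall fun ε z hz => by simp [hρ.fderiv_zero_of_lt z hz]
  · filter_upwards [eventually_mem_Ioc] with ε hε z hz
    have hu1 := hK _ (norm_sub_smul_le le_rfl hz hε.1 hε.2)
    rw [norm_mul]
    refine mul_le_mul hu1 ?_ (norm_nonneg _) ((norm_nonneg _).trans hu1)
    refine ((fderiv ℝ ρ z).le_opNorm _).trans ?_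
    refine mul_le_mul (hK' z) ?_ (norm_nonneg _) ((norm_nonneg _).trans (hK' z))
    exact (norm_smul_sub_le hh hε.1 x z).trans (mul_le_of_le_one_right L.2 hz)
  · refine Eventually.of_forall fun z => ?_
    refine ((hu.tendsto x).comp (tendsto_sub_smul x z)).mul ?_
    refine ((fderiv ℝ ρ z).continuous.tendsto _).comp ?_
    -- The quotient is taken backwards, from `x` to `x - εz`: hence the direction `-z` here and the
    -- change of sign in `h2`.
    have h1 := (hx.hasFDerivAt.hasLineDerivAt (-z)).tendsto_slope_zero_right
    have h2 := h1.neg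
    simp only [map_neg, neg_neg] at h2
    refine h2.congr fun ε => ?_
    rw [← smul_neg, neg_sub, smul_neg, ← sub_eq_add_neg]

end Mollification

/-! ### Entropy rate at a fixed time and its limit as the mollification is removed -/

section FixedTime

variable {E : Type*} [NormedAddCommGroup E] [InnerProductSpace ℝ E] [FiniteDimensional ℝ E]
  [MeasurableSpace E] [BorelSpace E]

variable {ρ χ u v : E → ℝ} {h k : E → E} {ε : ℝ}

lemma mol_pos (hρ : IsMollifier ρ) (hu : Continuous u) (hpos : ∀ x, 0 < u x) (x : E) :
    0 < mol ρ ε u x := by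
  obtain ⟨y, -, hy⟩ := (isCompact_closedBall (0 : E) (‖x‖ + |ε|)).exists_isMinOn
    ⟨0, by simp; positivity⟩ hu.continuousOn
  have c0 := hρ.continuous
  have hi : Integrable fun z => ρ z * u (x - ε • z) :=
    Continuous.integrable_of_hasCompactSupport (by fun_prop) hρ.hasCompactSupport.mul_right
  refine (hpos y).trans_le ?_
  have e : ∫ z, ρ z * u y = u y := by rw [integral_mul_const, hρ.integral_eq, one_mul]
  rw [← e]
  refine integral_mono (hρ.integrable.mul_const _) hi fun z => ?_
  by_cases hz : 1 < ‖z‖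
  · simp [hρ.zero_of_lt z hz]
  refine mul_le_mul_of_nonneg_left (hy ?_) (hρ.nonneg z)
  rw [mem_closedBall_zero_iff]
  refine (norm_sub_le _ _).trans (add_le_add le_rfl ?_)
  rw [norm_smul, Real.norm_eq_abs]
  exact mul_le_of_le_one_right (abs_nonneg _) (not_lt.1 hz)

/-- The rate of change of `∫ χ U log (U / V)` for mollified solutions `U`, `V` of the continuity
equations with velocity fields `h` and `k`. -/
noncomputable def entropyRate (ρ : E → ℝ) (ε : ℝ) (χ u v : E → ℝ) (h k : E → E) : ℝ :=
  ∫ x, χ x * ((Real.log (mol ρ ε u x) - Real.log (mol ρ ε v x) + 1) * molDiv ρ ε u h x -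
    mol ρ ε u x / mol ρ ε v x * molDiv ρ ε v k x)

/-- The integrand of `entropyRate` after integration by parts. -/
noncomputable def entropyIntegrand (ρ : E → ℝ) (ε : ℝ) (χ u v : E → ℝ) (h k : E → E) (x : E) : ℝ :=
  χ x * ((Real.log (mol ρ ε u x) - Real.log (mol ρ ε v x) + 1) * molComm ρ ε u h x -
    mol ρ ε u x / mol ρ ε v x * molComm ρ ε v k x) +
  χ x * (mol ρ ε u x * (Real.log (mol ρ ε u x) - Real.log (mol ρ ε v x))) * dvg h x +
  mol ρ ε u x * (Real.log (mol ρ ε u x) - Real.log (mol ρ ε v x)) * fderiv ℝ χ x (h x) +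
  χ x * mol ρ ε u x * Real.log (mol ρ ε v x) * dvg (fun y => h y - k y) x +
  Real.log (mol ρ ε v x) * (mol ρ ε u x * fderiv ℝ χ x (h x - k x) +
    χ x * fderiv ℝ (mol ρ ε u) x (h x - k x))

lemma integrable_mul_dvg {ψ : E → ℝ} (hψ : Continuous ψ) (hc : HasCompactSupport ψ) {b : E → E}
    {L : NNReal} (hb : LipschitzWith L b) : Integrable fun x => ψ x * dvg b x := by
  refine (hψ.integrable_of_hasCompactSupport hc).mul_bdd (c := Module.finrank ℝ E * L)
    (measurable_dvg b).aestronglyMeasurable (Eventually.of_forall fun x => ?_)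
  exact abs_dvg_le hb x

/-- Write `U`, `V` for the mollifications and `b = h - k`. Replacing each `molDiv` by its commutator
minus transport leaves `-χ((log(U/V) + 1) DU(h) - (U/V) DV(k))`. Up to terms with `Dχ` and `DU`,
this is `-Dψ₁(h) - Dψ₂(b)` with `ψ₁ = χ U log(U/V)` and `ψ₂ = χ U log V`; two integrations by parts
then put the derivatives on `h` and `b`. No derivative of `V` survives, so bounds on `∇v` are not
needed later. -/
lemma entropyRate_eq (hρ : IsMollifier ρ) (hε : ε ≠ 0) (hχ : ContDiff ℝ 1 χ)
    (hχc : HasCompactSupport χ) (hu : ContDiff ℝ 1 u) (hv : ContDiff ℝ 1 v)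
    (hu0 : ∀ x, 0 < u x) (hv0 : ∀ x, 0 < v x) {L : NNReal} (hh : LipschitzWith L h)
    (hk : LipschitzWith L k) :
    entropyRate ρ ε χ u v h k = ∫ x, entropyIntegrand ρ ε χ u v h k x := by
  set U := mol ρ ε u with hU
  set V := mol ρ ε v with hV
  have U1 : ContDiff ℝ 1 U := contDiff_mol hρ hu
  have V1 : ContDiff ℝ 1 V := contDiff_mol hρ hv
  have U0 : ∀ x, 0 < U x := mol_pos hρ hu.continuous hu0
  have V0 : ∀ x, 0 < V x := mol_pos hρ hv.continuous hv0
  have lU : ContDiff ℝ 1 fun x => Real.log (U x) := U1.log fun x => (U0 x).ne'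
  have lV : ContDiff ℝ 1 fun x => Real.log (V x) := V1.log fun x => (V0 x).ne'
  set ψ₁ : E → ℝ := fun x => χ x * (U x * (Real.log (U x) - Real.log (V x))) with hψ₁
  set ψ₂ : E → ℝ := fun x => χ x * U x * Real.log (V x) with hψ₂
  have ψ₁1 : ContDiff ℝ 1 ψ₁ := hχ.mul (U1.mul (lU.sub lV))
  have ψ₂1 : ContDiff ℝ 1 ψ₂ := (hχ.mul U1).mul lV
  have ψ₁c : HasCompactSupport ψ₁ := hχc.mul_right
  have ψ₂c : HasCompactSupport ψ₂ := (hχc.mul_right (f' := U)).mul_right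
  have hb : LipschitzWith (L + L) fun y => h y - k y := hh.sub hk
  have i₁ := integral_mul_dvg ψ₁1 ψ₁c hh
  have i₂ := integral_mul_dvg ψ₂1 ψ₂c hb
  have d₁ : ∀ x w, fderiv ℝ ψ₁ x w = U x * (Real.log (U x) - Real.log (V x)) * fderiv ℝ χ x w
      + χ x * ((Real.log (U x) - Real.log (V x) + 1) * fderiv ℝ U x w
        - U x / V x * fderiv ℝ V x w) := fun x w => by
    have e1 := (U1.differentiable one_ne_zero x).hasFDerivAt
    have e2 := (V1.differentiable one_ne_zero x).hasFDerivAt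
    have e3 := (hχ.differentiable one_ne_zero x).hasFDerivAt
    have e := e3.mul (e1.mul ((e1.log (U0 x).ne').sub (e2.log (V0 x).ne')))
    have e' : fderiv ℝ ψ₁ x = _ := e.fderiv
    rw [e']
    simp
    field_simp [(U0 x).ne', (V0 x).ne']
    ring
  have d₂ : ∀ x w, fderiv ℝ ψ₂ x w = Real.log (V x) * (U x * fderiv ℝ χ x w
      + χ x * fderiv ℝ U x w) + χ x * (U x / V x * fderiv ℝ V x w) := fun x w => by
    have e1 := (U1.differentiable one_ne_zero x).hasFDerivAt
    have e2 := (V1.differentiable one_ne_zero x).hasFDerivAt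
    have e3 := (hχ.differentiable one_ne_zero x).hasFDerivAt
    have e := (e3.mul e1).mul (e2.log (V0 x).ne')
    have e' : fderiv ℝ ψ₂ x = _ := e.fderiv
    rw [e']
    simp
    field_simp [(U0 x).ne', (V0 x).ne']
    ring
  have cχ := hχ.continuous
  have cχ' := hχ.continuous_fderiv one_ne_zero
  have cU := U1.continuous
  have cV := V1.continuous
  have cU' := U1.continuous_fderiv one_ne_zero
  have clU := lU.continuous
  have clV := lV.continuous
  have ch := hh.continuous
  have ck := hk.continuous
  have cdiv : Continuous fun x => U x / V x := cU.div cV fun x => (V0 x).ne'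
  have cA : Continuous (molComm ρ ε u h) := continuous_molComm hρ hu.continuous ch
  have cB : Continuous (molComm ρ ε v k) := continuous_molComm hρ hv.continuous ck
  have cψ₁' := ψ₁1.continuous_fderiv one_ne_zero
  have cψ₂' := ψ₂1.continuous_fderiv one_ne_zero
  -- `P` collects the terms common to both sides; the sides differ from it only by the two
  -- integrations by parts `i₁` and `i₂`.
  set P : E → ℝ := fun x => χ x * ((Real.log (U x) - Real.log (V x) + 1) * molComm ρ ε u h x -
    U x / V x * molComm ρ ε v k x) + U x * (Real.log (U x) - Real.log (V x)) * fderiv ℝ χ x (h x)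
    + Real.log (V x) * (U x * fderiv ℝ χ x (h x - k x) + χ x * fderiv ℝ U x (h x - k x)) with hP
  have hPi : Integrable P := by
    refine Continuous.integrable_of_hasCompactSupport (by fun_prop) ?_
    have hz : ∀ x, x ∉ tsupport χ → χ x = 0 ∧ fderiv ℝ χ x = 0 := fun x hx =>
      ⟨image_eq_zero_of_notMem_tsupport hx,
        image_eq_zero_of_notMem_tsupport fun hx' => hx (tsupport_fderiv_subset ℝ hx')⟩
    refine HasCompactSupport.intro hχc fun x hx => ?_
    simp [hP, (hz x hx).1, (hz x hx).2]
  have hfi₁ : Integrable fun x => fderiv ℝ ψ₁ x (h x) := by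
    refine Continuous.integrable_of_hasCompactSupport (by fun_prop) ?_
    refine HasCompactSupport.intro (ψ₁c.fderiv ℝ) fun x hx => ?_
    simp [image_eq_zero_of_notMem_tsupport hx]
  have hfi₂ : Integrable fun x => fderiv ℝ ψ₂ x (h x - k x) := by
    refine Continuous.integrable_of_hasCompactSupport (by fun_prop) ?_
    refine HasCompactSupport.intro (ψ₂c.fderiv ℝ) fun x hx => ?_
    simp [image_eq_zero_of_notMem_tsupport hx]
  have e1 : entropyRate ρ ε χ u v h k
      = ∫ x, (P x - fderiv ℝ ψ₁ x (h x) - fderiv ℝ ψ₂ x (h x - k x)) := by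
    refine integral_congr_ae (Eventually.of_forall fun x => ?_)
    simp only [← hU, ← hV, hP, d₁, d₂, molComm_eq hρ hu ch hε, molComm_eq hρ hv ck hε]
    simp only [map_sub]
    ring
  have e2 : ∫ x, entropyIntegrand ρ ε χ u v h k x
      = ∫ x, (P x + ψ₁ x * dvg h x + ψ₂ x * dvg (fun y => h y - k y) x) := by
    refine integral_congr_ae (Eventually.of_forall fun x => ?_)
    simp only [entropyIntegrand, ← hU, ← hV, hP, hψ₁, hψ₂]
    ring
  have g₁ := integrable_mul_dvg ψ₁1.continuous ψ₁c hh
  have g₂ := integrable_mul_dvg ψ₂1.continuous ψ₂c hb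
  have s₁ := integral_sub (hPi.sub hfi₁) hfi₂
  have s₂ := integral_add (hPi.add g₁) g₂
  simp only [Pi.sub_apply] at s₁
  simp only [Pi.add_apply] at s₂
  rw [e1, e2, s₁, s₂, integral_sub hPi hfi₁, integral_add hPi g₁, i₁, i₂]
  ring

/-- The uniform bound for `entropyIntegrand`. -/
noncomputable def entropyBound (c m M l a D H M' : ℝ) : ℝ :=
  c * ((2 * l + 1) * a + M / m * a) + c * (M * (2 * l)) * D + M * (2 * l) * (c * H) +
    c * M * l * D + l * (M * (c * H) + c * (M' * H))

lemma abs_entropy_expr_le {c m M l a D H M' x U V lU lV A B dh db ch cb U' : ℝ} (hm : 0 < m)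
    (hx : |x| ≤ c) (hU : U ∈ Icc m M) (hV : V ∈ Icc m M) (hlU : |lU| ≤ l) (hlV : |lV| ≤ l)
    (hA : |A| ≤ a) (hB : |B| ≤ a) (hdh : |dh| ≤ D) (hdb : |db| ≤ D) (hch : |ch| ≤ c * H)
    (hcb : |cb| ≤ c * H) (hU' : |U'| ≤ M' * H) :
    |x * ((lU - lV + 1) * A - U / V * B) + x * (U * (lU - lV)) * dh + U * (lU - lV) * ch +
      x * U * lV * db + lV * (U * cb + x * U')| ≤ entropyBound c m M l a D H M' := by
  have c0 : 0 ≤ c := (abs_nonneg _).trans hx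
  have l0 : 0 ≤ l := (abs_nonneg _).trans hlU
  have a0 : 0 ≤ a := (abs_nonneg _).trans hA
  have D0 : 0 ≤ D := (abs_nonneg _).trans hdh
  have M0 : 0 < M := hm.trans_le (hU.1.trans hU.2)
  have hUa : |U| ≤ M := by rw [abs_of_pos (hm.trans_le hU.1)]; exact hU.2
  have hll : |lU - lV| ≤ 2 * l := (abs_sub _ _).trans (by linarith)
  have hll1 : |lU - lV + 1| ≤ 2 * l + 1 := (abs_add_le _ _).trans (by simpa using hll)
  have hdiv : |U / V| ≤ M / m := by
    rw [abs_div, abs_of_pos (hm.trans_le hV.1)]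
    exact div_le_div₀ M0.le hUa hm hV.1
  unfold entropyBound
  refine (abs_add_le _ _).trans (add_le_add ((abs_add_le _ _).trans (add_le_add
    ((abs_add_le _ _).trans (add_le_add ((abs_add_le _ _).trans (add_le_add ?_ ?_)) ?_)) ?_)) ?_)
  · rw [abs_mul]
    refine mul_le_mul hx ((abs_sub _ _).trans (add_le_add ?_ ?_)) (abs_nonneg _) c0
    · rw [abs_mul]; exact mul_le_mul hll1 hA (abs_nonneg _) (by positivity)
    · rw [abs_mul]; exact mul_le_mul hdiv hB (abs_nonneg _) (by positivity)
  · rw [abs_mul, abs_mul, abs_mul]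
    gcongr
  · rw [abs_mul, abs_mul]
    gcongr
  · rw [abs_mul, abs_mul, abs_mul]
    gcongr
  · rw [abs_mul]
    refine mul_le_mul hlV ((abs_add_le _ _).trans (add_le_add ?_ ?_)) (abs_nonneg _) l0
    · rw [abs_mul]; gcongr
    · rw [abs_mul]; gcongr

lemma abs_log_le {m M x : ℝ} (hm : 0 < m) (hx : x ∈ Icc m M) :
    |Real.log x| ≤ |Real.log m| + |Real.log M| := by
  have h1 := Real.log_le_log hm hx.1
  have h2 := Real.log_le_log (hm.trans_le hx.1) hx.2
  rw [abs_le]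
  constructor
  · linarith [neg_abs_le (Real.log m), abs_nonneg (Real.log M)]
  · linarith [le_abs_self (Real.log M), abs_nonneg (Real.log m)]

/-- The constant is chosen before the functions and before `ε`, so it serves for all times and all
small scales at once. A gradient bound is asked of `u` alone. -/
lemma exists_abs_entropyIntegrand_le (hρ : IsMollifier ρ) (c m M H R : ℝ) (L : NNReal) :
    ∃ K : ℝ, ∀ (χ u v : E → ℝ) (h k : E → E) (ε : ℝ), 0 < m → 0 < ε → ε ≤ 1 →
      (∀ x, |χ x| ≤ c) → (∀ x, ‖fderiv ℝ χ x‖ ≤ c) →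
      ContDiff ℝ 1 u → Continuous v → LipschitzWith L h → LipschitzWith L k →
      (∀ y, ‖y‖ ≤ R + 1 → u y ∈ Icc m M) → (∀ y, ‖y‖ ≤ R + 1 → v y ∈ Icc m M) →
      (∀ y, ‖y‖ ≤ R + 1 → ‖fderiv ℝ u y‖ ≤ M) →
      (∀ y, ‖y‖ ≤ R → ‖h y‖ ≤ H) → (∀ y, ‖y‖ ≤ R → ‖k y‖ ≤ H) →
      ∀ x, ‖x‖ ≤ R → |entropyIntegrand ρ ε χ u v h k x| ≤ K := by
  obtain ⟨K', -, hK'⟩ := hρ.exists_bound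
  refine ⟨entropyBound c m M (|Real.log m| + |Real.log M|)
    (M * (K' * L) * (volume : Measure E).real (Metric.closedBall 0 1))
    (Module.finrank ℝ E * (L + L : NNReal)) (2 * H) M,
    fun χ u v h k ε hm h0 h1 hχ hχ' hu hv hh hk hub hvb hu' hhb hkb x hx => ?_⟩
  have hU := mol_mem_Icc hρ hu.continuous h0 h1 hub hx
  have hV := mol_mem_Icc hρ hv h0 h1 hvb hx
  have hab : ∀ w : ℝ, w ∈ Icc m M → |w| ≤ M := fun w hw => by
    rw [abs_of_pos (hm.trans_le hw.1)]; exact hw.2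
  have hH : 0 ≤ H := (norm_nonneg _).trans (hhb x hx)
  have hbx : ‖h x - k x‖ ≤ 2 * H := (norm_sub_le _ _).trans (by linarith [hhb x hx, hkb x hx])
  have hc : 0 ≤ c := (abs_nonneg _).trans (hχ x)
  refine abs_entropy_expr_le hm (hχ x) hU hV (abs_log_le hm hU) (abs_log_le hm hV)
    (abs_molComm_le hρ hK' hh h0 h1 (fun y hy => hab _ (hub y hy)) hx)
    (abs_molComm_le hρ hK' hk h0 h1 (fun y hy => hab _ (hvb y hy)) hx)
    ((abs_dvg_le hh x).trans ?_) (abs_dvg_le (hh.sub hk) x) ?_ ?_ ?_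
  · gcongr
    exact le_add_of_nonneg_left zero_le
  · refine ((fderiv ℝ χ x).le_opNorm _).trans (mul_le_mul (hχ' x) ?_ (norm_nonneg _) hc)
    linarith [hhb x hx]
  · exact ((fderiv ℝ χ x).le_opNorm _).trans (mul_le_mul (hχ' x) hbx (norm_nonneg _) hc)
  · have := norm_fderiv_mol_le hρ hu h0 h1 hu' hx
    exact ((fderiv ℝ _ x).le_opNorm _).trans (mul_le_mul this hbx (norm_nonneg _)
      ((norm_nonneg _).trans this))

lemma entropyIntegrand_eq_zero {R : ℝ} (hχR : ∀ x, R < ‖x‖ → χ x = 0) (x : E) (hx : R < ‖x‖) :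
    entropyIntegrand ρ ε χ u v h k x = 0 := by
  have h1 : fderiv ℝ χ x = 0 := by
    have : χ =ᶠ[𝓝 x] fun _ => 0 := by
      filter_upwards [(isOpen_lt continuous_const continuous_norm).mem_nhds hx] with y hy
      exact hχR y hy
    rw [this.fderiv_eq]
    simp
  simp [entropyIntegrand, hχR x hx, h1]

lemma hasCompactSupport_of_ball {R : ℝ} (hχR : ∀ x : E, R < ‖x‖ → χ x = 0) :
    HasCompactSupport χ :=
  HasCompactSupport.intro (isCompact_closedBall (0 : E) R) fun z hz => hχR z (by simpa using hz)

lemma exists_abs_entropyRate_le (hρ : IsMollifier ρ) (c m M H R : ℝ) (L : NNReal) :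
    ∃ K : ℝ, ∀ (χ u v : E → ℝ) (h k : E → E) (ε : ℝ), 0 < m → 0 < ε → ε ≤ 1 →
      ContDiff ℝ 1 χ → (∀ x, R < ‖x‖ → χ x = 0) →
      (∀ x, |χ x| ≤ c) → (∀ x, ‖fderiv ℝ χ x‖ ≤ c) →
      ContDiff ℝ 1 u → ContDiff ℝ 1 v → (∀ x, 0 < u x) → (∀ x, 0 < v x) →
      LipschitzWith L h → LipschitzWith L k →
      (∀ y, ‖y‖ ≤ R + 1 → u y ∈ Icc m M) → (∀ y, ‖y‖ ≤ R + 1 → v y ∈ Icc m M) →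
      (∀ y, ‖y‖ ≤ R + 1 → ‖fderiv ℝ u y‖ ≤ M) →
      (∀ y, ‖y‖ ≤ R → ‖h y‖ ≤ H) → (∀ y, ‖y‖ ≤ R → ‖k y‖ ≤ H) →
      |entropyRate ρ ε χ u v h k| ≤ K := by
  obtain ⟨K, hK⟩ := exists_abs_entropyIntegrand_le hρ c m M H R L
  refine ⟨K * (volume : Measure E).real (Metric.closedBall 0 R), ?_⟩
  intro χ u v h k ε hm h0 h1 hχ1 hχR hχ hχ' hu hv hu0 hv0 hh hk hub hvb hu' hhb hkb
  rw [entropyRate_eq hρ h0.ne' hχ1 (hasCompactSupport_of_ball hχR) hu hv hu0 hv0 hh hk,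
    ← Real.norm_eq_abs]
  exact norm_integral_le_of_bounded_on_ball R K (entropyIntegrand_eq_zero hχR) fun z hz =>
    hK χ u v h k ε hm h0 h1 hχ hχ' hu hv.continuous hh hk hub hvb hu' hhb hkb z hz

/-- The localized entropy production. -/
noncomputable def entropyProduction (χ u v : E → ℝ) (h k : E → E) : ℝ :=
  ∫ x, (u x * (Real.log (u x) - Real.log (v x)) * fderiv ℝ χ x (h x) +
    u x * fderiv ℝ χ x (h x - k x) +
    χ x * (fderiv ℝ u x (h x - k x) - u x * (fderiv ℝ v x (h x - k x) / v x)))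

/-- The commutators tend to `-u div h` and `-v div k`, and the terms with `log(u/v) div h` cancel.
What remains is `(χ u log v - χ u) div(h - k)` plus first-order terms. As `v` itself is `C¹`,
integrating this by parts brings back the gradient of `v` and yields `entropyProduction`. -/
lemma tendsto_entropyRate (hρ : IsMollifier ρ) {R : ℝ} (hχ : ContDiff ℝ 1 χ)
    (hχR : ∀ x, R < ‖x‖ → χ x = 0) (hu : ContDiff ℝ 1 u) (hv : ContDiff ℝ 1 v)
    (hu0 : ∀ x, 0 < u x) (hv0 : ∀ x, 0 < v x) {L : NNReal} (hh : LipschitzWith L h)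
    (hk : LipschitzWith L k) :
    Tendsto (fun ε => entropyRate ρ ε χ u v h k) (𝓝[>] 0) (𝓝 (entropyProduction χ u v h k)) := by
  have hχc := hasCompactSupport_of_ball hχR
  have lu : ContDiff ℝ 1 fun x => Real.log (u x) := hu.log fun x => (hu0 x).ne'
  have lv : ContDiff ℝ 1 fun x => Real.log (v x) := hv.log fun x => (hv0 x).ne'
  have cχ := hχ.continuous
  have cχ' := hχ.continuous_fderiv one_ne_zero
  have cu := hu.continuous
  have cv := hv.continuous
  have cu' := hu.continuous_fderiv one_ne_zero
  have cv' := hv.continuous_fderiv one_ne_zero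
  have clu := lu.continuous
  have clv := lv.continuous
  have ch := hh.continuous
  have ck := hk.continuous
  have hb : LipschitzWith (L + L) fun y => h y - k y := hh.sub hk
  have hz : ∀ x, x ∉ tsupport χ → χ x = 0 ∧ fderiv ℝ χ x = 0 := fun x hx =>
    ⟨image_eq_zero_of_notMem_tsupport hx,
      image_eq_zero_of_notMem_tsupport fun hx' => hx (tsupport_fderiv_subset ℝ hx')⟩
  -- the limit of the integrand
  set J : E → ℝ := fun x => (χ x * u x * Real.log (v x) - χ x * u x) * dvg (fun y => h y - k y) x +
    (u x * (Real.log (u x) - Real.log (v x)) * fderiv ℝ χ x (h x) +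
    Real.log (v x) * (u x * fderiv ℝ χ x (h x - k x) + χ x * fderiv ℝ u x (h x - k x))) with hJ
  have hlim : Tendsto (fun ε => ∫ x, entropyIntegrand ρ ε χ u v h k x) (𝓝[>] 0)
      (𝓝 (∫ x, J x)) := by
    obtain ⟨c₁, hc₁⟩ := hχc.exists_bound_of_continuous cχ
    obtain ⟨c₂, hc₂⟩ := (hχc.fderiv ℝ).exists_bound_of_continuous cχ'
    obtain ⟨M₁, hM₁⟩ := exists_abs_le_of_continuous cu (R + 1)
    obtain ⟨M₂, hM₂⟩ := exists_abs_le_of_continuous cv (R + 1)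
    obtain ⟨M₃, hM₃⟩ := exists_abs_le_of_continuous cu' (R + 1)
    obtain ⟨M₄, hM₄⟩ := exists_abs_le_of_continuous
      (w := fun x => (u x)⁻¹) (cu.inv₀ fun x => (hu0 x).ne') (R + 1)
    obtain ⟨M₅, hM₅⟩ := exists_abs_le_of_continuous
      (w := fun x => (v x)⁻¹) (cv.inv₀ fun x => (hv0 x).ne') (R + 1)
    obtain ⟨H₁, hH₁⟩ := exists_abs_le_of_continuous ch R
    obtain ⟨H₂, hH₂⟩ := exists_abs_le_of_continuous ck R
    -- Upper bounds for `1/u` and `1/v` on the ball are turned into a common positive lower bound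
    -- for `u` and `v`.
    set m := (1 + |M₄| + |M₅|)⁻¹
    set M := |M₁| + |M₂| + |M₃|
    have hm : 0 < m := by positivity
    obtain ⟨K, hK⟩ := exists_abs_entropyIntegrand_le hρ (max c₁ c₂) m M (max H₁ H₂) R L
    have hlow : ∀ w : ℝ, 0 < w → w⁻¹ ≤ 1 + |M₄| + |M₅| → m ≤ w := fun w hw hle => by
      rw [← inv_inv w]
      exact inv_anti₀ (inv_pos.2 hw) hle
    refine tendsto_integral_of_bounded_on_ball R K ?_ ?_ ?_ ?_
    · refine Eventually.of_forall fun ε => ?_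
      have h1 := (contDiff_mol (ε := ε) hρ hu).continuous
      have h2 := (contDiff_mol (ε := ε) hρ hv).continuous
      have h3 := (contDiff_mol (ε := ε) hρ hu).continuous_fderiv one_ne_zero
      have h4 := h1.log fun x => (mol_pos hρ cu hu0 x).ne'
      have h5 := h2.log fun x => (mol_pos hρ cv hv0 x).ne'
      have h6 : Continuous fun x => mol ρ ε u x / mol ρ ε v x :=
        h1.div h2 fun x => (mol_pos hρ cv hv0 x).ne'
      have h7 := continuous_molComm (ε := ε) hρ cu ch
      have h8 := continuous_molComm (ε := ε) hρ cv ck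
      have h9 := measurable_dvg h
      have h10 := measurable_dvg fun y => h y - k y
      have h11 : Continuous fun x => fderiv ℝ (mol ρ ε u) x (h x - k x) := by fun_prop
      have h12 : Continuous fun x => fderiv ℝ χ x (h x - k x) := by fun_prop
      have h13 : Continuous fun x => fderiv ℝ χ x (h x) := by fun_prop
      unfold entropyIntegrand
      exact Measurable.aestronglyMeasurable (by fun_prop)
    · exact Eventually.of_forall fun ε => entropyIntegrand_eq_zero hχR
    · filter_upwards [eventually_mem_Ioc] with ε hε z hz
      refine hK χ u v h k ε hm hε.1 hε.2 (fun x => (hc₁ x).trans (le_max_left _ _))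
        (fun x => (hc₂ x).trans (le_max_right _ _)) hu cv hh hk
        (fun y hy => ⟨hlow _ (hu0 y) ?_, ?_⟩)
        (fun y hy => ⟨hlow _ (hv0 y) ?_, ?_⟩) (fun y hy => (hM₃ y hy).trans ?_)
        (fun y hy => (hH₁ y hy).trans (le_max_left _ _))
        (fun y hy => (hH₂ y hy).trans (le_max_right _ _)) z hz
      · linarith [hM₄ y hy, le_abs_self ((u y)⁻¹), le_abs_self M₄, abs_nonneg M₅,
          Real.norm_eq_abs ((u y)⁻¹)]
      · simp only [M]
        linarith [hM₁ y hy, le_abs_self (u y), le_abs_self M₁, abs_nonneg M₂, abs_nonneg M₃,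
          Real.norm_eq_abs (u y)]
      · linarith [hM₅ y hy, le_abs_self ((v y)⁻¹), le_abs_self M₅, abs_nonneg M₄,
          Real.norm_eq_abs ((v y)⁻¹)]
      · simp only [M]
        linarith [hM₂ y hy, le_abs_self (v y), le_abs_self M₂, abs_nonneg M₁, abs_nonneg M₃,
          Real.norm_eq_abs (v y)]
      · simp only [M]
        linarith [le_abs_self M₃, abs_nonneg M₁, abs_nonneg M₂]
    · filter_upwards [hh.ae_differentiableAt (μ := volume), hk.ae_differentiableAt (μ := volume)]
        with x hxh hxk
      have t1 := tendsto_mol hρ cu x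
      have t2 := tendsto_mol hρ cv x
      have t3 := t1.log (hu0 x).ne'
      have t4 := t2.log (hv0 x).ne'
      have t5 := tendsto_molComm hρ cu hh hxh
      have t6 := tendsto_molComm hρ cv hk hxk
      have t7 := tendsto_fderiv_mol hρ hu x (h x - k x)
      have t8 := t1.div t2 (hv0 x).ne'
      have t := (((((((t3.sub t4).add_const 1).mul t5).sub (t8.mul t6)).const_mul (χ x)).add
        (((t1.mul (t3.sub t4)).const_mul (χ x)).mul_const (dvg h x))).add
        ((t1.mul (t3.sub t4)).mul_const (fderiv ℝ χ x (h x)))).add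
        (((t1.const_mul (χ x)).mul t4).mul_const (dvg (fun y => h y - k y) x))
      have t' := t.add (t4.mul ((t1.mul_const (fderiv ℝ χ x (h x - k x))).add
        (t7.const_mul (χ x))))
      refine (t'.congr fun ε => ?_).trans_eq ?_
      · simp only [entropyIntegrand, Pi.div_apply]
      · congr 1
        simp only [hJ, dvg_sub hxh hxk]
        have := (hv0 x).ne'
        field_simp
        ring
  have hJe : ∫ x, J x = entropyProduction χ u v h k := by
    -- `ψ` is the coefficient of `div(h - k)` in the limit `J`.
    set ψ : E → ℝ := fun x => χ x * u x * Real.log (v x) - χ x * u x with hψ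
    have ψ1 : ContDiff ℝ 1 ψ := ((hχ.mul hu).mul lv).sub (hχ.mul hu)
    have ψc : HasCompactSupport ψ :=
      ((hχc.mul_right (f' := u)).mul_right).sub (hχc.mul_right (f' := u))
    have dψ : ∀ x w, fderiv ℝ ψ x w = (Real.log (v x) - 1) * (u x * fderiv ℝ χ x w
        + χ x * fderiv ℝ u x w) + χ x * (u x / v x * fderiv ℝ v x w) := fun x w => by
      have e1 := (hu.differentiable one_ne_zero x).hasFDerivAt
      have e2 := (hv.differentiable one_ne_zero x).hasFDerivAt
      have e3 := (hχ.differentiable one_ne_zero x).hasFDerivAt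
      have e := ((e3.mul e1).mul (e2.log (hv0 x).ne')).sub (e3.mul e1)
      have e' : fderiv ℝ ψ x = _ := e.fderiv
      rw [e']
      simp
      field_simp [(hv0 x).ne']
      ring
    have cψ' := ψ1.continuous_fderiv one_ne_zero
    have i₁ := integral_mul_dvg ψ1 ψc hb
    have g₁ := integrable_mul_dvg ψ1.continuous ψc hb
    have g₂ : Integrable fun x => (u x * (Real.log (u x) - Real.log (v x)) * fderiv ℝ χ x (h x) +
        Real.log (v x) * (u x * fderiv ℝ χ x (h x - k x) + χ x * fderiv ℝ u x (h x - k x))) := by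
      refine Continuous.integrable_of_hasCompactSupport (by fun_prop) ?_
      refine HasCompactSupport.intro hχc fun x hx => ?_
      simp [(hz x hx).1, (hz x hx).2]
    have g₃ : Integrable fun x => fderiv ℝ ψ x (h x - k x) := by
      refine Continuous.integrable_of_hasCompactSupport (by fun_prop) ?_
      refine HasCompactSupport.intro (ψc.fderiv ℝ) fun x hx => ?_
      simp [image_eq_zero_of_notMem_tsupport hx]
    rw [hJ, integral_add g₁ g₂, i₁, neg_add_eq_sub, ← integral_sub g₂ g₃, entropyProduction]
    refine integral_congr_ae (Eventually.of_forall fun x => ?_)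
    simp only [dψ]
    have := (hv0 x).ne'
    field_simp
    ring
  rw [← hJe]
  refine hlim.congr' ?_
  filter_upwards [self_mem_nhdsWithin] with ε hε
  exact (entropyRate_eq hρ (ne_of_gt hε) hχ hχc hu hv hu0 hv0 hh hk).symm

end FixedTime

/-! ### Chain rule in time for the entropy density -/

/-- Chain rule for `a log (a / c)` along Lipschitz curves given as primitives. -/
lemma entropy_chain_rule {T B m : ℝ} (hT : 0 ≤ T) {a c α β : ℝ → ℝ} (hm : 0 < m)
    (hα : Measurable α) (hβ : Measurable β) (hαB : ∀ t ∈ Icc 0 T, |α t| ≤ B)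
    (hβB : ∀ t ∈ Icc 0 T, |β t| ≤ B)
    (ha : ∀ t ∈ Icc 0 T, a t = a 0 + ∫ s in (0 : ℝ)..t, α s)
    (hc : ∀ t ∈ Icc 0 T, c t = c 0 + ∫ s in (0 : ℝ)..t, β s)
    (ham : ∀ t ∈ Icc 0 T, m ≤ a t) (hcm : ∀ t ∈ Icc 0 T, m ≤ c t) :
    a T * (Real.log (a T) - Real.log (c T)) - a 0 * (Real.log (a 0) - Real.log (c 0)) =
      ∫ t in (0 : ℝ)..T, ((Real.log (a t) - Real.log (c t) + 1) * α t - a t / c t * β t) := by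
  have hu : uIcc 0 T = Icc 0 T := uIcc_of_le hT
  have hint : ∀ γ : ℝ → ℝ, Measurable γ → (∀ t ∈ Icc 0 T, |γ t| ≤ B) →
      ∀ x ∈ Icc 0 T, ∀ y ∈ Icc 0 T, IntervalIntegrable γ volume x y := fun γ h1 h2 x hx y hy => by
    refine (intervalIntegrable_const (c := B)).mono_fun h1.aestronglyMeasurable ?_
    refine (ae_restrict_mem measurableSet_uIoc).mono fun t ht => ?_
    refine (h2 t ?_).trans (le_abs_self B)
    exact (uIoc_subset_uIcc.trans (uIcc_subset_Icc hx hy)) ht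
  have h0 : (0 : ℝ) ∈ Icc 0 T := ⟨le_rfl, hT⟩
  have hTT : T ∈ Icc 0 T := ⟨hT, le_rfl⟩
  have hlip : ∀ (γ b : ℝ → ℝ), Measurable γ → (∀ t ∈ Icc 0 T, |γ t| ≤ B) →
      (∀ t ∈ Icc 0 T, b t = b 0 + ∫ s in (0 : ℝ)..t, γ s) →
      LipschitzOnWith B.toNNReal b (Icc 0 T) := fun γ b h1 h2 h3 => by
    refine LipschitzOnWith.of_dist_le_mul fun x hx y hy => ?_
    rw [h3 x hx, h3 y hy, dist_add_left, dist_eq_norm, Real.dist_eq,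
      intervalIntegral.integral_interval_sub_left (hint γ h1 h2 0 h0 x hx)
        (hint γ h1 h2 0 h0 y hy)]
    refine (intervalIntegral.norm_integral_le_of_norm_le_const (C := B) fun t ht => h2 t
      ((uIoc_subset_uIcc.trans (uIcc_subset_Icc hy hx)) ht)).trans ?_
    exact mul_le_mul_of_nonneg_right (Real.le_coe_toNNReal B) (abs_nonneg _)
  have hlog : LipschitzOnWith (m⁻¹).toNNReal Real.log (Ici m) := by
    refine (convex_Ici m).lipschitzOnWith_of_nnnorm_hasDerivWithin_le
      (fun x hx => (Real.hasDerivAt_log (hm.trans_le hx).ne').hasDerivWithinAt) fun x hx => ?_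
    rw [← NNReal.coe_le_coe, coe_nnnorm, Real.coe_toNNReal _ (inv_pos.2 hm).le, norm_inv,
      Real.norm_of_nonneg (hm.trans_le hx).le]
    exact inv_anti₀ hm hx
  have la := hlip α a hα hαB ha
  have lc := hlip β c hβ hβB hc
  have lla := hlog.comp la (fun t ht => ham t ht)
  have llc := hlog.comp lc (fun t ht => hcm t ht)
  rw [← hu] at la lla llc
  -- On `[m, ∞)` the logarithm is Lipschitz with constant `1/m`, so the whole expression is
  -- absolutely continuous and equals the integral of its almost everywhere derivative.
  have hac := la.absolutelyContinuousOnInterval.mul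
    (lla.absolutelyContinuousOnInterval.sub llc.absolutelyContinuousOnInterval)
  have hftc := hac.integral_deriv_eq_sub
  simp only [Pi.mul_apply, Pi.sub_apply, Function.comp_apply] at hftc
  rw [← hftc]
  refine intervalIntegral.integral_congr_ae ?_
  -- The hypotheses hold on `[0,T]` only, so a two-sided derivative requires an interior time; `0`
  -- is already excluded by the half-open interval of integration.
  have hne : ∀ᵐ t : ℝ, t ≠ T := by simp [ae_iff, measure_singleton]
  filter_upwards [(hint α hα hαB 0 h0 T hTT).ae_hasDerivAt_integral,
    (hint β hβ hβB 0 h0 T hTT).ae_hasDerivAt_integral, hne] with t h1 h2 h3 ht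
  rw [uIoc_of_le hT] at ht
  have htI : t ∈ Icc 0 T := Ioc_subset_Icc_self ht
  have hnhds : Icc 0 T ∈ 𝓝 t := Icc_mem_nhds ht.1 (lt_of_le_of_ne ht.2 h3)
  have da : HasDerivAt a (α t) t := by
    refine ((h1 (hu ▸ htI) 0 (hu ▸ h0)).const_add (a 0)).congr_of_eventuallyEq ?_
    filter_upwards [hnhds] with s hs using ha s hs
  have dc : HasDerivAt c (β t) t := by
    refine ((h2 (hu ▸ htI) 0 (hu ▸ h0)).const_add (c 0)).congr_of_eventuallyEq ?_
    filter_upwards [hnhds] with s hs using hc s hs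
  have a0 := (hm.trans_le (ham t htI)).ne'
  have c0 := (hm.trans_le (hcm t htI)).ne'
  have e := (da.mul ((da.log a0).sub (dc.log c0))).deriv
  have e' : deriv (a * (Real.log ∘ a - Real.log ∘ c)) t = _ := e
  rw [e']
  simp only [Pi.sub_apply]
  field_simp
  ring

/-! ### Localized entropy identity for two continuity equations -/

section Evolution

variable {E : Type*} [NormedAddCommGroup E] [InnerProductSpace ℝ E] [FiniteDimensional ℝ E]
  [MeasurableSpace E] [BorelSpace E]

/-- The weak form of the continuity equation `∂ₜ u + div (u h) = 0` on `[0,T]`. -/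
def ContinuityEquation (T : ℝ) (u : ℝ → E → ℝ) (h : ℝ → E → E) : Prop :=
  ∀ φ : E → ℝ, ContDiff ℝ (⊤ : ℕ∞) φ → HasCompactSupport φ → ∀ t ∈ Icc 0 T,
    ∫ x, φ x * u t x = (∫ x, φ x * u 0 x) + ∫ s in (0 : ℝ)..t, ∫ x, u s x * fderiv ℝ φ x (h s x)

variable {ρ χ : E → ℝ} {ε T : ℝ} {u v : ℝ → E → ℝ} {h k : ℝ → E → E}

lemma integral_comp_sub_smul (hε : 0 < ε) (F : E → ℝ) (x : E) :
    ∫ z, F (x - ε • z) = (ε ^ Module.finrank ℝ E)⁻¹ * ∫ y, F y := by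
  rw [Measure.integral_comp_smul volume (fun z => F (x - z)) ε, integral_sub_left_eq_self,
    abs_of_pos (by positivity), smul_eq_mul]

/-- The weak equation is tested with the translated and rescaled kernel `y ↦ ρ((x - y)/ε)`; the
Jacobian of the scaling appears on both sides. -/
lemma mol_evolution (hρ : IsMollifier ρ) (hε : 0 < ε) (hu : ContinuityEquation T u h) (x : E)
    {t : ℝ} (ht : t ∈ Icc 0 T) :
    mol ρ ε (u t) x = mol ρ ε (u 0) x + ∫ s in (0 : ℝ)..t, molDiv ρ ε (u s) (h s) x := by
  set φ : E → ℝ := fun y => ρ (ε⁻¹ • (x - y)) with hφ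
  set c : ℝ := (ε ^ Module.finrank ℝ E)⁻¹ with hc
  have hz : ∀ z, ε⁻¹ • (x - (x - ε • z)) = z := fun z => by
    rw [sub_sub_cancel, inv_smul_smul₀ hε.ne']
  have hmol : ∀ w : E → ℝ, mol ρ ε w x = c * ∫ y, φ y * w y := fun w => by
    rw [← integral_comp_sub_smul hε (fun y => φ y * w y) x]
    simp only [hφ, hz]
    rfl
  have hφ1 : ContDiff ℝ (⊤ : ℕ∞) φ :=
    hρ.smooth.comp ((contDiff_const.sub contDiff_id).const_smul ε⁻¹)
  have hφc : HasCompactSupport φ := by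
    refine HasCompactSupport.intro (isCompact_closedBall x ε) fun y hy => hρ.zero_of_lt _ ?_
    rw [norm_smul, norm_inv, Real.norm_of_nonneg hε.le, lt_inv_mul_iff₀ hε, mul_one]
    rw [Metric.mem_closedBall, not_le, dist_eq_norm, norm_sub_rev] at hy
    exact hy
  have hd : ∀ y w, fderiv ℝ φ y w = - ε⁻¹ * fderiv ℝ ρ (ε⁻¹ • (x - y)) w := fun y w => by
    have h1 : HasFDerivAt φ _ y := (hρ.smooth.differentiable (by simp) _).hasFDerivAt.comp y
      (((hasFDerivAt_id y).const_sub x).const_smul ε⁻¹)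
    rw [h1.fderiv]
    simp
  have hdiv : ∀ s, molDiv ρ ε (u s) (h s) x = c * ∫ y, u s y * fderiv ℝ φ y (h s y) := fun s => by
    rw [← integral_comp_sub_smul hε (fun y => u s y * fderiv ℝ φ y (h s y)) x, molDiv,
      ← integral_const_mul]
    refine integral_congr_ae (Eventually.of_forall fun z => ?_)
    simp only [hd, hz]
    ring
  simp_rw [hmol, hdiv, intervalIntegral.integral_const_mul]
  rw [hu φ hφ1 hφc t ht, mul_add]

lemma measurable_mol (hρ : IsMollifier ρ) (hu : Measurable (Function.uncurry u)) :
    Measurable fun p : ℝ × E => mol ρ ε (u p.1) p.2 := by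
  have h1 := hρ.continuous.measurable
  have : Measurable fun p : (ℝ × E) × E => ρ p.2 * u p.1.1 (p.1.2 - ε • p.2) :=
    (h1.comp measurable_snd).mul (hu.comp (measurable_fst.fst.prodMk
      (measurable_fst.snd.sub (measurable_snd.const_smul ε))))
  exact this.stronglyMeasurable.integral_prod_right.measurable

lemma measurable_clm_apply {X : Type*} [MeasurableSpace X] {A : X → E →L[ℝ] ℝ} {w : X → E}
    (hA : Measurable A) (hw : Measurable w) : Measurable fun x => A x (w x) :=
  isBoundedBilinearMap_apply.continuous.measurable.comp (hA.prodMk hw)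

lemma measurable_molDiv (hρ : IsMollifier ρ) (hu : Measurable (Function.uncurry u))
    (hh : Measurable (Function.uncurry h)) :
    Measurable fun p : ℝ × E => molDiv ρ ε (u p.1) (h p.1) p.2 := by
  have h1 := hρ.continuous_fderiv.measurable
  have h2 : Measurable fun p : (ℝ × E) × E => (p.1.1, p.1.2 - ε • p.2) :=
    measurable_fst.fst.prodMk (measurable_fst.snd.sub (measurable_snd.const_smul ε))
  have : Measurable fun p : (ℝ × E) × E => u p.1.1 (p.1.2 - ε • p.2) *
      fderiv ℝ ρ p.2 (h p.1.1 (p.1.2 - ε • p.2)) :=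
    (hu.comp h2).mul (measurable_clm_apply (h1.comp measurable_snd) (hh.comp h2))
  exact this.stronglyMeasurable.integral_prod_right.measurable.const_mul _

/-- Local bounds, uniform in time, for two densities and their velocity fields. -/
structure LocalBounds (T : ℝ) (L : NNReal) (u v : ℝ → E → ℝ) (h k : ℝ → E → E) : Prop where
  contDiff_left : ∀ t ∈ Icc 0 T, ContDiff ℝ 1 (u t)
  contDiff_right : ∀ t ∈ Icc 0 T, ContDiff ℝ 1 (v t)
  pos_left : ∀ t ∈ Icc 0 T, ∀ x, 0 < u t x
  pos_right : ∀ t ∈ Icc 0 T, ∀ x, 0 < v t x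
  lipschitz_left : ∀ t ∈ Icc 0 T, LipschitzWith L (h t)
  lipschitz_right : ∀ t ∈ Icc 0 T, LipschitzWith L (k t)
  bounds : ∀ r : ℝ, ∃ m M : ℝ, 0 < m ∧ ∀ t ∈ Icc 0 T, ∀ y, ‖y‖ ≤ r →
    u t y ∈ Icc m M ∧ v t y ∈ Icc m M ∧ ‖fderiv ℝ (u t) y‖ ≤ M ∧ ‖h t y‖ ≤ M ∧ ‖k t y‖ ≤ M

lemma measurable_entropyRate_integrand (hρ : IsMollifier ρ) (hχ : Continuous χ)
    (hum : Measurable (Function.uncurry u)) (hvm : Measurable (Function.uncurry v))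
    (hhm : Measurable (Function.uncurry h)) (hkm : Measurable (Function.uncurry k)) :
    Measurable fun p : ℝ × E => χ p.2 *
      ((Real.log (mol ρ ε (u p.1) p.2) - Real.log (mol ρ ε (v p.1) p.2) + 1) *
        molDiv ρ ε (u p.1) (h p.1) p.2 -
      mol ρ ε (u p.1) p.2 / mol ρ ε (v p.1) p.2 * molDiv ρ ε (v p.1) (k p.1) p.2) := by
  have h1 := measurable_mol (ε := ε) hρ hum
  have h2 := measurable_mol (ε := ε) hρ hvm
  have h3 := measurable_molDiv (ε := ε) hρ hum hhm
  have h4 := measurable_molDiv (ε := ε) hρ hvm hkm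
  have h5 : Measurable fun p : ℝ × E => χ p.2 := hχ.measurable.comp measurable_snd
  exact h5.mul ((((h1.log.sub h2.log).add_const 1).mul h3).sub ((h1.div h2).mul h4))

lemma measurable_entropyRate (hρ : IsMollifier ρ) (hχ : Continuous χ)
    (hum : Measurable (Function.uncurry u)) (hvm : Measurable (Function.uncurry v))
    (hhm : Measurable (Function.uncurry h)) (hkm : Measurable (Function.uncurry k)) :
    Measurable fun t => entropyRate ρ ε χ (u t) (v t) (h t) (k t) :=
  (measurable_entropyRate_integrand hρ hχ hum hvm hhm
    hkm).stronglyMeasurable.integral_prod_right.measurable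

/-- For each `x` the mollified densities are Lipschitz in time and bounded below, so
`entropy_chain_rule` applies pointwise; integrating against `χ` and exchanging the integrals gives
the identity. -/
lemma mollified_entropy_evolution (hρ : IsMollifier ρ) (hT : 0 ≤ T) (h0 : 0 < ε) (h1 : ε ≤ 1)
    {R : ℝ} (hχ : ContDiff ℝ 1 χ) (hχR : ∀ x, R < ‖x‖ → χ x = 0)
    (hum : Measurable (Function.uncurry u)) (hvm : Measurable (Function.uncurry v))
    (hhm : Measurable (Function.uncurry h)) (hkm : Measurable (Function.uncurry k))
    {L : NNReal} (hb : LocalBounds T L u v h k)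
    (hu : ContinuityEquation T u h) (hv : ContinuityEquation T v k) :
    (∫ x, χ x * (mol ρ ε (u T) x * (Real.log (mol ρ ε (u T) x) - Real.log (mol ρ ε (v T) x)))) -
      (∫ x, χ x * (mol ρ ε (u 0) x * (Real.log (mol ρ ε (u 0) x) - Real.log (mol ρ ε (v 0) x)))) =
    ∫ t in (0 : ℝ)..T, entropyRate ρ ε χ (u t) (v t) (h t) (k t) := by
  have hχc := hasCompactSupport_of_ball hχR
  obtain ⟨K', -, hK'⟩ := hρ.exists_bound
  obtain ⟨m, M, hm, hmM⟩ := hb.bounds (R + 1)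
  set B := ε⁻¹ * (M * (K' * M) * (volume : Measure E).real (Metric.closedBall 0 1)) with hB
  have hab : ∀ w : ℝ, w ∈ Icc m M → |w| ≤ M := fun w hw => by
    rw [abs_of_pos (hm.trans_le hw.1)]; exact hw.2
  have bU : ∀ t ∈ Icc 0 T, ∀ x, ‖x‖ ≤ R → mol ρ ε (u t) x ∈ Icc m M := fun t ht x hx =>
    mol_mem_Icc hρ (hb.contDiff_left t ht).continuous h0 h1 (fun y hy => (hmM t ht y hy).1) hx
  have bV : ∀ t ∈ Icc 0 T, ∀ x, ‖x‖ ≤ R → mol ρ ε (v t) x ∈ Icc m M := fun t ht x hx =>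
    mol_mem_Icc hρ (hb.contDiff_right t ht).continuous h0 h1 (fun y hy => (hmM t ht y hy).2.1) hx
  have bdU : ∀ t ∈ Icc 0 T, ∀ x, ‖x‖ ≤ R → |molDiv ρ ε (u t) (h t) x| ≤ B := fun t ht x hx =>
    abs_molDiv_le hρ hK' h0 h1 (fun y hy => hab _ (hmM t ht y hy).1)
      (fun y hy => (hmM t ht y hy).2.2.2.1) hx
  have bdV : ∀ t ∈ Icc 0 T, ∀ x, ‖x‖ ≤ R → |molDiv ρ ε (v t) (k t) x| ≤ B := fun t ht x hx =>
    abs_molDiv_le hρ hK' h0 h1 (fun y hy => hab _ (hmM t ht y hy).2.1)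
      (fun y hy => (hmM t ht y hy).2.2.2.2) hx
  set G : ℝ → E → ℝ := fun t x => χ x *
      ((Real.log (mol ρ ε (u t) x) - Real.log (mol ρ ε (v t) x) + 1) * molDiv ρ ε (u t) (h t) x -
      mol ρ ε (u t) x / mol ρ ε (v t) x * molDiv ρ ε (v t) (k t) x) with hG
  have hGm : Measurable (Function.uncurry G) :=
    measurable_entropyRate_integrand hρ hχ.continuous hum hvm hhm hkm
  obtain ⟨c, hc⟩ := hχc.exists_bound_of_continuous hχ.continuous
  have hGz : ∀ t x, R < ‖x‖ → G t x = 0 := fun t x hx => by simp [hG, hχR x hx]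
  have hGb : ∀ t ∈ Icc 0 T, ∀ x, ‖x‖ ≤ R → |G t x| ≤
      c * ((2 * (|Real.log m| + |Real.log M|) + 1) * B + M / m * B) := fun t ht x hx => by
    have l1 := abs_log_le hm (bU t ht x hx)
    have l2 := abs_log_le hm (bV t ht x hx)
    have M0 : 0 ≤ M := (abs_nonneg _).trans (hab _ (bU t ht x hx))
    simp only [hG]
    rw [abs_mul]
    refine mul_le_mul (hc x) ((abs_sub _ _).trans (add_le_add ?_ ?_)) (abs_nonneg _)
      ((norm_nonneg _).trans (hc x))
    · rw [abs_mul]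
      refine mul_le_mul ?_ (bdU t ht x hx) (abs_nonneg _) (by positivity)
      refine (abs_add_le _ _).trans ?_
      rw [abs_one]
      have := abs_sub (Real.log (mol ρ ε (u t) x)) (Real.log (mol ρ ε (v t) x))
      linarith
    · rw [abs_mul, abs_div]
      refine mul_le_mul (div_le_div₀ M0 (hab _ (bU t ht x hx)) hm ?_) (bdV t ht x hx)
        (abs_nonneg _) (by positivity)
      exact (bV t ht x hx).1.trans (le_abs_self _)
  -- Fubini
  have hGi : Integrable (Function.uncurry G) ((volume.restrict (Ioc 0 T)).prod volume) := by
    set K := c * ((2 * (|Real.log m| + |Real.log M|) + 1) * B + M / m * B)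
    have hi : Integrable (fun p : ℝ × E => (1 : ℝ) * (Metric.closedBall (0 : E) R).indicator
        (fun _ => K) p.2) ((volume.restrict (Ioc 0 T)).prod volume) := by
      refine Integrable.mul_prod (f := fun _ : ℝ => (1 : ℝ)) ?_ ?_
      · exact integrable_const _
      · rw [integrable_indicator_iff Metric.isClosed_closedBall.measurableSet]
        exact integrableOn_const (measure_closedBall_lt_top.ne)
    refine hi.mono' hGm.aestronglyMeasurable ?_
    have hae : ∀ᵐ p ∂((volume.restrict (Ioc 0 T)).prod (volume : Measure E)), p.1 ∈ Ioc 0 T :=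
      Measure.quasiMeasurePreserving_fst.ae (ae_restrict_mem measurableSet_Ioc)
    filter_upwards [hae] with p hp
    rw [one_mul]
    by_cases hx : ‖p.2‖ ≤ R
    · rw [indicator_of_mem (by simpa using hx)]
      exact hGb p.1 (Ioc_subset_Icc_self hp) p.2 hx
    · rw [indicator_of_notMem (by simpa using hx)]
      simp only [Function.uncurry]
      rw [hGz p.1 p.2 (not_le.1 hx), norm_zero]
  have hswap : ∫ t in (0 : ℝ)..T, entropyRate ρ ε χ (u t) (v t) (h t) (k t) =
      ∫ x, ∫ t in (0 : ℝ)..T, G t x := by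
    simp_rw [intervalIntegral.integral_of_le hT]
    exact integral_integral_swap hGi
  have hpt : ∀ x, ∫ t in (0 : ℝ)..T, G t x =
      χ x * (mol ρ ε (u T) x * (Real.log (mol ρ ε (u T) x) - Real.log (mol ρ ε (v T) x))) -
      χ x * (mol ρ ε (u 0) x * (Real.log (mol ρ ε (u 0) x) - Real.log (mol ρ ε (v 0) x))) :=
    fun x => by
    by_cases hx : ‖x‖ ≤ R
    · rw [← mul_sub, entropy_chain_rule hT hm (a := fun t => mol ρ ε (u t) x)
        (c := fun t => mol ρ ε (v t) x) (α := fun t => molDiv ρ ε (u t) (h t) x)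
        (β := fun t => molDiv ρ ε (v t) (k t) x)
        ((measurable_molDiv hρ hum hhm).comp measurable_prodMk_right)
        ((measurable_molDiv hρ hvm hkm).comp measurable_prodMk_right)
        (fun t ht => bdU t ht x hx) (fun t ht => bdV t ht x hx)
        (fun t ht => mol_evolution hρ h0 hu x ht) (fun t ht => mol_evolution hρ h0 hv x ht)
        (fun t ht => (bU t ht x hx).1) (fun t ht => (bV t ht x hx).1),
        ← intervalIntegral.integral_const_mul]
    · simp [hG, hχR x (not_le.1 hx)]
  rw [hswap]
  simp_rw [hpt]
  have hTT : T ∈ Icc 0 T := ⟨hT, le_rfl⟩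
  have h00 : (0 : ℝ) ∈ Icc 0 T := ⟨le_rfl, hT⟩
  have hint : ∀ t ∈ Icc 0 T, Integrable fun x => χ x * (mol ρ ε (u t) x *
      (Real.log (mol ρ ε (u t) x) - Real.log (mol ρ ε (v t) x))) := fun t ht => by
    have c1 := (contDiff_mol (ε := ε) hρ (hb.contDiff_left t ht)).continuous
    have c2 := (contDiff_mol (ε := ε) hρ (hb.contDiff_right t ht)).continuous
    have c3 := c1.log fun x =>
      (mol_pos hρ (hb.contDiff_left t ht).continuous (hb.pos_left t ht) x).ne'
    have c4 := c2.log fun x =>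
      (mol_pos hρ (hb.contDiff_right t ht).continuous (hb.pos_right t ht) x).ne'
    have c5 := hχ.continuous
    exact Continuous.integrable_of_hasCompactSupport (by fun_prop) hχc.mul_right
  exact (integral_sub (hint T hTT) (hint 0 h00)).symm

/-- The localized relative entropy identity for two solutions of continuity equations. -/
theorem entropy_evolution (hT : 0 ≤ T)
    {R : ℝ} (hχ : ContDiff ℝ 1 χ) (hχR : ∀ x, R < ‖x‖ → χ x = 0)
    (hum : Measurable (Function.uncurry u)) (hvm : Measurable (Function.uncurry v))
    (hhm : Measurable (Function.uncurry h)) (hkm : Measurable (Function.uncurry k))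
    {L : NNReal} (hb : LocalBounds T L u v h k)
    (hu : ContinuityEquation T u h) (hv : ContinuityEquation T v k) :
    IntervalIntegrable (fun t => entropyProduction χ (u t) (v t) (h t) (k t)) volume 0 T ∧
    (∫ x, χ x * (u T x * (Real.log (u T x) - Real.log (v T x)))) -
      (∫ x, χ x * (u 0 x * (Real.log (u 0 x) - Real.log (v 0 x)))) =
    ∫ t in (0 : ℝ)..T, entropyProduction χ (u t) (v t) (h t) (k t) := by
  obtain ⟨ρ, hρ⟩ := exists_isMollifier E
  have hχc := hasCompactSupport_of_ball hχR
  obtain ⟨m, M, hm, hmM⟩ := hb.bounds (R + 1)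
  obtain ⟨c₁, hc₁⟩ := hχc.exists_bound_of_continuous hχ.continuous
  obtain ⟨c₂, hc₂⟩ := (hχc.fderiv ℝ).exists_bound_of_continuous
    (hχ.continuous_fderiv one_ne_zero)
  obtain ⟨K, hK⟩ := exists_abs_entropyRate_le hρ (max c₁ c₂) m M M R L
  -- `K` depends neither on `ε` nor on `t`: it dominates the time integral as `ε → 0` and bounds the
  -- limit.
  have hKt : ∀ ε ∈ Ioc (0 : ℝ) 1, ∀ t ∈ Icc 0 T,
      |entropyRate ρ ε χ (u t) (v t) (h t) (k t)| ≤ K := fun ε hε t ht =>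
    hK χ (u t) (v t) (h t) (k t) ε hm hε.1 hε.2 hχ hχR (fun x => (hc₁ x).trans (le_max_left _ _))
      (fun x => (hc₂ x).trans (le_max_right _ _)) (hb.contDiff_left t ht) (hb.contDiff_right t ht)
      (hb.pos_left t ht) (hb.pos_right t ht) (hb.lipschitz_left t ht) (hb.lipschitz_right t ht)
      (fun y hy => (hmM t ht y hy).1) (fun y hy => (hmM t ht y hy).2.1)
      (fun y hy => (hmM t ht y hy).2.2.1)
      (fun y hy => (hmM t ht y (hy.trans (by linarith))).2.2.2.1)
      (fun y hy => (hmM t ht y (hy.trans (by linarith))).2.2.2.2)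
  have hlim : ∀ t ∈ Icc 0 T, Tendsto (fun ε => entropyRate ρ ε χ (u t) (v t) (h t) (k t)) (𝓝[>] 0)
      (𝓝 (entropyProduction χ (u t) (v t) (h t) (k t))) := fun t ht =>
    tendsto_entropyRate hρ hχ hχR (hb.contDiff_left t ht) (hb.contDiff_right t ht)
      (hb.pos_left t ht) (hb.pos_right t ht) (hb.lipschitz_left t ht) (hb.lipschitz_right t ht)
  have hmeas : ∀ ε, Measurable fun t => entropyRate ρ ε χ (u t) (v t) (h t) (k t) := fun ε =>
    measurable_entropyRate hρ hχ.continuous hum hvm hhm hkm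
  have hu0 : uIoc 0 T ⊆ Icc 0 T := by rw [uIoc_of_le hT]; exact Ioc_subset_Icc_self
  have hint : Tendsto (fun ε => ∫ t in (0 : ℝ)..T, entropyRate ρ ε χ (u t) (v t) (h t) (k t))
      (𝓝[>] 0) (𝓝 (∫ t in (0 : ℝ)..T, entropyProduction χ (u t) (v t) (h t) (k t))) := by
    refine intervalIntegral.tendsto_integral_filter_of_dominated_convergence (fun _ => K)
      (Eventually.of_forall fun ε => (hmeas ε).aestronglyMeasurable) ?_ intervalIntegrable_const ?_
    · filter_upwards [eventually_mem_Ioc] with ε hε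
      exact Eventually.of_forall fun t ht => hKt ε hε t (hu0 ht)
    · exact Eventually.of_forall fun t ht => hlim t (hu0 ht)
  have hmono : ∀ t ∈ Icc 0 T, |entropyProduction χ (u t) (v t) (h t) (k t)| ≤ K := fun t ht =>
    le_of_tendsto (hlim t ht).abs <| by
      filter_upwards [eventually_mem_Ioc] with ε hε using hKt ε hε t ht
  refine ⟨?_, ?_⟩
  · refine (intervalIntegrable_const (c := K)).mono_fun ?_ ?_
    -- Measurability in time of the production is inherited from the mollified rates.
    · refine aestronglyMeasurable_of_tendsto_ae (𝓝[>] (0 : ℝ))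
        (fun ε => (hmeas ε).aestronglyMeasurable) ?_
      exact (ae_restrict_mem measurableSet_uIoc).mono fun t ht => hlim t (hu0 ht)
    · exact (ae_restrict_mem measurableSet_uIoc).mono fun t ht =>
        (hmono t (hu0 ht)).trans (le_abs_self K)
  · have hend : ∀ t ∈ Icc 0 T, Tendsto (fun ε => ∫ x, χ x * (mol ρ ε (u t) x *
        (Real.log (mol ρ ε (u t) x) - Real.log (mol ρ ε (v t) x)))) (𝓝[>] 0)
        (𝓝 (∫ x, χ x * (u t x * (Real.log (u t x) - Real.log (v t x))))) := fun t ht => by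
      have cu := (hb.contDiff_left t ht).continuous
      have cv := (hb.contDiff_right t ht).continuous
      refine tendsto_integral_of_bounded_on_ball R
        (c₁ * (M * (2 * (|Real.log m| + |Real.log M|)))) ?_ ?_ ?_ ?_
      · refine Eventually.of_forall fun ε => ?_
        have c1 := (contDiff_mol (ε := ε) hρ (hb.contDiff_left t ht)).continuous
        have c2 := (contDiff_mol (ε := ε) hρ (hb.contDiff_right t ht)).continuous
        have c3 := c1.log fun x => (mol_pos hρ cu (hb.pos_left t ht) x).ne'
        have c4 := c2.log fun x => (mol_pos hρ cv (hb.pos_right t ht) x).ne'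
        have c5 := hχ.continuous
        exact Continuous.aestronglyMeasurable (by fun_prop)
      · exact Eventually.of_forall fun ε x hx => by simp [hχR x hx]
      · filter_upwards [eventually_mem_Ioc] with ε hε x hx
        have b1 := mol_mem_Icc hρ cu hε.1 hε.2 (fun y hy => (hmM t ht y hy).1) hx
        have b2 := mol_mem_Icc hρ cv hε.1 hε.2 (fun y hy => (hmM t ht y hy).2.1) hx
        have l1 := abs_log_le hm b1
        have l2 := abs_log_le hm b2
        rw [norm_mul, norm_mul, Real.norm_of_nonneg (hm.le.trans b1.1)]
        refine mul_le_mul (hc₁ x) (mul_le_mul b1.2 ?_ (norm_nonneg _)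
          (hm.le.trans (b1.1.trans b1.2))) ?_ ((norm_nonneg _).trans (hc₁ x))
        · refine (abs_sub _ _).trans ?_
          linarith
        · exact mul_nonneg (hm.le.trans b1.1) (norm_nonneg _)
      · refine Eventually.of_forall fun x => ?_
        have t1 := tendsto_mol hρ cu x
        have t2 := tendsto_mol hρ cv x
        exact (t1.mul ((t1.log (hb.pos_left t ht x).ne').sub
          (t2.log (hb.pos_right t ht x).ne'))).const_mul (χ x)
    refine tendsto_nhds_unique ((hend T ⟨hT, le_rfl⟩).sub (hend 0 ⟨le_rfl, hT⟩)) ?_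
    refine hint.congr' ?_
    filter_upwards [eventually_mem_Ioc] with ε hε
    exact (mollified_entropy_evolution hρ hT hε.1 hε.2 hχ hχR hum hvm hhm hkm hb hu hv).symm

end Evolution

/-! ### Density of the terminal Gaussian law -/

section Gaussian

variable {d : ℕ}

lemma isFiniteMeasure_densityMeasure_of_integrable {ρ : EuclideanSpace ℝ (Fin d) → ℝ}
    (h : Integrable ρ) : IsFiniteMeasure (densityMeasure ρ) :=
  isFiniteMeasure_withDensity_ofReal h.hasFiniteIntegral

/-- The centered Gaussian has the usual density. -/
lemma exists_centeredGaussian_eq {σ : ℝ} (hσ : 0 < σ) : ∃ κ > 0,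
    centeredGaussian d σ = densityMeasure fun x => κ * Real.exp (-(‖x‖ ^ 2 / (2 * σ ^ 2))) := by
  set b : ℝ := (2 * σ ^ 2)⁻¹ with hb
  have hb0 : 0 < b := by positivity
  have hbre : 0 < (b : ℂ).re := by simpa using hb0
  have hI : Integrable fun x : EuclideanSpace ℝ (Fin d) => Real.exp (-b * ‖x‖ ^ 2) := by
    have := (GaussianFourier.integrable_cexp_neg_mul_sq_norm_add (V := EuclideanSpace ℝ (Fin d))
      hbre 0 0).re
    refine this.congr (Eventually.of_forall fun x => ?_)
    simp only [zero_mul, add_zero]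
    rw [← Complex.ofReal_pow, ← Complex.ofReal_neg, ← Complex.ofReal_mul, ← Complex.ofReal_exp]
    exact Complex.ofReal_re _
  have hpos : 0 < ∫ x : EuclideanSpace ℝ (Fin d), Real.exp (-b * ‖x‖ ^ 2) := by
    rw [GaussianFourier.integral_rexp_neg_mul_sq_norm hb0]
    positivity
  set κ := (∫ x : EuclideanSpace ℝ (Fin d), Real.exp (-b * ‖x‖ ^ 2))⁻¹ with hκ
  have hκ0 : 0 < κ := inv_pos.2 hpos
  refine ⟨κ, hκ0, ?_⟩
  have hfun : (fun x : EuclideanSpace ℝ (Fin d) => κ * Real.exp (-(‖x‖ ^ 2 / (2 * σ ^ 2)))) =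
      fun x => κ * Real.exp (-b * ‖x‖ ^ 2) := by
    funext x
    rw [hb]
    congr 2
    ring
  rw [hfun]
  have : IsFiniteMeasure (densityMeasure fun x : EuclideanSpace ℝ (Fin d) =>
      κ * Real.exp (-b * ‖x‖ ^ 2)) :=
    isFiniteMeasure_densityMeasure_of_integrable (hI.const_mul κ)
  have : IsProbabilityMeasure (centeredGaussian d σ) :=
    Measure.isProbabilityMeasure_map (by fun_prop)
  -- Both sides are finite measures, so it suffices to compare characteristic functions. With `b =
  -- 1/(2σ²)`, the Gaussian Fourier integral gives `exp(-σ²‖t‖²/2)` after normalization by `κ`.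
  refine Measure.ext_of_charFun (funext fun t => ?_)
  rw [centeredGaussian, charFun_map_smul, charFun_stdGaussian, charFun_apply, densityMeasure,
    integral_withDensity_eq_integral_toReal_smul (by fun_prop)
      (Eventually.of_forall fun x => ENNReal.ofReal_lt_top)]
  have h1 : ∀ x : EuclideanSpace ℝ (Fin d), (ENNReal.ofReal (κ * Real.exp (-b * ‖x‖ ^ 2))).toReal •
      Complex.exp (inner ℝ x t * Complex.I) =
      (κ : ℂ) * Complex.exp (-(b : ℂ) * ‖x‖ ^ 2 + Complex.I * inner ℝ t x) := fun x => by
    rw [ENNReal.toReal_ofReal (by positivity), Complex.real_smul, Complex.exp_add,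
      real_inner_comm]
    push_cast
    ring_nf
  simp_rw [h1]
  rw [integral_const_mul, GaussianFourier.integral_cexp_neg_mul_sq_norm_add hbre]
  have h2 : (κ : ℂ) * ((Real.pi : ℂ) / b) ^
      ((Module.finrank ℝ (EuclideanSpace ℝ (Fin d)) : ℂ) / 2) = 1 := by
    rw [← GaussianFourier.integral_cexp_neg_mul_sq_norm hbre, hκ]
    have : (∫ v : EuclideanSpace ℝ (Fin d), Complex.exp (-(b : ℂ) * ‖v‖ ^ 2)) =
        ((∫ x : EuclideanSpace ℝ (Fin d), Real.exp (-b * ‖x‖ ^ 2) : ℝ) : ℂ) := by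
      rw [← integral_complex_ofReal]
      refine integral_congr_ae (Eventually.of_forall fun x => ?_)
      push_cast
      rfl
    rw [this, ← Complex.ofReal_mul, inv_mul_cancel₀ hpos.ne', Complex.ofReal_one]
  rw [← mul_assoc, h2, one_mul]
  congr 1
  rw [hb, Complex.I_sq, norm_smul, Real.norm_of_nonneg hσ.le]
  have : (σ : ℂ) ≠ 0 := by exact_mod_cast hσ.ne'
  push_cast
  field_simp
  ring

end Gaussian

/-! ### Pointwise values of a continuous density from small balls -/

section Density

variable {d : ℕ} {ρ : EuclideanSpace ℝ (Fin d) → ℝ} {a : ℝ} {x : EuclideanSpace ℝ (Fin d)}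

/-- Were `ρ x < a`, continuity would keep `ρ` below some `w < a` near `x`, and small balls would
have too little mass. Together with its counterpart, this converts inclusions between events into
pointwise density bounds. -/
lemma le_density_of_ball (hρ : ContinuousAt ρ x) (ha : 0 < a)
    (h : ∀ᶠ r in 𝓝[>] (0 : ℝ), ENNReal.ofReal a * volume (Metric.ball x r) ≤
      densityMeasure ρ (Metric.ball x r)) : a ≤ ρ x := by
  by_contra! hlt
  obtain ⟨w, hw1, hw2⟩ := exists_between hlt
  obtain ⟨δ, hδ, hball⟩ := Metric.eventually_nhds_iff_ball.1 (hρ.eventually (gt_mem_nhds hw1))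
  obtain ⟨r, hr, hr0, hrδ⟩ := (h.and (Ioc_mem_nhdsGT hδ)).exists
  have hV := Metric.measure_ball_pos volume x hr0
  have hV' : volume (Metric.ball x r) ≠ ⊤ := measure_ball_lt_top.ne
  have h2 : densityMeasure ρ (Metric.ball x r) ≤ ENNReal.ofReal w * volume (Metric.ball x r) := by
    rw [densityMeasure, withDensity_apply _ measurableSet_ball, ← setLIntegral_const]
    refine setLIntegral_mono measurable_const fun y hy => ?_
    exact ENNReal.ofReal_le_ofReal (hball y (Metric.ball_subset_ball hrδ hy)).le
  have h3 := hr.trans h2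
  rw [ENNReal.mul_le_mul_iff_left hV.ne' hV'] at h3
  have h4 := (ENNReal.ofReal_le_ofReal_iff').1 h3
  rcases h4 with h4 | h4 <;> linarith

lemma density_le_of_ball (hρ : ContinuousAt ρ x) (ha : 0 ≤ a)
    (h : ∀ᶠ r in 𝓝[>] (0 : ℝ), densityMeasure ρ (Metric.ball x r) ≤
      ENNReal.ofReal a * volume (Metric.ball x r)) : ρ x ≤ a := by
  by_contra! hlt
  obtain ⟨w, hw1, hw2⟩ := exists_between hlt
  obtain ⟨δ, hδ, hball⟩ := Metric.eventually_nhds_iff_ball.1 (hρ.eventually (lt_mem_nhds hw2))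
  obtain ⟨r, hr, hr0, hrδ⟩ := (h.and (Ioc_mem_nhdsGT hδ)).exists
  have hV := Metric.measure_ball_pos volume x hr0
  have hV' : volume (Metric.ball x r) ≠ ⊤ := measure_ball_lt_top.ne
  have h2 : ENNReal.ofReal w * volume (Metric.ball x r) ≤ densityMeasure ρ (Metric.ball x r) := by
    rw [densityMeasure, withDensity_apply _ measurableSet_ball, ← setLIntegral_const]
    refine setLIntegral_mono' measurableSet_ball fun y hy => ?_
    exact ENNReal.ofReal_le_ofReal (hball y (Metric.ball_subset_ball hrδ hy)).le
  have h3 := h2.trans hr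
  rw [ENNReal.mul_le_mul_iff_left hV.ne' hV'] at h3
  have h4 := (ENNReal.ofReal_le_ofReal_iff').1 h3
  rcases h4 with h4 | h4 <;> linarith

end Density

/-! ### Grönwall inequalities in integral form -/

section Gronwall

lemma le_exp_of_le_integral {φ : ℝ → ℝ} {a b A K : ℝ} (hK : 0 ≤ K) (hφ : ContinuousOn φ (Icc a b))
    (h : ∀ t ∈ Icc a b, φ t ≤ A + K * ∫ s in a..t, φ s) :
    ∀ t ∈ Icc a b, φ t ≤ A * Real.exp (K * (t - a)) := by
  intro t₀ ht₀
  have hab : a ≤ b := ht₀.1.trans ht₀.2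
  -- The constant extension makes the integrand continuous on the line, so its primitive is
  -- differentiable everywhere, endpoints included.
  set φ' : ℝ → ℝ := IccExtend hab ((Icc a b).domRestrict φ) with hφ'
  have hc : Continuous φ' := hφ.domRestrict.Icc_extend'
  have he : ∀ t ∈ Icc a b, φ' t = φ t := fun t ht => IccExtend_of_mem hab _ ht
  have hi : ∀ t ∈ Icc a b, ∫ s in a..t, φ s = ∫ s in a..t, φ' s := fun t ht => by
    refine intervalIntegral.integral_congr fun s hs => (he s ?_).symm
    rw [uIcc_of_le ht.1] at hs
    exact ⟨hs.1, hs.2.trans ht.2⟩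
  set ψ : ℝ → ℝ := fun t => A + K * ∫ s in a..t, φ' s with hψ
  have hd : ∀ t, HasDerivAt ψ (K * φ' t) t := fun t =>
    ((intervalIntegral.integral_hasDerivAt_right (hc.intervalIntegrable _ _)
      (hc.stronglyMeasurableAtFilter _ _) hc.continuousAt).const_mul K).const_add A
  have hle : ∀ t ∈ Icc a b, φ t ≤ ψ t := fun t ht => by
    rw [hψ]; simp only; rw [← hi t ht]; exact h t ht
  have key := le_gronwallBound_of_liminf_deriv_right_le (f := ψ) (f' := fun t => K * φ' t)
    (δ := A) (K := K) (ε := 0) (a := a) (b := b)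
    (fun t _ => (hd t).continuousAt.continuousWithinAt)
    (fun t _ r hr => ((hd t).hasDerivWithinAt.liminf_right_slope_le hr)) (by simp [hψ])
    (fun t ht => by
      rw [add_zero, he t (Ico_subset_Icc_self ht)]
      exact mul_le_mul_of_nonneg_left (hle t (Ico_subset_Icc_self ht)) hK) t₀ ht₀
  rw [gronwallBound_ε0] at key
  exact (hle t₀ ht₀).trans key

/-- Time reversal `t ↦ -t` of the forward inequality. -/
lemma le_exp_of_le_integral_right {φ : ℝ → ℝ} {a b A K : ℝ} (hK : 0 ≤ K)
    (hφ : ContinuousOn φ (Icc a b))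
    (h : ∀ t ∈ Icc a b, φ t ≤ A + K * ∫ s in t..b, φ s) :
    ∀ t ∈ Icc a b, φ t ≤ A * Real.exp (K * (b - t)) := by
  intro t ht
  have key := le_exp_of_le_integral (φ := fun s => φ (-s)) (a := -b) (b := -a) (A := A) hK
    (hφ.comp continuous_neg.continuousOn fun s hs => ⟨by linarith [hs.2], by linarith [hs.1]⟩)
    (fun s hs => by
      have := h (-s) ⟨by linarith [hs.2], by linarith [hs.1]⟩
      rwa [intervalIntegral.integral_comp_neg, neg_neg]) (-t)
    ⟨by linarith [ht.2], by linarith [ht.1]⟩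
  simp only [neg_neg] at key
  rwa [show -t - -b = b - t by ring] at key

end Gronwall

/-! ### Ordinary differential equations with Lipschitz fields measurable in time -/

section Curves

variable {E : Type*} [NormedAddCommGroup E] [InnerProductSpace ℝ E] [FiniteDimensional ℝ E]
  [MeasurableSpace E] [BorelSpace E]

/-- Solutions, in integral form, of `γ' = h (γ, t)` on `[a,b]`. -/
structure IsSolution (h : E → ℝ → E) (a b : ℝ) (γ : ℝ → E) : Prop where
  continuousOn : ContinuousOn γ (Icc a b)
  equation : ∀ t ∈ Icc a b, γ t = γ a + ∫ u in a..t, h (γ u) u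

/-- A measurable vector field which on `[a,b]` is Lipschitz in space with linear growth. -/
structure IsLipschitzField (h : E → ℝ → E) (a b : ℝ) (L : ℝ) : Prop where
  measurable : Measurable (Function.uncurry h)
  nonneg : 0 ≤ L
  lipschitz : ∀ x y, ∀ t ∈ Icc a b, ‖h x t - h y t‖ ≤ L * ‖x - y‖
  growth : ∀ x, ∀ t ∈ Icc a b, ‖h x t‖ ≤ L * (1 + ‖x‖)

variable {h : E → ℝ → E} {a b L : ℝ} {γ η : ℝ → E}

lemma IsLipschitzField.mono {a' : ℝ} (hh : IsLipschitzField h a b L) (ha : a ≤ a') :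
    IsLipschitzField h a' b L where
  measurable := hh.measurable
  nonneg := hh.nonneg
  lipschitz x y t ht := hh.lipschitz x y t ⟨ha.trans ht.1, ht.2⟩
  growth x t ht := hh.growth x t ⟨ha.trans ht.1, ht.2⟩

lemma IsLipschitzField.integrableOn (hh : IsLipschitzField h a b L)
    (hγ : ContinuousOn γ (Icc a b)) : IntegrableOn (fun u => h (γ u) u) (Icc a b) := by
  obtain ⟨M, hM⟩ := isCompact_Icc.exists_bound_of_continuousOn hγ
  refine Integrable.of_bound ?_ (L * (1 + M)) ?_
  · exact (hh.measurable.comp_aemeasurable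
      ((hγ.aemeasurable measurableSet_Icc).prodMk aemeasurable_id)).aestronglyMeasurable
  · refine (ae_restrict_mem measurableSet_Icc).mono fun t ht => (hh.growth _ t ht).trans ?_
    exact mul_le_mul_of_nonneg_left (by linarith [hM t ht]) hh.nonneg

lemma IsLipschitzField.intervalIntegrable (hh : IsLipschitzField h a b L)
    (hγ : ContinuousOn γ (Icc a b)) {s t : ℝ} (hs : s ∈ Icc a b) (ht : t ∈ Icc a b) :
    IntervalIntegrable (fun u => h (γ u) u) volume s t :=
  ((hh.integrableOn hγ).mono_set (uIcc_subset_Icc hs ht)).intervalIntegrable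

namespace IsSolution

lemma sub_eq (hh : IsLipschitzField h a b L) (hγ : IsSolution h a b γ) {s t : ℝ}
    (hs : s ∈ Icc a b) (ht : t ∈ Icc a b) : γ t - γ s = ∫ u in s..t, h (γ u) u := by
  have ha : a ∈ Icc a b := ⟨le_rfl, hs.1.trans hs.2⟩
  rw [hγ.equation t ht, hγ.equation s hs, add_sub_add_left_eq_sub,
    intervalIntegral.integral_interval_sub_left (hh.intervalIntegrable hγ.continuousOn ha ht)
      (hh.intervalIntegrable hγ.continuousOn ha hs)]

lemma norm_sub_le_integral (hh : IsLipschitzField h a b L) (hγ : IsSolution h a b γ)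
    (hη : IsSolution h a b η) {s t : ℝ} (hs : s ∈ Icc a b) (ht : t ∈ Icc a b) (hst : s ≤ t) :
    ‖(γ t - η t) - (γ s - η s)‖ ≤ L * ∫ u in s..t, ‖γ u - η u‖ := by
  have e : (γ t - η t) - (γ s - η s) = ∫ u in s..t, (h (γ u) u - h (η u) u) := by
    rw [intervalIntegral.integral_sub (hh.intervalIntegrable hγ.continuousOn hs ht)
      (hh.intervalIntegrable hη.continuousOn hs ht), ← hγ.sub_eq hh hs ht, ← hη.sub_eq hh hs ht]
    abel
  rw [e, ← intervalIntegral.integral_const_mul]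
  refine intervalIntegral.norm_integral_le_of_norm_le hst ?_ ?_
  · exact Eventually.of_forall fun u hu => hh.lipschitz _ _ u ⟨hs.1.trans hu.1.le, hu.2.trans ht.2⟩
  · refine ContinuousOn.intervalIntegrable ?_
    exact (continuousOn_const.mul (hγ.continuousOn.sub hη.continuousOn).norm).mono
      (uIcc_subset_Icc hs ht)

lemma norm_sub_le_forward (hh : IsLipschitzField h a b L) (hγ : IsSolution h a b γ)
    (hη : IsSolution h a b η) (hab : a ≤ b) :
    ‖γ b - η b‖ ≤ ‖γ a - η a‖ * Real.exp (L * (b - a)) := by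
  have ha : a ∈ Icc a b := ⟨le_rfl, hab⟩
  refine le_exp_of_le_integral hh.nonneg (hγ.continuousOn.sub hη.continuousOn).norm
    (fun t ht => ?_) b ⟨hab, le_rfl⟩
  have h1 := norm_sub_le_integral hh hγ hη ha ht ht.1
  have h2 := norm_le_norm_add_norm_sub (γ a - η a) (γ t - η t)
  rw [norm_sub_rev (γ a - η a)] at h2
  simp only [Pi.sub_apply]
  linarith

lemma norm_sub_le_backward (hh : IsLipschitzField h a b L) (hγ : IsSolution h a b γ)
    (hη : IsSolution h a b η) (hab : a ≤ b) :
    ‖γ a - η a‖ ≤ ‖γ b - η b‖ * Real.exp (L * (b - a)) := by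
  have hb : b ∈ Icc a b := ⟨hab, le_rfl⟩
  refine le_exp_of_le_integral_right hh.nonneg (hγ.continuousOn.sub hη.continuousOn).norm
    (fun t ht => ?_) a ⟨le_rfl, hab⟩
  have h1 := norm_sub_le_integral hh hγ hη ht hb ht.2
  have h2 := norm_le_norm_add_norm_sub (γ b - η b) (γ t - η t)
  simp only [Pi.sub_apply]
  linarith

lemma growth (hh : IsLipschitzField h a b L) (hγ : IsSolution h a b γ) (hab : a ≤ b) :
    1 + ‖γ b‖ ≤ (1 + ‖γ a‖) * Real.exp (L * (b - a)) := by
  have ha : a ∈ Icc a b := ⟨le_rfl, hab⟩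
  refine le_exp_of_le_integral (φ := fun t => 1 + ‖γ t‖) hh.nonneg
    (continuousOn_const.add hγ.continuousOn.norm) (fun t ht => ?_) b ⟨hab, le_rfl⟩
  have h1 : ‖γ t - γ a‖ ≤ ∫ u in a..t, L * (1 + ‖γ u‖) := by
    rw [hγ.sub_eq hh ha ht]
    refine intervalIntegral.norm_integral_le_of_norm_le ht.1 ?_ ?_
    · exact Eventually.of_forall fun u hu => hh.growth _ u ⟨hu.1.le, hu.2.trans ht.2⟩
    · refine ContinuousOn.intervalIntegrable ?_
      exact (continuousOn_const.mul (continuousOn_const.add hγ.continuousOn.norm)).mono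
        (uIcc_subset_Icc ha ht)
  rw [intervalIntegral.integral_const_mul] at h1
  have h2 := norm_le_norm_add_norm_sub (γ a) (γ t)
  rw [norm_sub_rev] at h2
  linarith

end IsSolution

/-- Existence of solutions by the contraction principle. -/
lemma IsLipschitzField.exists_solution (hh : IsLipschitzField h a b L) (hab : a ≤ b) (x : E) :
    ∃ γ, IsSolution h a b γ ∧ γ a = x := by
  set K : ℝ := L + 1 with hK
  have hK0 : 0 < K := by linarith [hh.nonneg]
  -- the curve encoded by a weighted curve
  let c (w : C(Icc a b, E)) (u : ℝ) : E := Real.exp (2 * K * (u - a)) • w (projIcc a b hab u)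
  have hc : ∀ w, Continuous (c w) := fun w => by
    have := w.continuous
    have := continuous_projIcc (h := hab)
    simp only [c]
    fun_prop
  have hprim : ∀ w, ContinuousOn (fun t => x + ∫ u in a..t, h (c w u) u) (Icc a b) := fun w => by
    refine continuousOn_const.add ?_
    have h1 := hh.integrableOn (hc w).continuousOn
    have := intervalIntegral.continuousOn_primitive_interval (a := a) (b := b)
      (f := fun u => h (c w u) u) (μ := volume) (by rwa [uIcc_of_le hab])
    rwa [uIcc_of_le hab] at this
  -- This is the Picard map in the variable `w(t) = exp(-2K(t - a)) γ(t)`. Since the integral of `K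
  -- exp(2K(u - a))` is at most `exp(2K(t - a))/2`, it contracts by `1/2` on the whole interval,
  -- without subdivision.
  let Γ (w : C(Icc a b, E)) : C(Icc a b, E) :=
    ⟨fun t => Real.exp (-(2 * K * ((t : ℝ) - a))) • (x + ∫ u in a..(t : ℝ), h (c w u) u), by
      have := (hprim w).domRestrict
      refine Continuous.smul (by fun_prop) this⟩
  have hcontr : ContractingWith (1 / 2) Γ := by
    refine ⟨by norm_num, LipschitzWith.of_dist_le_mul fun w w' => ?_⟩
    rw [ContinuousMap.dist_le (by positivity)]
    intro t
    have ht := t.2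
    have ha : a ∈ Icc a b := ⟨le_rfl, hab⟩
    simp only [Γ, ContinuousMap.coe_mk]
    rw [dist_eq_norm, ← smul_sub, add_sub_add_left_eq_sub, norm_smul,
      Real.norm_of_nonneg (Real.exp_pos _).le,
      ← intervalIntegral.integral_sub (hh.intervalIntegrable (hc w).continuousOn ha ht)
        (hh.intervalIntegrable (hc w').continuousOn ha ht)]
    have hexp : ∀ s : ℝ, HasDerivAt (fun s => Real.exp (2 * K * (s - a)) * (dist w w' / 2))
        (K * (Real.exp (2 * K * (s - a)) * dist w w')) s := fun s => by
      have := ((((hasDerivAt_id s).sub_const a).const_mul (2 * K)).exp).mul_const (dist w w' / 2)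
      refine this.congr_deriv ?_
      simp only [id]
      ring
    have hcont : Continuous fun s => K * (Real.exp (2 * K * (s - a)) * dist w w') := by fun_prop
    have hint : ‖∫ u in a..(t : ℝ), (h (c w u) u - h (c w' u) u)‖ ≤
        ∫ u in a..(t : ℝ), K * (Real.exp (2 * K * (u - a)) * dist w w') := by
      refine intervalIntegral.norm_integral_le_of_norm_le ht.1 ?_ (hcont.intervalIntegrable _ _)
      refine Eventually.of_forall fun u hu => ?_
      refine (hh.lipschitz _ _ u ⟨hu.1.le, hu.2.trans ht.2⟩).trans ?_
      refine mul_le_mul (by linarith) ?_ (norm_nonneg _) hK0.le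
      simp only [c]
      rw [← smul_sub, norm_smul, Real.norm_of_nonneg (Real.exp_pos _).le, ← dist_eq_norm]
      exact mul_le_mul_of_nonneg_left (ContinuousMap.dist_apply_le_dist _) (Real.exp_pos _).le
    rw [intervalIntegral.integral_eq_sub_of_hasDerivAt (fun s _ => hexp s)
      (hcont.intervalIntegrable _ _)] at hint
    have hd : 0 ≤ dist w w' := dist_nonneg
    calc _ ≤ Real.exp (-(2 * K * ((t : ℝ) - a))) *
          (Real.exp (2 * K * ((t : ℝ) - a)) * (dist w w' / 2)) := by
          refine mul_le_mul_of_nonneg_left (hint.trans ?_) (Real.exp_pos _).le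
          simp
          linarith
      _ = _ := by
          rw [← mul_assoc, ← Real.exp_add]
          simp
          ring
  have hfix := hcontr.fixedPoint_isFixedPt (f := Γ)
  set w := ContractingWith.fixedPoint Γ hcontr with hw
  have heq : ∀ t ∈ Icc a b, c w t = x + ∫ u in a..t, h (c w u) u := fun t ht => by
    have h1 : w ⟨t, ht⟩ = Γ w ⟨t, ht⟩ := by rw [hfix]
    simp only [c, projIcc_of_mem hab ht]
    rw [h1]
    simp only [Γ, ContinuousMap.coe_mk]
    rw [smul_smul, ← Real.exp_add]
    simp [c]
  have hca : c w a = x := by simpa using heq a ⟨le_rfl, hab⟩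
  exact ⟨c w, ⟨(hc w).continuousOn, fun t ht => by rw [hca]; exact heq t ht⟩, hca⟩

end Curves

/-! ### Density bounds along the flow -/

section FlowDensity

variable {d : ℕ}

lemma IsSolution.mono {h : EuclideanSpace ℝ (Fin d) → ℝ → EuclideanSpace ℝ (Fin d)}
    {a a' b L : ℝ} {γ : ℝ → EuclideanSpace ℝ (Fin d)}
    (hh : IsLipschitzField h a b L) (hγ : IsSolution h a b γ) (ha : a' ∈ Icc a b) :
    IsSolution h a' b γ where
  continuousOn := hγ.continuousOn.mono (Icc_subset_Icc_left ha.1)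
  equation t ht := by
    rw [← hγ.sub_eq hh ha ⟨ha.1.trans ht.1, ht.2⟩]
    abel

lemma volume_ball_mul {c : ℝ} (hc : 0 < c) (z x : EuclideanSpace ℝ (Fin d)) (r : ℝ) :
    volume (Metric.ball z (c * r)) = ENNReal.ofReal (c ^ d) * volume (Metric.ball x r) := by
  rw [Measure.addHaar_ball_mul_of_pos volume z hc r, Measure.addHaar_ball_center volume x r]
  simp

variable {Ω : Type*} [MeasurableSpace Ω] {P : Measure Ω} {Y : ℝ → Ω → EuclideanSpace ℝ (Fin d)}
  {h : EuclideanSpace ℝ (Fin d) → ℝ → EuclideanSpace ℝ (Fin d)}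
  {T L : ℝ} {G : EuclideanSpace ℝ (Fin d) → ℝ} {p : ℝ → EuclideanSpace ℝ (Fin d) → ℝ}

/-- Two-sided pointwise bounds, in terms of the terminal density, for the density transported by a
Lipschitz field. -/
lemma density_bounds_of_flow (hh : IsLipschitzField h 0 T L)
    (hYm : ∀ t ∈ Icc 0 T, Measurable (Y t)) (hY : ∀ᵐ ω ∂P, IsSolution h 0 T fun t => Y t ω)
    (hG : P.map (Y T) = densityMeasure G) (hp : ∀ t ∈ Icc 0 T, IsDensityOf (p t) (P.map (Y t)))
    (hpc : ∀ t ∈ Icc 0 T, Continuous (p t)) {κ : ℝ} (hκ : 0 ≤ κ) (hGκ : ∀ z, G z ≤ κ)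
    {t : ℝ} (ht : t ∈ Icc 0 T) (x : EuclideanSpace ℝ (Fin d)) :
    p t x ≤ Real.exp (L * T) ^ d * κ ∧
    ∃ z : EuclideanSpace ℝ (Fin d), 1 + ‖z‖ ≤ (1 + ‖x‖) * Real.exp (L * T) ∧
      ∀ m > 0, (∀ y ∈ Metric.ball z 1, m ≤ G y) → (Real.exp (L * T))⁻¹ ^ d * m ≤ p t x := by
  have hT : T ∈ Icc 0 T := ⟨ht.1.trans ht.2, le_rfl⟩
  set c := Real.exp (L * T) with hc
  have hc0 : 0 < c := Real.exp_pos _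
  have hc1 : Real.exp (L * (T - t)) ≤ c :=
    Real.exp_le_exp.2 (mul_le_mul_of_nonneg_left (by linarith [ht.1]) hh.nonneg)
  have hht := hh.mono ht.1
  -- The trajectory started from `x` at time `t` ends at `z`. By Grönwall in both directions,
  -- distances of `Y` to it at times `t` and `T` are comparable up to the factor `c`, so no flow map
  -- and no Jacobian are needed.
  obtain ⟨γ, hγ, hγx⟩ := hht.exists_solution ht.2 x
  set z := γ T with hz
  have hfwd : ∀ᵐ ω ∂P, ‖Y T ω - z‖ ≤ c * ‖Y t ω - x‖ := by
    filter_upwards [hY] with ω hω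
    have := (hω.mono hh ht).norm_sub_le_forward hht hγ ht.2
    rw [hγx] at this
    refine this.trans ?_
    rw [mul_comm]
    exact mul_le_mul_of_nonneg_right hc1 (norm_nonneg _)
  have hbwd : ∀ᵐ ω ∂P, ‖Y t ω - x‖ ≤ c * ‖Y T ω - z‖ := by
    filter_upwards [hY] with ω hω
    have := (hω.mono hh ht).norm_sub_le_backward hht hγ ht.2
    rw [hγx] at this
    refine this.trans ?_
    rw [mul_comm]
    exact mul_le_mul_of_nonneg_right hc1 (norm_nonneg _)
  have hmt : ∀ (s : ℝ) (_ : s ∈ Icc 0 T) (w : EuclideanSpace ℝ (Fin d)) (r : ℝ),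
      P.map (Y s) (Metric.ball w r) = P {ω | ‖Y s ω - w‖ < r} := fun s hs w r => by
    rw [Measure.map_apply (hYm s hs) measurableSet_ball]
    congr 1
  refine ⟨?_, z, ?_, fun m hm hmG => ?_⟩
  · refine density_le_of_ball (hpc t ht).continuousAt (by positivity)
      (Eventually.of_forall fun r => ?_)
    rw [← (hp t ht).2.2, hmt t ht]
    -- Paths within `r` of `x` at time `t` end within `cr` of `z`. The ratio of the volumes of the
    -- two balls is the factor `c ^ d` of the bound.
    have h1 : P {ω | ‖Y t ω - x‖ < r} ≤ P {ω | ‖Y T ω - z‖ < c * r} := by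
      refine measure_mono_ae ?_
      filter_upwards [hfwd] with ω hω (hr : _ < _)
      exact hω.trans_lt (mul_lt_mul_of_pos_left hr hc0)
    refine h1.trans ?_
    rw [← hmt T hT, hG, densityMeasure, withDensity_apply _ measurableSet_ball]
    have h2 : ∫⁻ y in Metric.ball z (c * r), ENNReal.ofReal (G y) ≤
        ENNReal.ofReal κ * volume (Metric.ball z (c * r)) := by
      rw [← setLIntegral_const]
      exact setLIntegral_mono measurable_const fun y _ => ENNReal.ofReal_le_ofReal (hGκ y)
    refine h2.trans_eq ?_
    rw [volume_ball_mul hc0 z x r, ← mul_assoc, ← ENNReal.ofReal_mul hκ, mul_comm κ]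
  · have := hγ.growth hht ht.2
    rw [hγx] at this
    exact this.trans (mul_le_mul_of_nonneg_left hc1 (by positivity))
  · refine le_density_of_ball (hpc t ht).continuousAt (by positivity) ?_
    -- For `r ≤ c` the ball of radius `r/c` around `z` lies inside the unit ball, where `G ≥ m`.
    filter_upwards [Ioc_mem_nhdsGT hc0] with r hr
    rw [← (hp t ht).2.2, hmt t ht]
    have h1 : P {ω | ‖Y T ω - z‖ < c⁻¹ * r} ≤ P {ω | ‖Y t ω - x‖ < r} := by
      refine measure_mono_ae ?_
      filter_upwards [hbwd] with ω hω (hr : _ < _)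
      refine hω.trans_lt ?_
      rwa [lt_inv_mul_iff₀ hc0] at hr
    refine le_trans ?_ h1
    rw [← hmt T hT, hG, densityMeasure, withDensity_apply _ measurableSet_ball]
    have h2 : ENNReal.ofReal m * volume (Metric.ball z (c⁻¹ * r)) ≤
        ∫⁻ y in Metric.ball z (c⁻¹ * r), ENNReal.ofReal (G y) := by
      rw [← setLIntegral_const]
      refine setLIntegral_mono' measurableSet_ball fun y hy =>
        ENNReal.ofReal_le_ofReal (hmG y (Metric.ball_subset_ball ?_ hy))
      rw [inv_mul_le_iff₀ hc0, mul_one]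
      exact hr.2
    refine le_trans (le_of_eq ?_) h2
    rw [volume_ball_mul (inv_pos.2 hc0) z x r, ← mul_assoc, ← ENNReal.ofReal_mul hm.le, mul_comm m]

/-- The log-density of the flow of a Lipschitz field with Gaussian terminal law grows at most
quadratically, uniformly in time. -/
lemma exists_abs_log_density_flow_le {σ : ℝ} (hσ : 0 < σ) (hh : IsLipschitzField h 0 T L)
    (hYm : ∀ t ∈ Icc 0 T, Measurable (Y t)) (hY : ∀ᵐ ω ∂P, IsSolution h 0 T fun t => Y t ω)
    (hYT : P.map (Y T) = centeredGaussian d σ)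
    (hp : ∀ t ∈ Icc 0 T, IsDensityOf (p t) (P.map (Y t)))
    (hpc : ∀ t ∈ Icc 0 T, Continuous (p t)) :
    ∃ C > 0, ∀ t ∈ Icc 0 T, ∀ x, 0 < p t x ∧ |Real.log (p t x)| ≤ C * (1 + ‖x‖ ^ 2) := by
  obtain ⟨κ, hκ, hG⟩ := exists_centeredGaussian_eq (d := d) hσ
  set c := Real.exp (L * T) with hc
  have hc0 : 0 < c := Real.exp_pos _
  -- The first two terms are the logarithms of the constants in the upper and lower bounds. The
  -- third is the Gaussian exponent: `(1 + ‖z‖)² ≤ 2c²(1 + ‖x‖²)`, and the `2` cancels against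
  -- `2σ²`.
  refine ⟨|Real.log (c ^ d * κ)| + |Real.log (c⁻¹ ^ d * κ)| + c ^ 2 / σ ^ 2, by positivity,
    fun t ht x => ?_⟩
  obtain ⟨hup, z, hz, hlow⟩ := density_bounds_of_flow hh hYm hY (hYT.trans hG) hp hpc hκ.le
    (fun z => mul_le_of_le_one_right hκ.le (Real.exp_le_one_iff.2 (by
      rw [Left.neg_nonpos_iff]; positivity))) ht x
  have hlow' := hlow (κ * Real.exp (-((1 + ‖z‖) ^ 2 / (2 * σ ^ 2)))) (by positivity) fun y hy => by
    refine mul_le_mul_of_nonneg_left (Real.exp_le_exp.2 (neg_le_neg ?_)) hκ.le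
    have : ‖y‖ ≤ 1 + ‖z‖ := by
      have := norm_le_norm_add_norm_sub z y
      rw [Metric.mem_ball, dist_eq_norm, norm_sub_rev] at hy
      linarith
    gcongr
  rw [← mul_assoc] at hlow'
  have hpos : 0 < p t x := lt_of_lt_of_le (by positivity) hlow'
  refine ⟨hpos, ?_⟩
  have l1 := Real.log_le_log hpos hup
  have l2 := Real.log_le_log (by positivity) hlow'
  rw [Real.log_mul (by positivity) (Real.exp_pos _).ne', Real.log_exp] at l2
  have hq : (1 + ‖z‖) ^ 2 / (2 * σ ^ 2) ≤ c ^ 2 / σ ^ 2 * (1 + ‖x‖ ^ 2) := by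
    have h1 : (1 + ‖z‖) ^ 2 ≤ ((1 + ‖x‖) * c) ^ 2 := by gcongr
    have h2 : (1 + ‖x‖) ^ 2 ≤ 2 * (1 + ‖x‖ ^ 2) := by nlinarith [sq_nonneg (1 - ‖x‖)]
    have h3 : (1 + ‖z‖) ^ 2 ≤ (2 * (1 + ‖x‖ ^ 2)) * c ^ 2 := by
      refine h1.trans ?_
      rw [mul_pow]
      exact mul_le_mul_of_nonneg_right h2 (by positivity)
    rw [div_mul_eq_mul_div, div_le_div_iff₀ (by positivity) (by positivity)]
    nlinarith [sq_nonneg σ]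
  have hx : 1 ≤ 1 + ‖x‖ ^ 2 := by linarith [sq_nonneg ‖x‖]
  have e1 : |Real.log (c ^ d * κ)| ≤ |Real.log (c ^ d * κ)| * (1 + ‖x‖ ^ 2) :=
    le_mul_of_one_le_right (abs_nonneg _) hx
  have e2 : |Real.log (c⁻¹ ^ d * κ)| ≤ |Real.log (c⁻¹ ^ d * κ)| * (1 + ‖x‖ ^ 2) :=
    le_mul_of_one_le_right (abs_nonneg _) hx
  have e3 : 0 ≤ c ^ 2 / σ ^ 2 * (1 + ‖x‖ ^ 2) := by positivity
  have a1 := le_abs_self (Real.log (c ^ d * κ))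
  have a2 := neg_abs_le (Real.log (c⁻¹ ^ d * κ))
  have a3 := abs_nonneg (Real.log (c ^ d * κ))
  have a4 := abs_nonneg (Real.log (c⁻¹ ^ d * κ))
  rw [abs_le]
  constructor <;> nlinarith

end FlowDensity

/-! ### Growth of the score and of the log-density -/

section LogLipschitz

variable {d : ℕ}

lemma inner_score {ρ : EuclideanSpace ℝ (Fin d) → ℝ} (hρ : ContDiff ℝ 1 ρ) (h0 : ∀ x, 0 < ρ x)
    (x w : EuclideanSpace ℝ (Fin d)) :
    inner ℝ (score ρ x) w = fderiv ℝ ρ x w / ρ x := by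
  rw [score, inner_gradient_left,
    ((hρ.differentiable one_ne_zero x).hasFDerivAt.log (h0 x).ne').fderiv]
  simp [div_eq_inv_mul]

lemma score_eq {ρ : EuclideanSpace ℝ (Fin d) → ℝ} (hρ : ContDiff ℝ 1 ρ) (h0 : ∀ x, 0 < ρ x)
    (x : EuclideanSpace ℝ (Fin d)) :
    score ρ x = (ρ x)⁻¹ • gradient ρ x := by
  refine ext_inner_right ℝ fun w => ?_
  rw [inner_score hρ h0, inner_smul_left, inner_gradient_left]
  simp [div_eq_inv_mul]

variable {ρ : EuclideanSpace ℝ (Fin d) → ℝ}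

lemma abs_log_sub_le (hρ : ContDiff ℝ 1 ρ) (h0 : ∀ x, 0 < ρ x) {S r : ℝ}
    (hS : ∀ y, ‖y‖ ≤ r → ‖score ρ y‖ ≤ S) {x y : EuclideanSpace ℝ (Fin d)}
    (hx : ‖x‖ ≤ r) (hy : ‖y‖ ≤ r) :
    |Real.log (ρ x) - Real.log (ρ y)| ≤ S * ‖x - y‖ := by
  have hd : ∀ z, HasFDerivAt (fun z => Real.log (ρ z)) ((ρ z)⁻¹ • fderiv ℝ ρ z) z := fun z =>
    (hρ.differentiable one_ne_zero z).hasFDerivAt.log (h0 z).ne'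
  have hcvx := convex_closedBall (0 : EuclideanSpace ℝ (Fin d)) r
  refine hcvx.norm_image_sub_le_of_norm_hasFDerivWithin_le
    (fun z _ => (hd z).hasFDerivWithinAt) (fun z hz => ?_) (by simpa using hy) (by simpa using hx)
  refine ContinuousLinearMap.opNorm_le_bound _ ?_ fun w => ?_
  · exact (norm_nonneg _).trans (hS z (by simpa using hz))
  · have h1 : ((ρ z)⁻¹ • fderiv ℝ ρ z) w = inner ℝ (score ρ z) w := by
      rw [inner_score hρ h0]; simp [div_eq_inv_mul]
    rw [h1]
    refine (abs_real_inner_le_norm _ _).trans ?_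
    exact mul_le_mul_of_nonneg_right (hS z (by simpa using hz)) (norm_nonneg _)

/-- A probability density with Lipschitz score, bounded gradient on a ball and half of its mass in
that ball has a quadratically bounded logarithm and an explicitly bounded score at the origin. -/
lemma exists_score_and_log_bound (R C Λ : ℝ) (hR : 0 < R) (hC : 0 ≤ C) (hΛ : 0 ≤ Λ) :
    ∃ S > 0, ∀ ρ : EuclideanSpace ℝ (Fin d) → ℝ, ContDiff ℝ 1 ρ → (∀ x, 0 < ρ x) →
      IsProbabilityMeasure (densityMeasure ρ) →
      1 / 2 ≤ densityMeasure ρ (Metric.closedBall 0 R) →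
      (∀ x, ‖x‖ ≤ R → ‖gradient ρ x‖ ≤ C) →
      (∀ x y, ‖score ρ x - score ρ y‖ ≤ Λ * ‖x - y‖) →
      (∀ x, ‖score ρ x‖ ≤ S * (1 + ‖x‖)) ∧ ∀ x, |Real.log (ρ x)| ≤ S * (1 + ‖x‖ ^ 2) := by
  set V := (volume : Measure (EuclideanSpace ℝ (Fin d))).real (Metric.closedBall 0 R) with hV
  set V₁ := (volume : Measure (EuclideanSpace ℝ (Fin d))).real (Metric.ball 0 1) with hV₁
  have hV0 : 0 < V := ENNReal.toReal_pos (Metric.measure_closedBall_pos volume 0 hR).ne'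
    measure_closedBall_lt_top.ne
  have hV₁0 : 0 < V₁ := ENNReal.toReal_pos (Metric.measure_ball_pos volume 0 one_pos).ne'
    measure_ball_lt_top.ne
  -- A density below `c` on the whole ball would give it mass at most `1/4`, less than the assumed
  -- `1/2`.
  set c : ℝ := (4 * V)⁻¹ with hc
  have hc0 : 0 < c := by positivity
  set S₀ : ℝ := C / c + Λ * R + Λ with hS₀
  have hS₀0 : 0 ≤ S₀ := by positivity
  refine ⟨1 + S₀ + (|Real.log c| + S₀ * (1 + R) * (2 + R) + 6 * S₀ + |Real.log V₁|),
    by positivity, fun ρ hρ h0 hprob hhalf hgrad hlip => ?_⟩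
  -- a point where the density is bounded below
  obtain ⟨x₀, hx₀, hρx₀⟩ : ∃ x₀ : EuclideanSpace ℝ (Fin d), ‖x₀‖ ≤ R ∧ c ≤ ρ x₀ := by
    by_contra! hcon
    have : densityMeasure ρ (Metric.closedBall 0 R) ≤ ENNReal.ofReal (1 / 4) := by
      rw [densityMeasure, withDensity_apply _ Metric.isClosed_closedBall.measurableSet]
      have h1 : ∫⁻ y in Metric.closedBall (0 : EuclideanSpace ℝ (Fin d)) R, ENNReal.ofReal (ρ y) ≤
          ENNReal.ofReal c * volume (Metric.closedBall (0 : EuclideanSpace ℝ (Fin d)) R) := by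
        rw [← setLIntegral_const]
        exact setLIntegral_mono measurable_const fun y hy =>
          ENNReal.ofReal_le_ofReal (hcon y (by simpa using hy)).le
      refine h1.trans_eq ?_
      rw [← ENNReal.ofReal_toReal (measure_closedBall_lt_top (μ := volume)).ne,
        ← ENNReal.ofReal_mul hc0.le]
      congr 1
      change c * V = 1 / 4
      rw [hc]
      field_simp
    have h2 := hhalf.trans this
    have h3 : (1 / 2 : ENNReal) = ENNReal.ofReal (1 / 2) := by
      rw [ENNReal.ofReal_div_of_pos two_pos]; simp
    rw [h3, ENNReal.ofReal_le_ofReal_iff (by norm_num)] at h2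
    norm_num at h2
  -- At `x₀` the score `∇ρ/ρ` has a bounded numerator and a denominator bounded below; the Lipschitz
  -- condition then spreads the bound to all of space with linear growth.
  have hs₀ : ‖score ρ x₀‖ ≤ C / c := by
    rw [score_eq hρ h0, norm_smul, norm_inv, Real.norm_of_nonneg (h0 _).le, ← div_eq_inv_mul]
    exact div_le_div₀ hC (hgrad x₀ hx₀) hc0 hρx₀
  have hs : ∀ x, ‖score ρ x‖ ≤ S₀ * (1 + ‖x‖) := fun x => by
    have h1 := norm_le_norm_add_norm_sub (score ρ x₀) (score ρ x)
    rw [norm_sub_rev] at h1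
    have h2 := hlip x x₀
    have h3 : Λ * ‖x - x₀‖ ≤ Λ * (‖x‖ + R) :=
      mul_le_mul_of_nonneg_left ((norm_sub_le _ _).trans (by linarith)) hΛ
    have h4 : 0 ≤ (C / c + Λ * R) * ‖x‖ := by positivity
    have h5 : S₀ * (1 + ‖x‖) = C / c + Λ * (‖x‖ + R) + Λ + (C / c + Λ * R) * ‖x‖ := by
      simp only [hS₀]
      ring
    linarith
  refine ⟨fun x => (hs x).trans (mul_le_mul_of_nonneg_right ?_ (by positivity)), fun x => ?_⟩
  · have : 0 ≤ |Real.log c| + S₀ * (1 + R) * (2 + R) + 6 * S₀ + |Real.log V₁| := by positivity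
    linarith
  have hx0 := norm_nonneg x
  -- Integrating the linearly growing score along the segment from `x₀` to `x` costs at most a
  -- quadratic term.
  have hlow : Real.log c - S₀ * (1 + (‖x‖ + R)) * (‖x‖ + R) ≤ Real.log (ρ x) := by
    have h1 := abs_log_sub_le hρ h0 (S := S₀ * (1 + (‖x‖ + R))) (r := ‖x‖ + R) (fun y hy =>
      (hs y).trans (mul_le_mul_of_nonneg_left (by linarith) hS₀0)) (x := x) (y := x₀)
      (by linarith) (by linarith)
    have h2 : S₀ * (1 + (‖x‖ + R)) * ‖x - x₀‖ ≤ S₀ * (1 + (‖x‖ + R)) * (‖x‖ + R) :=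
      mul_le_mul_of_nonneg_left ((norm_sub_le _ _).trans (by linarith)) (by positivity)
    have h3 := Real.log_le_log hc0 hρx₀
    have h4 := (abs_le.1 h1).1
    linarith
  -- The logarithm varies by at most `S₀(2 + ‖x‖)` on the unit ball around `x`, and the mass of that
  -- ball is at most one.
  have hup : Real.log (ρ x) ≤ S₀ * (2 + ‖x‖) + |Real.log V₁| := by
    have hball : ∀ y ∈ Metric.ball x 1, Real.log (ρ x) - S₀ * (2 + ‖x‖) ≤ Real.log (ρ y) := by
      intro y hy
      rw [Metric.mem_ball, dist_eq_norm] at hy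
      have hyn : ‖y‖ ≤ 1 + ‖x‖ := by
        have := norm_le_norm_add_norm_sub x y
        rw [norm_sub_rev] at this
        linarith
      have h1 := abs_log_sub_le hρ h0 (S := S₀ * (2 + ‖x‖)) (r := 1 + ‖x‖) (fun z hz =>
        (hs z).trans (mul_le_mul_of_nonneg_left (by linarith) hS₀0)) (x := y) (y := x)
        hyn (by linarith)
      have h2 : S₀ * (2 + ‖x‖) * ‖y - x‖ ≤ S₀ * (2 + ‖x‖) :=
        mul_le_of_le_one_right (by positivity) hy.le
      linarith [(abs_le.1 h1).1]
    set e := Real.exp (Real.log (ρ x) - S₀ * (2 + ‖x‖)) with he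
    have h1 : ENNReal.ofReal e * volume (Metric.ball x 1) ≤ densityMeasure ρ (Metric.ball x 1) := by
      rw [densityMeasure, withDensity_apply _ measurableSet_ball, ← setLIntegral_const]
      refine setLIntegral_mono' measurableSet_ball fun y hy => ENNReal.ofReal_le_ofReal ?_
      rw [he, ← Real.exp_log (h0 y)]
      exact Real.exp_le_exp.2 (hball y hy)
    have h2 := h1.trans prob_le_one
    rw [Measure.addHaar_ball_center, ← ENNReal.ofReal_toReal (measure_ball_lt_top (μ := volume)).ne,
      ← ENNReal.ofReal_mul (Real.exp_pos _).le, ENNReal.ofReal_le_one] at h2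
    have h3 : e * V₁ ≤ 1 := h2
    have h4 := Real.log_le_log (mul_pos (Real.exp_pos _) hV₁0) h3
    rw [Real.log_mul (Real.exp_pos _).ne' hV₁0.ne', Real.log_exp, Real.log_one] at h4
    linarith [neg_abs_le (Real.log V₁)]
  have hx1 : ‖x‖ ≤ 1 + ‖x‖ ^ 2 := by nlinarith [sq_nonneg (1 - ‖x‖)]
  have hsq := sq_nonneg ‖x‖
  have a1 := neg_abs_le (Real.log c)
  have a2 := abs_nonneg (Real.log c)
  have a3 := abs_nonneg (Real.log V₁)
  have key1 : S₀ * (1 + (‖x‖ + R)) * (‖x‖ + R) ≤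
      (S₀ * (1 + R) * (2 + R) + 6 * S₀) * (1 + ‖x‖ ^ 2) := by
    have : (1 + (‖x‖ + R)) * (‖x‖ + R) ≤ ((1 + R) * (2 + R) + 6) * (1 + ‖x‖ ^ 2) := by
      nlinarith [mul_le_mul_of_nonneg_left hx1 hR.le, mul_nonneg hR.le hsq,
        mul_nonneg (mul_nonneg hR.le hR.le) hsq]
    calc _ = S₀ * ((1 + (‖x‖ + R)) * (‖x‖ + R)) := by ring
      _ ≤ S₀ * (((1 + R) * (2 + R) + 6) * (1 + ‖x‖ ^ 2)) := mul_le_mul_of_nonneg_left this hS₀0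
      _ = _ := by ring
  have key2 : S₀ * (2 + ‖x‖) ≤ 6 * S₀ * (1 + ‖x‖ ^ 2) := by
    have : 2 + ‖x‖ ≤ 6 * (1 + ‖x‖ ^ 2) := by nlinarith
    calc _ ≤ S₀ * (6 * (1 + ‖x‖ ^ 2)) := mul_le_mul_of_nonneg_left this hS₀0
      _ = _ := by ring
  have n1 : 0 ≤ (1 + S₀) * (1 + ‖x‖ ^ 2) := by positivity
  have n2 : |Real.log c| ≤ |Real.log c| * (1 + ‖x‖ ^ 2) :=
    le_mul_of_one_le_right a2 (by linarith)
  have n3 : |Real.log V₁| ≤ |Real.log V₁| * (1 + ‖x‖ ^ 2) :=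
    le_mul_of_one_le_right a3 (by linarith)
  have n4 : 0 ≤ S₀ * (1 + R) * (2 + R) * (1 + ‖x‖ ^ 2) := by positivity
  have n5 : 0 ≤ 6 * S₀ * (1 + ‖x‖ ^ 2) := by positivity
  have expand : (1 + S₀ + (|Real.log c| + S₀ * (1 + R) * (2 + R) + 6 * S₀ + |Real.log V₁|)) *
      (1 + ‖x‖ ^ 2) = (1 + S₀) * (1 + ‖x‖ ^ 2) + |Real.log c| * (1 + ‖x‖ ^ 2) +
      S₀ * (1 + R) * (2 + R) * (1 + ‖x‖ ^ 2) + 6 * S₀ * (1 + ‖x‖ ^ 2) +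
      |Real.log V₁| * (1 + ‖x‖ ^ 2) := by ring
  rw [expand, abs_le]
  constructor
  · linarith
  · linarith

end LogLipschitz

/-! ### Continuous processes and the chain rule along paths -/

section Processes

variable {E : Type*} [NormedAddCommGroup E] [InnerProductSpace ℝ E] [FiniteDimensional ℝ E]
  [MeasurableSpace E] [BorelSpace E]
variable {Ω : Type*} [MeasurableSpace Ω] {P : Measure Ω} [IsProbabilityMeasure P]
  {X : ℝ → Ω → E} {T : ℝ}

/-- Paths are set to zero on a measurable null set and extended constantly outside `[0,T]`. The
result is jointly measurable in time and chance, as Fubini requires. -/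
lemma exists_continuous_version (hT : 0 ≤ T) (hXm : ∀ t ∈ Icc 0 T, Measurable (X t))
    (hXc : ∀ᵐ ω ∂P, ContinuousOn (fun t => X t ω) (Icc 0 T)) :
    ∃ Z : ℝ → Ω → E, (∀ ω, Continuous fun t => Z t ω) ∧ Measurable (Function.uncurry Z) ∧
      ∀ᵐ ω ∂P, ∀ t ∈ Icc 0 T, Z t ω = X t ω := by
  classical
  obtain ⟨N, hN, hNm, hN0⟩ := exists_measurable_superset_of_null (ae_iff.1 hXc)
  have hc : ∀ ω, ω ∉ N → ContinuousOn (fun t => X t ω) (Icc 0 T) := fun ω hω => by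
    by_contra h
    exact hω (hN h)
  set Z : ℝ → Ω → E := fun t ω => if ω ∈ N then 0 else X (projIcc 0 T hT t) ω with hZ
  have hZc : ∀ ω, Continuous fun t => Z t ω := fun ω => by
    by_cases hω : ω ∈ N
    · simp [hZ, hω, continuous_const]
    · simp only [hZ, if_neg hω]
      exact (hc ω hω).domRestrict.comp continuous_projIcc
  refine ⟨Z, hZc, ?_, ?_⟩
  · refine measurable_uncurry_of_continuous_of_measurable hZc fun t => ?_
    exact Measurable.ite hNm measurable_const (hXm _ (projIcc 0 T hT t).2)
  · have : ∀ᵐ ω ∂P, ω ∉ N := by rw [ae_iff]; simpa using hN0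
    filter_upwards [this] with ω hω t ht
    simp [hZ, hω, projIcc_of_mem hT ht]

lemma integral_intervalIntegral_swap {G : ℝ → Ω → ℝ} (hG : Measurable (Function.uncurry G))
    {K t : ℝ} (ht : 0 ≤ t) (hK : ∀ s ∈ Icc 0 t, ∀ ω, |G s ω| ≤ K) :
    ∫ ω, (∫ s in (0 : ℝ)..t, G s ω) ∂P = ∫ s in (0 : ℝ)..t, ∫ ω, G s ω ∂P := by
  simp_rw [intervalIntegral.integral_of_le ht]
  refine (integral_integral_swap (f := G) ?_).symm
  refine Integrable.of_bound hG.aestronglyMeasurable K ?_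
  have hae : ∀ᵐ z ∂((volume.restrict (Ioc 0 t)).prod P), z.1 ∈ Ioc 0 t :=
    Measure.quasiMeasurePreserving_fst.ae (ae_restrict_mem measurableSet_Ioc)
  filter_upwards [hae] with z hz
  exact hK z.1 (Ioc_subset_Icc_self hz) z.2

/-- A process with continuous paths is uniformly tight on a compact time interval. -/
lemma exists_tight (hT : 0 ≤ T) (hXm : ∀ t ∈ Icc 0 T, Measurable (X t))
    (hXc : ∀ᵐ ω ∂P, ContinuousOn (fun t => X t ω) (Icc 0 T)) :
    ∃ R > 0, ∀ t ∈ Icc 0 T, 1 / 2 ≤ P.map (X t) (Metric.closedBall 0 R) := by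
  obtain ⟨Z, hZc, -, hZX⟩ := exists_continuous_version hT hXm hXc
  set A : ℕ → Set Ω := fun n => {ω | ∀ t ∈ Icc 0 T, ‖Z t ω‖ ≤ n} with hA
  have hmono : Monotone A := fun n m hnm ω hω t ht => (hω t ht).trans (by exact_mod_cast hnm)
  have hU : ⋃ n, A n = univ := by
    refine eq_univ_of_forall fun ω => ?_
    obtain ⟨K, hK⟩ := isCompact_Icc.exists_bound_of_continuousOn
      ((hZc ω).continuousOn (s := Icc 0 T))
    obtain ⟨n, hn⟩ := exists_nat_ge K
    exact mem_iUnion.2 ⟨n, fun t ht => (hK t ht).trans hn⟩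
  -- Continuity from below holds for increasing sequences of arbitrary sets, so measurability of `A
  -- n` plays no role.
  have hlim := tendsto_measure_iUnion_atTop (μ := P) hmono
  rw [hU, measure_univ] at hlim
  obtain ⟨n, hn, hn1⟩ := ((hlim.eventually (lt_mem_nhds ENNReal.one_half_lt_one)).and
    (eventually_ge_atTop 1)).exists
  refine ⟨n, by exact_mod_cast hn1, fun t ht => ?_⟩
  rw [Measure.map_apply (hXm t ht) Metric.isClosed_closedBall.measurableSet]
  rw [one_div]
  refine hn.le.trans (measure_mono_ae ?_)
  filter_upwards [hZX] with ω hω (h : ∀ t ∈ Icc 0 T, ‖Z t ω‖ ≤ n)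
  have h1 : ‖X t ω‖ ≤ n := by rw [← hω t ht]; exact h t ht
  change X t ω ∈ Metric.closedBall (0 : E) n
  simpa using h1

lemma ContinuityEquation.congr {u u' : ℝ → E → ℝ} {h h' : ℝ → E → E}
    (H : ContinuityEquation T u h) (hu : ∀ t ∈ Icc 0 T, u' t = u t)
    (hh : ∀ t ∈ Icc 0 T, h' t = h t) : ContinuityEquation T u' h' := by
  intro φ hφ hφc t ht
  have h0 : (0 : ℝ) ∈ Icc 0 T := ⟨le_rfl, ht.1.trans ht.2⟩
  rw [hu t ht, hu 0 h0, H φ hφ hφc t ht]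
  congr 1
  refine intervalIntegral.integral_congr fun s hs => ?_
  rw [uIcc_of_le ht.1] at hs
  have hs' : s ∈ Icc 0 T := ⟨hs.1, hs.2.trans ht.2⟩
  simp only [hu s hs', hh s hs']

lemma exists_fderiv_bound {φ : E → ℝ} (hφ : ContDiff ℝ (⊤ : ℕ∞) φ) (hφc : HasCompactSupport φ)
    {h : E → ℝ → E} {L : ℝ} (hh : IsLipschitzField h 0 T L) :
    ∃ K, ∀ s ∈ Icc 0 T, ∀ y, |fderiv ℝ φ y (h y s)| ≤ K := by
  obtain ⟨c, hc⟩ := (hφc.fderiv ℝ).exists_bound_of_continuous (hφ.continuous_fderiv (by simp))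
  obtain ⟨r, hr⟩ := hφc.isBounded.exists_norm_le
  refine ⟨c * (L * (1 + |r|)), fun s hs y => ?_⟩
  have hc0 : 0 ≤ c := (norm_nonneg _).trans (hc y)
  have hL := hh.nonneg
  by_cases hy : y ∈ tsupport φ
  · refine ((fderiv ℝ φ y).le_opNorm _).trans (mul_le_mul (hc y) ?_ (norm_nonneg _) hc0)
    exact (hh.growth y s hs).trans (mul_le_mul_of_nonneg_left
      (by linarith [hr y hy, le_abs_self r]) hL)
  · have : fderiv ℝ φ y = 0 :=
      image_eq_zero_of_notMem_tsupport fun hx' => hy (tsupport_fderiv_subset ℝ hx')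
    rw [this]
    simp
    positivity

/-- Chain rule along solutions of an ordinary differential equation in integral form. -/
lemma IsSolution.chain_rule {φ : E → ℝ} (hφ : ContDiff ℝ (⊤ : ℕ∞) φ) (hφc : HasCompactSupport φ)
    {h : E → ℝ → E} {L : ℝ} (hh : IsLipschitzField h 0 T L) {γ : ℝ → E} (hγ : IsSolution h 0 T γ)
    {t : ℝ} (ht : t ∈ Icc 0 T) :
    φ (γ t) = φ (γ 0) + ∫ s in (0 : ℝ)..t, fderiv ℝ φ (γ s) (h (γ s) s) := by
  have h0 : (0 : ℝ) ∈ Icc 0 T := ⟨le_rfl, ht.1.trans ht.2⟩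
  have hTT : T ∈ Icc 0 T := ⟨ht.1.trans ht.2, le_rfl⟩
  obtain ⟨M, hM⟩ := isCompact_Icc.exists_bound_of_continuousOn hγ.continuousOn
  have hlipγ : LipschitzOnWith (L * (1 + M)).toNNReal γ (Icc 0 T) := by
    refine LipschitzOnWith.of_dist_le_mul fun x hx y hy => ?_
    rw [dist_eq_norm, hγ.sub_eq hh hy hx, Real.dist_eq]
    refine (intervalIntegral.norm_integral_le_of_norm_le_const (C := L * (1 + M))
      fun s hs => ?_).trans
      (mul_le_mul_of_nonneg_right (Real.le_coe_toNNReal _) (abs_nonneg _))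
    have hs' := (uIoc_subset_uIcc.trans (uIcc_subset_Icc hy hx)) hs
    exact (hh.growth _ s hs').trans (mul_le_mul_of_nonneg_left (by linarith [hM s hs']) hh.nonneg)
  obtain ⟨D, hD⟩ := hφ.lipschitzWith_of_hasCompactSupport hφc (by simp)
  have hsub : uIcc 0 t ⊆ Icc 0 T := uIcc_subset_Icc h0 ht
  -- The curve is Lipschitz, since the field is bounded along it; its composition with the Lipschitz
  -- `φ` is therefore recovered from its almost everywhere derivative.
  have hac := (hD.comp_lipschitzOnWith (hlipγ.mono hsub)).absolutelyContinuousOnInterval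
  have hftc := hac.integral_deriv_eq_sub
  simp only [Function.comp_apply] at hftc
  rw [← sub_eq_iff_eq_add', ← hftc]
  refine intervalIntegral.integral_congr_ae ?_
  have hne : ∀ᵐ s : ℝ, s ≠ t := by simp [ae_iff, measure_singleton]
  filter_upwards [(hh.intervalIntegrable hγ.continuousOn h0 ht).ae_hasDerivAt_integral, hne]
    with s h1 h3 hs
  have hsI := uIoc_subset_uIcc hs
  rw [uIoc_of_le ht.1] at hs
  have hd : HasDerivAt γ (h (γ s) s) s := by
    refine ((h1 hsI 0 left_mem_uIcc).const_add (γ 0)).congr_of_eventuallyEq ?_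
    filter_upwards [Icc_mem_nhds hs.1 (lt_of_le_of_ne hs.2 h3)] with r hr
    exact hγ.equation r ⟨hr.1, hr.2.trans ht.2⟩
  exact ((hφ.differentiable (by simp) _).hasFDerivAt.comp_hasDerivAt s hd).deriv

end Processes

/-! ### The two continuity equations -/

section Weak

variable {d : ℕ} {Ω : Type*} [mΩ : MeasurableSpace Ω] {P : Measure Ω} [IsProbabilityMeasure P]
  {T : ℝ}

lemma integral_densityMeasure {ρ : EuclideanSpace ℝ (Fin d) → ℝ} (hρ : Measurable ρ)
    (h0 : ∀ x, 0 ≤ ρ x) (w : EuclideanSpace ℝ (Fin d) → ℝ) :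
    ∫ x, w x ∂(densityMeasure ρ) = ∫ x, ρ x * w x := by
  rw [densityMeasure, integral_withDensity_eq_integral_toReal_smul hρ.ennreal_ofReal
    (Eventually.of_forall fun x => ENNReal.ofReal_lt_top)]
  refine integral_congr_ae (Eventually.of_forall fun x => ?_)
  simp [ENNReal.toReal_ofReal (h0 x)]

lemma integral_comp_eq_of_isDensityOf {Z : Ω → EuclideanSpace ℝ (Fin d)} (hZ : Measurable Z)
    {ρ : EuclideanSpace ℝ (Fin d) → ℝ} (hρ : IsDensityOf ρ (P.map Z))
    {w : EuclideanSpace ℝ (Fin d) → ℝ} (hw : Measurable w) :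
    ∫ ω, w (Z ω) ∂P = ∫ x, ρ x * w x := by
  rw [← integral_map hZ.aemeasurable hw.aestronglyMeasurable, hρ.2.2,
    integral_densityMeasure hρ.1 hρ.2.1]

/-- The marginal densities of a flow satisfy the continuity equation. -/
lemma continuityEquation_of_flow {h : EuclideanSpace ℝ (Fin d) → ℝ → EuclideanSpace ℝ (Fin d)}
    {L : ℝ} {Y : ℝ → Ω → EuclideanSpace ℝ (Fin d)} {p : ℝ → EuclideanSpace ℝ (Fin d) → ℝ}
    (hT : 0 ≤ T) (hh : IsLipschitzField h 0 T L)
    (hYm : ∀ t ∈ Icc 0 T, Measurable (Y t)) (hY : ∀ᵐ ω ∂P, IsSolution h 0 T fun t => Y t ω)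
    (hp : ∀ t ∈ Icc 0 T, IsDensityOf (p t) (P.map (Y t))) :
    ContinuityEquation T p fun t x => h x t := by
  intro φ hφ hφc t ht
  have h0 : (0 : ℝ) ∈ Icc 0 T := ⟨le_rfl, hT⟩
  obtain ⟨Z, hZc, hZm, hZY⟩ := exists_continuous_version hT hYm (hY.mono fun ω h => h.continuousOn)
  obtain ⟨K, hK⟩ := exists_fderiv_bound hφ hφc hh
  have hφ'm := (hφ.continuous_fderiv (by simp)).measurable
  set G : ℝ → Ω → ℝ := fun s ω => fderiv ℝ φ (Z s ω) (h (Z s ω) s) with hG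
  have hGm : Measurable (Function.uncurry G) :=
    measurable_clm_apply (hφ'm.comp hZm) (hh.measurable.comp (hZm.prodMk measurable_fst))
  have hφi : ∀ s ∈ Icc 0 T, Integrable (fun ω => φ (Y s ω)) P := fun s hs => by
    obtain ⟨c, hc⟩ := hφc.exists_bound_of_continuous hφ.continuous
    exact Integrable.of_bound (hφ.continuous.measurable.comp (hYm s hs)).aestronglyMeasurable c
      (Eventually.of_forall fun ω => hc _)
  -- The chain rule along almost every path, in expectation. After Fubini, expectations become
  -- integrals against the densities.
  have e1 : ∫ ω, φ (Y t ω) ∂P = ∫ ω, φ (Y 0 ω) ∂P + ∫ ω, (∫ s in (0 : ℝ)..t, G s ω) ∂P := by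
    rw [← sub_eq_iff_eq_add', ← integral_sub (hφi t ht) (hφi 0 h0)]
    refine integral_congr_ae ?_
    filter_upwards [hY, hZY] with ω h1 h2
    rw [h1.chain_rule hφ hφc hh ht, add_sub_cancel_left]
    refine intervalIntegral.integral_congr fun s hs => ?_
    rw [uIcc_of_le ht.1] at hs
    simp only [hG, h2 s ⟨hs.1, hs.2.trans ht.2⟩]
  have hfm : ∀ s, Measurable fun x => fderiv ℝ φ x (h x s) := fun s =>
    measurable_clm_apply hφ'm (hh.measurable.comp measurable_prodMk_right)
  rw [integral_intervalIntegral_swap hGm ht.1 (K := K)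
    (fun s hs ω => hK s ⟨hs.1, hs.2.trans ht.2⟩ _),
    integral_comp_eq_of_isDensityOf (hYm t ht) (hp t ht) hφ.continuous.measurable,
    integral_comp_eq_of_isDensityOf (hYm 0 h0) (hp 0 h0) hφ.continuous.measurable] at e1
  simp_rw [mul_comm (φ _)]
  rw [e1]
  congr 1
  refine intervalIntegral.integral_congr fun s hs => ?_
  rw [uIcc_of_le ht.1] at hs
  have hs' : s ∈ Icc 0 T := ⟨hs.1, hs.2.trans ht.2⟩
  rw [← integral_comp_eq_of_isDensityOf (hYm s hs') (hp s hs') (hfm s)]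
  refine integral_congr_ae ?_
  filter_upwards [hZY] with ω h2
  simp only [hG, h2 s hs']

/-- Integration by parts for the Laplacian against a positive `C¹` density. -/
lemma integral_mul_laplacian {ρ φ : EuclideanSpace ℝ (Fin d) → ℝ} (hρ : ContDiff ℝ 1 ρ)
    (h0 : ∀ x, 0 < ρ x) (hφ : ContDiff ℝ (⊤ : ℕ∞) φ) (hφc : HasCompactSupport φ) :
    ∫ x, ρ x * Laplacian.laplacian φ x = - ∫ x, ρ x * fderiv ℝ φ x (score ρ x) := by
  set e := stdOrthonormalBasis ℝ (EuclideanSpace ℝ (Fin d))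
  have c0 := hρ.continuous
  have c1 := hρ.continuous_fderiv one_ne_zero
  have hφ' : ContDiff ℝ (⊤ : ℕ∞) (fderiv ℝ φ) := hφ.fderiv_right (by simp)
  have c2 := hφ'.continuous
  have hg : ∀ i, ContDiff ℝ (⊤ : ℕ∞) fun x => fderiv ℝ φ x (e i) := fun i =>
    hφ'.clm_apply contDiff_const
  have hgc : ∀ i, HasCompactSupport fun x => fderiv ℝ φ x (e i) := fun i =>
    hφc.fderiv_apply ℝ (e i)
  have hg' : ∀ i, Continuous fun x => fderiv ℝ (fun x => fderiv ℝ φ x (e i)) x (e i) := fun i =>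
    ((hg i).continuous_fderiv (by simp)).clm_apply continuous_const
  have hI1 : ∀ i, Integrable fun x => ρ x * fderiv ℝ (fun x => fderiv ℝ φ x (e i)) x (e i) :=
    fun i => (c0.mul (hg' i)).integrable_of_hasCompactSupport
      ((hgc i).fderiv_apply ℝ (e i)).mul_left
  have hI2 : ∀ i, Integrable fun x => fderiv ℝ ρ x (e i) * fderiv ℝ φ x (e i) := fun i =>
    Continuous.integrable_of_hasCompactSupport (by fun_prop) (hgc i).mul_left
  have key : ∀ i, ∫ x, ρ x * fderiv ℝ (fun x => fderiv ℝ φ x (e i)) x (e i) =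
      - ∫ x, fderiv ℝ ρ x (e i) * fderiv ℝ φ x (e i) := fun i =>
    integral_mul_fderiv_eq_neg_fderiv_mul_of_integrable (hI2 i) (hI1 i)
      ((c0.mul (hg i).continuous).integrable_of_hasCompactSupport (hgc i).mul_left)
      (fun x _ => hρ.differentiable one_ne_zero x) (fun x _ => (hg i).differentiable (by simp) x)
  have hlap : ∀ x, ρ x * Laplacian.laplacian φ x =
      ∑ i, ρ x * fderiv ℝ (fun x => fderiv ℝ φ x (e i)) x (e i) := fun x => by
    rw [InnerProductSpace.laplacian_eq_iteratedFDeriv_orthonormalBasis φ e, ← Finset.mul_sum]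
    congr 1
    refine Finset.sum_congr rfl fun i _ => ?_
    rw [iteratedFDeriv_two_apply]
    have := ((hφ'.differentiable (by simp) x).hasFDerivAt.clm_apply
      (hasFDerivAt_const (e i) x)).fderiv
    rw [this]
    simp
  -- Here `ρ ∇log ρ = ∇ρ` turns the first-order term into one that carries the score.
  have hsc : ∀ x, ρ x * fderiv ℝ φ x (score ρ x) =
      ∑ i, fderiv ℝ ρ x (e i) * fderiv ℝ φ x (e i) := fun x => by
    conv_lhs => rw [← e.sum_repr' (score ρ x)]
    rw [map_sum, Finset.mul_sum]
    refine Finset.sum_congr rfl fun i _ => ?_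
    rw [map_smul, real_inner_comm, inner_score hρ h0, smul_eq_mul, ← mul_assoc,
      mul_div_cancel₀ _ (h0 x).ne']
  simp_rw [hlap, hsc]
  rw [integral_finsetSum _ fun i _ => hI1 i, integral_finsetSum _ fun i _ => hI2 i,
    ← Finset.sum_neg_distrib]
  exact Finset.sum_congr rfl fun i _ => key i

/-- The marginal densities of the forward diffusion satisfy the continuity equation with the
velocity field of the probability flow. -/
lemma continuityEquation_of_diffusion
    {f : EuclideanSpace ℝ (Fin d) → ℝ → EuclideanSpace ℝ (Fin d)} {g : ℝ → ℝ}
    {ℱ : Filtration (Icc (0 : ℝ) T) mΩ} {X : ℝ → Ω → EuclideanSpace ℝ (Fin d)}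
    {q : ℝ → EuclideanSpace ℝ (Fin d) → ℝ} {L : ℝ} (hT : 0 ≤ T)
    (hX : IsForwardDiffusion T f g ℱ P X)
    (hq : ∀ t ∈ Icc (0 : ℝ) T, IsDensityOf (q t) (P.map (X t)))
    (hf : IsLipschitzField f 0 T L) (hg : Continuous g)
    (hq_pos : ∀ t ∈ Icc (0 : ℝ) T, ∀ x, 0 < q t x)
    (hq_C1 : ∀ t ∈ Icc (0 : ℝ) T, ContDiff ℝ 1 (q t)) :
    ContinuityEquation T q fun t x => f x t - ((1 / 2) * g t ^ 2) • score (q t) x := by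
  intro φ hφ hφc t ht
  have h0 : (0 : ℝ) ∈ Icc 0 T := ⟨le_rfl, hT⟩
  have hXm : ∀ t ∈ Icc 0 T, Measurable (X t) := fun t ht =>
    (hX.adapted ⟨t, ht⟩).mono (ℱ.le _) le_rfl
  obtain ⟨Z, hZc, hZm, hZX⟩ := exists_continuous_version hT hXm hX.continuous_paths
  obtain ⟨K, hK⟩ := exists_fderiv_bound hφ hφc hf
  have hφ' : ContDiff ℝ (⊤ : ℕ∞) (fderiv ℝ φ) := hφ.fderiv_right (by simp)
  have hφ'm := hφ'.continuous.measurable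
  -- the Laplacian is continuous with compact support
  have hlapc : Continuous (Laplacian.laplacian φ) := by
    rw [InnerProductSpace.laplacian_eq_iteratedFDeriv_stdOrthonormalBasis]
    have hc2 : Continuous (iteratedFDeriv ℝ 2 φ) :=
      hφ.continuous_iteratedFDeriv (WithTop.coe_le_coe.2 le_top)
    refine continuous_finsetSum _ fun i _ => ?_
    exact (ContinuousMultilinearMap.apply ℝ (fun _ : Fin 2 => EuclideanSpace ℝ (Fin d)) ℝ
      ![stdOrthonormalBasis ℝ (EuclideanSpace ℝ (Fin d)) i,
        stdOrthonormalBasis ℝ (EuclideanSpace ℝ (Fin d)) i]).continuous.comp hc2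
  have hlaps : HasCompactSupport (Laplacian.laplacian φ) := by
    refine HasCompactSupport.intro hφc fun x hx => ?_
    rw [InnerProductSpace.laplacian_eq_iteratedFDeriv_stdOrthonormalBasis]
    have : iteratedFDeriv ℝ 2 φ x = 0 :=
      image_eq_zero_of_notMem_tsupport fun hx' => hx (tsupport_iteratedFDeriv_subset 2 hx')
    simp [this]
  obtain ⟨c, hc⟩ := hlaps.exists_bound_of_continuous hlapc
  obtain ⟨M, hM⟩ := isCompact_Icc.exists_bound_of_continuousOn (hg.continuousOn (s := Icc 0 T))
  have hgen : ∀ s x, generator f g φ s x =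
      fderiv ℝ φ x (f x s) + (1 / 2) * g s ^ 2 * Laplacian.laplacian φ x := fun s x => by
    rw [generator, real_inner_comm, inner_gradient_left]
  set G : ℝ → Ω → ℝ := fun s ω => generator f g φ s (Z s ω) with hG
  have hGm : Measurable (Function.uncurry G) := by
    have : Function.uncurry G = fun z : ℝ × Ω => fderiv ℝ φ (Z z.1 z.2) (f (Z z.1 z.2) z.1) +
        (1 / 2) * g z.1 ^ 2 * Laplacian.laplacian φ (Z z.1 z.2) := by
      funext z
      exact hgen _ _
    rw [this]
    refine (measurable_clm_apply (hφ'm.comp hZm)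
      (hf.measurable.comp (hZm.prodMk measurable_fst))).add ?_
    exact (((hg.measurable.comp measurable_fst).pow_const 2).const_mul _).mul
      (hlapc.measurable.comp hZm)
  have hGK : ∀ s ∈ Icc 0 t, ∀ ω, |G s ω| ≤ K + 1 / 2 * M ^ 2 * c := fun s hs ω => by
    have hs' : s ∈ Icc 0 T := ⟨hs.1, hs.2.trans ht.2⟩
    simp only [hG, hgen]
    refine (abs_add_le _ _).trans (add_le_add (hK s hs' _) ?_)
    rw [abs_mul, abs_mul, abs_pow, abs_of_pos (by norm_num : (0 : ℝ) < 1 / 2)]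
    have h1 := hM s hs'
    have h2 := hc (Z s ω)
    rw [Real.norm_eq_abs] at h1 h2
    gcongr
  have hφi : ∀ s ∈ Icc 0 T, Integrable (fun ω => φ (X s ω)) P := fun s hs => by
    obtain ⟨c, hc⟩ := hφc.exists_bound_of_continuous hφ.continuous
    exact Integrable.of_bound (hφ.continuous.measurable.comp (hXm s hs)).aestronglyMeasurable c
      (Eventually.of_forall fun ω => hc _)
  -- Dynkin's formula: the martingale has the same expectation at times `0` and `t`.
  have e1 : ∫ ω, φ (X t ω) ∂P = ∫ ω, φ (X 0 ω) ∂P + ∫ ω, (∫ s in (0 : ℝ)..t, G s ω) ∂P := by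
    have hm := hX.martingale φ hφ hφc
    have hle : (⟨0, h0⟩ : Icc (0 : ℝ) T) ≤ ⟨t, ht⟩ := ht.1
    have h1 := hm.setIntegral_eq hle (s := univ) MeasurableSet.univ
    simp only [setIntegral_univ, intervalIntegral.integral_same, sub_zero] at h1
    have h2 : (fun ω => ∫ u in (0 : ℝ)..t, generator f g φ u (X u ω)) =ᵐ[P]
        fun ω => ∫ u in (0 : ℝ)..t, G u ω := by
      filter_upwards [hZX] with ω h2
      refine intervalIntegral.integral_congr fun s hs => ?_
      rw [uIcc_of_le ht.1] at hs
      simp only [hG, h2 s ⟨hs.1, hs.2.trans ht.2⟩]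
    have h3 : Integrable (fun ω => ∫ u in (0 : ℝ)..t, generator f g φ u (X u ω)) P := by
      have := (hφi t ht).sub (hm.integrable ⟨t, ht⟩)
      refine this.congr (Eventually.of_forall fun ω => ?_)
      simp
    rw [integral_sub (hφi t ht) h3, integral_congr_ae h2] at h1
    linarith
  rw [integral_intervalIntegral_swap hGm ht.1 hGK,
    integral_comp_eq_of_isDensityOf (hXm t ht) (hq t ht) hφ.continuous.measurable,
    integral_comp_eq_of_isDensityOf (hXm 0 h0) (hq 0 h0) hφ.continuous.measurable] at e1
  simp_rw [mul_comm (φ _)]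
  rw [e1]
  congr 1
  refine intervalIntegral.integral_congr fun s hs => ?_
  rw [uIcc_of_le ht.1] at hs
  have hs' : s ∈ Icc 0 T := ⟨hs.1, hs.2.trans ht.2⟩
  have hfm : Measurable fun x => fderiv ℝ φ x (f x s) :=
    measurable_clm_apply hφ'm (hf.measurable.comp measurable_prodMk_right)
  have hgm : Measurable fun x => generator f g φ s x := by
    simp only [hgen]
    exact hfm.add (hlapc.measurable.const_mul _)
  have e2 : ∫ ω, G s ω ∂P = ∫ x, q s x * generator f g φ s x := by
    rw [← integral_comp_eq_of_isDensityOf (hXm s hs') (hq s hs') hgm]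
    refine integral_congr_ae ?_
    filter_upwards [hZX] with ω h2
    simp only [hG, h2 s hs']
  have cq := (hq_C1 s hs').continuous
  have cf : Continuous fun x => f x s := by
    refine LipschitzWith.continuous (K := L.toNNReal) (LipschitzWith.of_dist_le_mul fun x y => ?_)
    rw [dist_eq_norm, dist_eq_norm]
    exact (hf.lipschitz x y s hs').trans (mul_le_mul_of_nonneg_right (Real.le_coe_toNNReal L)
      (norm_nonneg _))
  have hi1 : Integrable fun x => q s x * fderiv ℝ φ x (f x s) := by
    have := hφ'.continuous
    refine Continuous.integrable_of_hasCompactSupport (by fun_prop) ?_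
    refine HasCompactSupport.intro (hφc.fderiv ℝ) fun x hx => ?_
    simp [image_eq_zero_of_notMem_tsupport hx]
  have hi2 : Integrable fun x => q s x * Laplacian.laplacian φ x :=
    (cq.mul hlapc).integrable_of_hasCompactSupport hlaps.mul_left
  have cs : Continuous (score (q s)) := by
    have : score (q s) = fun x => (q s x)⁻¹ • gradient (q s) x :=
      funext fun x => score_eq (hq_C1 s hs') (hq_pos s hs') x
    rw [this]
    have hgr : Continuous (gradient (q s)) :=
      (InnerProductSpace.toDual ℝ _).symm.continuous.comp
        ((hq_C1 s hs').continuous_fderiv one_ne_zero)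
    exact (cq.inv₀ fun x => (hq_pos s hs' x).ne').smul hgr
  have hi3 : Integrable fun x => q s x * fderiv ℝ φ x (score (q s) x) := by
    have := hφ'.continuous
    refine Continuous.integrable_of_hasCompactSupport (by fun_prop) ?_
    refine HasCompactSupport.intro (hφc.fderiv ℝ) fun x hx => ?_
    simp [image_eq_zero_of_notMem_tsupport hx]
  rw [e2]
  have e3 : ∫ x, q s x * generator f g φ s x = ∫ x, (q s x * fderiv ℝ φ x (f x s) +
      (1 / 2) * g s ^ 2 * (q s x * Laplacian.laplacian φ x)) := by
    refine integral_congr_ae (Eventually.of_forall fun x => ?_)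
    simp only [hgen]
    ring
  have e4 : ∫ x, q s x * fderiv ℝ φ x (f x s - ((1 / 2) * g s ^ 2) • score (q s) x) =
      ∫ x, (q s x * fderiv ℝ φ x (f x s) -
        (1 / 2) * g s ^ 2 * (q s x * fderiv ℝ φ x (score (q s) x))) := by
    refine integral_congr_ae (Eventually.of_forall fun x => ?_)
    simp only [map_sub, map_smul, smul_eq_mul]
    ring
  -- Integrating the Laplacian by parts replaces diffusion by transport with velocity `-½g²∇log q`.
  rw [e3, e4, integral_add hi1 (hi2.const_mul _), integral_sub hi1 (hi3.const_mul _),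
    integral_const_mul, integral_const_mul,
    integral_mul_laplacian (hq_C1 s hs') (hq_pos s hs') hφ hφc]
  ring

end Weak

/-! ### Joint measurability of densities and scores -/

section Marginals

variable {d : ℕ} {Ω : Type*} [MeasurableSpace Ω] {P : Measure Ω} [IsProbabilityMeasure P]
  {X : ℝ → Ω → EuclideanSpace ℝ (Fin d)} {q : ℝ → EuclideanSpace ℝ (Fin d) → ℝ} {T : ℝ}

/-- Continuity of paths makes the marginals weakly continuous in time, by dominated convergence on
the probability space. -/
lemma continuousOn_integral_density_mul (hT : 0 ≤ T) (hXm : ∀ t ∈ Icc 0 T, Measurable (X t))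
    (hXc : ∀ᵐ ω ∂P, ContinuousOn (fun t => X t ω) (Icc 0 T))
    (hq : ∀ t ∈ Icc (0 : ℝ) T, IsDensityOf (q t) (P.map (X t)))
    {w : EuclideanSpace ℝ (Fin d) → ℝ} (hw : Continuous w) {c : ℝ} (hc : ∀ x, ‖w x‖ ≤ c) :
    ContinuousOn (fun t => ∫ x, q t x * w x) (Icc 0 T) := by
  obtain ⟨Z, hZc, hZm, hZX⟩ := exists_continuous_version hT hXm hXc
  have hc' : Continuous fun t => ∫ ω, w (Z t ω) ∂P := by
    refine continuous_of_dominated (bound := fun _ => c) (fun t => ?_)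
      (fun t => Eventually.of_forall fun ω => hc _) (integrable_const _)
      (Eventually.of_forall fun ω => hw.comp (hZc ω))
    exact (hw.measurable.comp (hZm.comp measurable_prodMk_left)).aestronglyMeasurable
  refine hc'.continuousOn.congr fun t ht => ?_
  simp only
  rw [← integral_comp_eq_of_isDensityOf (hXm t ht) (hq t ht) hw.measurable]
  refine integral_congr_ae ?_
  filter_upwards [hZX] with ω h
  rw [h t ht]

/-- The marginal densities of a continuous process are jointly measurable. -/
lemma measurable_uncurry_density (hT : 0 ≤ T) (hXm : ∀ t ∈ Icc 0 T, Measurable (X t))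
    (hXc : ∀ᵐ ω ∂P, ContinuousOn (fun t => X t ω) (Icc 0 T))
    (hq : ∀ t ∈ Icc (0 : ℝ) T, IsDensityOf (q t) (P.map (X t)))
    (hqc : ∀ t ∈ Icc 0 T, Continuous (q t)) :
    Measurable (Function.uncurry fun t => q (projIcc 0 T hT t)) := by
  obtain ⟨ρ, hρ⟩ := exists_isMollifier (EuclideanSpace ℝ (Fin d))
  set u : ℝ → EuclideanSpace ℝ (Fin d) → ℝ := fun t => q (projIcc 0 T hT t) with hu
  have huc : ∀ t, Continuous (u t) := fun t => hqc _ (projIcc 0 T hT t).2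
  -- At fixed scale the mollification is continuous in space, and in time it is the integral of a
  -- fixed bounded continuous function against the marginal. It is thus jointly measurable, and the
  -- density is its limit as `ε → 0`.
  have hmol : ∀ ε : ℝ, 0 < ε → Measurable fun z : ℝ × EuclideanSpace ℝ (Fin d) =>
      mol ρ ε (u z.1) z.2 := fun ε hε => by
    have key : Measurable (Function.uncurry fun (x : EuclideanSpace ℝ (Fin d)) (t : ℝ) =>
        mol ρ ε (u t) x) := by
      refine measurable_uncurry_of_continuous_of_measurable (fun t => mol_fun hρ (huc t))
        fun x => ?_
      set φ : EuclideanSpace ℝ (Fin d) → ℝ := fun y => ρ (ε⁻¹ • (x - y)) with hφ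
      have hφc : Continuous φ := by
        have := hρ.continuous
        fun_prop
      obtain ⟨c, hc⟩ := hρ.hasCompactSupport.exists_bound_of_continuous hρ.continuous
      have h1 := continuousOn_integral_density_mul hT hXm hXc hq hφc (c := c) fun y => hc _
      have h2 : Continuous fun t => ∫ y, u t y * φ y :=
        h1.domRestrict.comp continuous_projIcc
      have h3 : (fun t => mol ρ ε (u t) x) = fun t =>
          (ε ^ Module.finrank ℝ (EuclideanSpace ℝ (Fin d)))⁻¹ * ∫ y, u t y * φ y := by
        funext t
        rw [← integral_comp_sub_smul hε (fun y => u t y * φ y) x, mol]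
        refine integral_congr_ae (Eventually.of_forall fun z => ?_)
        simp only [hφ, sub_sub_cancel, inv_smul_smul₀ hε.ne']
        ring
      rw [h3]
      exact (h2.const_mul _ |>.measurable)
    exact key.comp measurable_swap
  refine measurable_of_tendsto_metrizable (fun n : ℕ => hmol (1 / (n + 1)) (by positivity))
    (tendsto_pi_nhds.2 fun z => (tendsto_mol hρ (huc z.1) z.2).comp ?_)
  exact tendsto_nhdsWithin_iff.2 ⟨tendsto_one_div_add_atTop_nhds_zero_nat,
    Eventually.of_forall fun n => by simp only [mem_Ioi]; positivity⟩

/-- Directional derivatives are limits of jointly measurable difference quotients with step `1/n`;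
the score is rebuilt from its coordinates. -/
lemma measurable_uncurry_score {u : ℝ → EuclideanSpace ℝ (Fin d) → ℝ}
    (hum : Measurable (Function.uncurry u)) (hu : ∀ t, ContDiff ℝ 1 (u t))
    (hu0 : ∀ t x, 0 < u t x) : Measurable (Function.uncurry fun t => score (u t)) := by
  have hd : ∀ w, Measurable fun z : ℝ × EuclideanSpace ℝ (Fin d) => fderiv ℝ (u z.1) z.2 w :=
    fun w => by
    refine measurable_of_tendsto_metrizable (f := fun (n : ℕ) z =>
      (n : ℝ) • (u z.1 (z.2 + (n : ℝ)⁻¹ • w) - u z.1 z.2)) (fun n => ?_)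
      (tendsto_pi_nhds.2 fun z => ?_)
    · have h1 : Measurable fun z : ℝ × EuclideanSpace ℝ (Fin d) => u z.1 (z.2 + (n : ℝ)⁻¹ • w) :=
        hum.comp (measurable_fst.prodMk (measurable_snd.add_const _))
      exact (h1.sub hum).const_smul (n : ℝ)
    · refine ((hu z.1).differentiable one_ne_zero z.2).hasFDerivAt.lim w ?_
      simpa using tendsto_natCast_atTop_atTop (R := ℝ)
  set e := stdOrthonormalBasis ℝ (EuclideanSpace ℝ (Fin d))
  have : (Function.uncurry fun t => score (u t)) = fun z : ℝ × EuclideanSpace ℝ (Fin d) =>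
      ∑ i, (fderiv ℝ (u z.1) z.2 (e i) / u z.1 z.2) • e i := by
    funext z
    rw [← e.sum_repr' (Function.uncurry (fun t => score (u t)) z)]
    refine Finset.sum_congr rfl fun i _ => ?_
    rw [real_inner_comm]
    congr 1
    exact inner_score (hu z.1) (hu0 z.1) _ _
  rw [this]
  exact Finset.measurable_fun_sum _ fun i _ => ((hd _).div hum).smul_const _

end Marginals

/-! ### A smooth truncation of the squared norm -/

section SecondMoment

variable {E : Type*} [NormedAddCommGroup E] [InnerProductSpace ℝ E] [FiniteDimensional ℝ E]
  [MeasurableSpace E] [BorelSpace E]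

variable (E) in
/-- A smooth compactly supported function which is comparable to `4 - ‖y‖ ^ 2`. -/
lemma exists_truncated_sq : ∃ φ : E → ℝ, ∃ K > 0, ContDiff ℝ (⊤ : ℕ∞) φ ∧ HasCompactSupport φ ∧
    (∀ y, 0 ≤ φ y) ∧ (∀ y, φ y ≤ 4) ∧ (∀ y, 4 - φ y ≤ 4 * ‖y‖ ^ 2) ∧
    (∀ y, ‖y‖ ≤ 2 → ‖y‖ ^ 2 ≤ 4 - φ y) ∧ (∀ y, 2 < ‖y‖ → fderiv ℝ φ y = 0) ∧
    ∀ y, ‖fderiv ℝ φ y‖ ≤ K * ‖y‖ := by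
  let χ : ContDiffBump (0 : E) := ⟨1, 2, by norm_num, by norm_num⟩
  set φ : E → ℝ := fun y => (4 - ‖y‖ ^ 2) * χ y with hφ
  have hsm : ContDiff ℝ (⊤ : ℕ∞) φ := (contDiff_const.sub (contDiff_norm_sq ℝ)).mul χ.contDiff
  have hcs : HasCompactSupport φ := χ.hasCompactSupport.mul_left
  have hsupp : tsupport φ ⊆ Metric.closedBall 0 2 := by
    refine (tsupport_mul_subset_right).trans ?_
    rw [χ.tsupport_eq]
  have hout : ∀ y, 2 < ‖y‖ → y ∉ tsupport φ := fun y hy h => by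
    have := hsupp h
    rw [mem_closedBall_zero_iff] at this
    linarith
  have h0 : ∀ y, 0 ≤ φ y := fun y => by
    by_cases hy : ‖y‖ ≤ 2
    · exact mul_nonneg (by nlinarith [norm_nonneg y]) χ.nonneg
    · rw [image_eq_zero_of_notMem_tsupport (hout y (not_le.1 hy))]
  have h2 : ∀ y, ‖y‖ ≤ 2 → ‖y‖ ^ 2 ≤ 4 - φ y := fun y hy => by
    have : φ y ≤ (4 - ‖y‖ ^ 2) * 1 :=
      mul_le_mul_of_nonneg_left χ.le_one (by nlinarith [norm_nonneg y])
    linarith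
  have h4 : ∀ y, φ y ≤ 4 := fun y => by
    by_cases hy : ‖y‖ ≤ 2
    · nlinarith [h2 y hy, norm_nonneg y]
    · rw [image_eq_zero_of_notMem_tsupport (hout y (not_le.1 hy))]
      norm_num
  have h1 : ∀ y, ‖y‖ ≤ 1 → φ y = 4 - ‖y‖ ^ 2 := fun y hy => by
    rw [hφ]
    simp only
    rw [χ.one_of_mem_closedBall (by simpa [χ] using hy), mul_one]
  have hsm' : ContDiff ℝ (⊤ : ℕ∞) (fderiv ℝ φ) := hsm.fderiv_right (by simp)
  obtain ⟨K, hK⟩ := ContDiff.lipschitzWith_of_hasCompactSupport (hcs.fderiv ℝ) hsm' (by simp)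
  refine ⟨φ, K + 1, by positivity, hsm, hcs, h0, h4, fun y => ?_, h2, fun y hy => ?_, fun y => ?_⟩
  · rcases le_total ‖y‖ 1 with hy | hy
    · rw [h1 y hy]
      nlinarith [norm_nonneg y]
    · nlinarith [h0 y]
  · exact image_eq_zero_of_notMem_tsupport fun h => hout y hy (tsupport_fderiv_subset ℝ h)
  -- The maximum is attained at the origin, so the Lipschitz derivative vanishes there and is at
  -- most linear.
  · have hmax : fderiv ℝ φ 0 = 0 := by
      refine IsLocalMax.fderiv_eq_zero (Eventually.of_forall fun y => ?_)
      rw [h1 0 (by simp)]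
      simpa using h4 y
    have := hK.norm_sub_le y 0
    rw [hmax, sub_zero, sub_zero] at this
    nlinarith [norm_nonneg y]

end SecondMoment

/-! ### Second moments bounded uniformly in time -/

section MomentBound

variable {d : ℕ} {Ω : Type*} [MeasurableSpace Ω] {P : Measure Ω} [IsProbabilityMeasure P]
  {X : ℝ → Ω → EuclideanSpace ℝ (Fin d)} {q : ℝ → EuclideanSpace ℝ (Fin d) → ℝ} {T : ℝ}

lemma IsDensityOf.integrable {ρ : EuclideanSpace ℝ (Fin d) → ℝ}
    {μ : Measure (EuclideanSpace ℝ (Fin d))} [IsFiniteMeasure μ] (hρ : IsDensityOf ρ μ) :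
    Integrable ρ := by
  have h := measure_lt_top μ univ
  rw [hρ.2.2, densityMeasure, withDensity_apply _ MeasurableSet.univ, setLIntegral_univ] at h
  refine ⟨hρ.1.aestronglyMeasurable, ?_⟩
  rwa [hasFiniteIntegral_iff_ofReal (Eventually.of_forall hρ.2.1)]

lemma IsDensityOf.integral_eq_one {ρ : EuclideanSpace ℝ (Fin d) → ℝ}
    {μ : Measure (EuclideanSpace ℝ (Fin d))} [IsProbabilityMeasure μ] (hρ : IsDensityOf ρ μ) :
    ∫ x, ρ x = 1 := by
  have := integral_densityMeasure hρ.1 hρ.2.1 fun _ => 1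
  rw [← hρ.2.2] at this
  simpa using this.symm

lemma integrable_densityMeasure_iff {ρ : EuclideanSpace ℝ (Fin d) → ℝ} (hρ : Measurable ρ)
    (h0 : ∀ x, 0 ≤ ρ x) (w : EuclideanSpace ℝ (Fin d) → ℝ) :
    Integrable w (densityMeasure ρ) ↔ Integrable fun x => ρ x * w x := by
  rw [densityMeasure, integrable_withDensity_iff_integrable_smul' hρ.ennreal_ofReal
    (Eventually.of_forall fun x => ENNReal.ofReal_lt_top)]
  refine integrable_congr (Eventually.of_forall fun x => ?_)
  simp [ENNReal.toReal_ofReal (h0 x)]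

/-- If the velocity field has linear growth, then the second moments stay bounded. -/
lemma exists_second_moment_bound {h : ℝ → EuclideanSpace ℝ (Fin d) → EuclideanSpace ℝ (Fin d)}
    {S : ℝ} (hT : 0 ≤ T) (hXm : ∀ t ∈ Icc 0 T, Measurable (X t))
    (hXc : ∀ᵐ ω ∂P, ContinuousOn (fun t => X t ω) (Icc 0 T))
    (hq : ∀ t ∈ Icc (0 : ℝ) T, IsDensityOf (q t) (P.map (X t)))
    (hCE : ContinuityEquation T q h) (hS : 0 ≤ S)
    (hh : ∀ t ∈ Icc 0 T, ∀ x, ‖h t x‖ ≤ S * (1 + ‖x‖))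
    (h0 : Integrable fun x => q 0 x * ‖x‖ ^ 2) :
    ∃ K, ∀ t ∈ Icc 0 T, (Integrable fun x => q t x * ‖x‖ ^ 2) ∧ ∫ x, q t x * ‖x‖ ^ 2 ≤ K := by
  have hT0 : (0 : ℝ) ∈ Icc 0 T := ⟨le_rfl, hT⟩
  have hpr : ∀ t ∈ Icc 0 T, IsProbabilityMeasure (P.map (X t)) := fun t ht =>
    Measure.isProbabilityMeasure_map (hXm t ht).aemeasurable
  have hqi : ∀ t ∈ Icc 0 T, Integrable (q t) := fun t ht => by
    have := hpr t ht
    exact (hq t ht).integrable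
  have hq1 : ∀ t ∈ Icc 0 T, ∫ x, q t x = 1 := fun t ht => by
    have := hpr t ht
    exact (hq t ht).integral_eq_one
  obtain ⟨φ, C, hC, hφ, hφc, hφ0, hφ4, hφsq, hφsq', hφ', hφd⟩ :=
    exists_truncated_sq (EuclideanSpace ℝ (Fin d))
  set M := ∫ x, q 0 x * ‖x‖ ^ 2
  -- The test function `θ(x) = R²(4 - φ(x/R))` is a bounded stand-in for `‖x‖²`: it is at most
  -- `4‖x‖²` everywhere and at least `‖x‖²` for `‖x‖ ≤ 2R`. The bound obtained does not depend on
  -- `R`.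
  have main : ∀ R > 0, ∀ t ∈ Icc 0 T,
      ∫ x, q t x * (R ^ 2 * (4 - φ (R⁻¹ • x))) ≤ (1 + 8 * M) * Real.exp (2 * (C * S) * T) := by
    intro R hR
    set Φ : EuclideanSpace ℝ (Fin d) → ℝ := fun x => R ^ 2 * φ (R⁻¹ • x) with hΦ
    set θ : EuclideanSpace ℝ (Fin d) → ℝ := fun x => R ^ 2 * (4 - φ (R⁻¹ • x)) with hθ
    have hθΦ : ∀ x, θ x = 4 * R ^ 2 - Φ x := fun x => by simp only [hθ, hΦ]; ring
    have hΦsm : ContDiff ℝ (⊤ : ℕ∞) Φ :=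
      contDiff_const.mul (hφ.comp (contDiff_id.const_smul R⁻¹))
    have hΦc : HasCompactSupport Φ :=
      (hφc.comp_smul (inv_ne_zero hR.ne')).mul_left (f := fun _ => R ^ 2)
    have hθc : Continuous θ := by
      have := hφ.continuous
      fun_prop
    have hθ0 : ∀ x, 0 ≤ θ x := fun x => mul_nonneg (by positivity) (by linarith [hφ4 (R⁻¹ • x)])
    have hθb : ∀ x, ‖θ x‖ ≤ 4 * R ^ 2 := fun x => by
      rw [Real.norm_of_nonneg (hθ0 x), hθΦ]
      have : 0 ≤ Φ x := mul_nonneg (by positivity) (hφ0 _)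
      linarith
    have hnorm : ∀ x : EuclideanSpace ℝ (Fin d), R * ‖R⁻¹ • x‖ = ‖x‖ := fun x => by
      rw [norm_smul, norm_inv, Real.norm_of_nonneg hR.le, mul_inv_cancel_left₀ hR.ne']
    have hder : ∀ x w, fderiv ℝ Φ x w = R * fderiv ℝ φ (R⁻¹ • x) w := fun x w => by
      have h1 : HasFDerivAt Φ _ x := (((hφ.differentiable (by simp) _).hasFDerivAt.comp x
        ((hasFDerivAt_id x).const_smul R⁻¹))).const_mul (R ^ 2)
      rw [h1.fderiv]
      simp
      field_simp
    -- For `‖x‖ ≤ 2R`, the gradient is at most `C‖x‖` and the field at most `S(1 + ‖x‖)`, so their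
    -- product is controlled by `1 + 2θ`. Farther out the derivative vanishes. This closes a
    -- Grönwall inequality for `1 + 2m`.
    have hbd : ∀ s ∈ Icc 0 T, ∀ x, |fderiv ℝ Φ x (h s x)| ≤ C * S * (1 + 2 * θ x) := by
      intro s hs x
      rw [hder, abs_mul, abs_of_pos hR]
      rcases lt_or_ge 2 ‖R⁻¹ • x‖ with hx | hx
      · rw [hφ' _ hx]
        have := hθ0 x
        simp
        positivity
      · have e1 : |fderiv ℝ φ (R⁻¹ • x) (h s x)| ≤ C * ‖R⁻¹ • x‖ * (S * (1 + ‖x‖)) :=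
          (ContinuousLinearMap.le_opNorm _ _).trans
            (mul_le_mul (hφd _) (hh s hs x) (norm_nonneg _) (by positivity))
        have e2 : ‖x‖ ^ 2 ≤ θ x := by
          rw [← hnorm x, mul_pow]
          exact mul_le_mul_of_nonneg_left (hφsq' _ hx) (by positivity)
        calc R * |fderiv ℝ φ (R⁻¹ • x) (h s x)| ≤ R * (C * ‖R⁻¹ • x‖ * (S * (1 + ‖x‖))) := by gcongr
          _ = C * S * (‖x‖ * (1 + ‖x‖)) := by rw [← hnorm x]; ring
          _ ≤ C * S * (1 + 2 * θ x) := by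
            gcongr
            nlinarith [norm_nonneg x, sq_nonneg (‖x‖ - 1)]
    have hqθ : ∀ t ∈ Icc 0 T, Integrable fun x => q t x * θ x := fun t ht =>
      (hqi t ht).mul_bdd hθc.aestronglyMeasurable (Eventually.of_forall hθb)
    have hqΦ : ∀ t ∈ Icc 0 T, Integrable fun x => q t x * Φ x := fun t ht => by
      have := ((hqi t ht).const_mul (4 * R ^ 2)).sub (hqθ t ht)
      refine this.congr (Eventually.of_forall fun x => ?_)
      simp only [Pi.sub_apply, hθΦ]
      ring
    set m : ℝ → ℝ := fun t => ∫ x, q t x * θ x with hm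
    have hmΦ : ∀ t ∈ Icc 0 T, m t = 4 * R ^ 2 - ∫ x, Φ x * q t x := fun t ht => by
      have e : (fun x => q t x * θ x) = fun x => 4 * R ^ 2 * q t x - Φ x * q t x := by
        funext x
        rw [hθΦ]
        ring
      simp only [hm]
      rw [e, integral_sub ((hqi t ht).const_mul _) ((hqΦ t ht).congr
        (Eventually.of_forall fun x => mul_comm _ _)), integral_const_mul, hq1 t ht, mul_one]
    have hm1 : ∀ t ∈ Icc 0 T, ∫ x, q t x * (C * S * (1 + 2 * θ x)) = C * S * (1 + 2 * m t) :=
      fun t ht => by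
      have e : (fun x => q t x * (C * S * (1 + 2 * θ x))) =
          fun x => C * S * q t x + 2 * (C * S) * (q t x * θ x) := by
        funext x
        ring
      rw [e, integral_add ((hqi t ht).const_mul _) ((hqθ t ht).const_mul _), integral_const_mul,
        integral_const_mul, hq1 t ht]
      ring
    have hmi : ∀ s ∈ Icc 0 T, ‖∫ x, q s x * fderiv ℝ Φ x (h s x)‖ ≤ C * S * (1 + 2 * m s) :=
      fun s hs => by
      rw [← hm1 s hs]
      refine norm_integral_le_of_norm_le ?_ (Eventually.of_forall fun x => ?_)
      · have := ((hqi s hs).const_mul (C * S)).add ((hqθ s hs).const_mul (2 * (C * S)))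
        refine this.congr (Eventually.of_forall fun x => ?_)
        simp only [Pi.add_apply]
        ring
      · rw [norm_mul, Real.norm_of_nonneg ((hq s hs).2.1 x)]
        exact mul_le_mul_of_nonneg_left (hbd s hs x) ((hq s hs).2.1 x)
    have hmc : ContinuousOn m (Icc 0 T) :=
      continuousOn_integral_density_mul hT hXm hXc hq hθc hθb
    have hm0 : m 0 ≤ 4 * M := by
      rw [← integral_const_mul]
      refine integral_mono (hqθ 0 hT0) (h0.const_mul 4) fun x => ?_
      have := hφsq (R⁻¹ • x)
      have e : θ x ≤ 4 * ‖x‖ ^ 2 := by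
        rw [← hnorm x, mul_pow, mul_left_comm]
        exact mul_le_mul_of_nonneg_left this (by positivity)
      have := mul_le_mul_of_nonneg_left e ((hq 0 hT0).2.1 x)
      simp only
      linarith
    have hgron := le_exp_of_le_integral (φ := fun t => 1 + 2 * m t) (A := 1 + 2 * m 0)
      (K := 2 * (C * S)) (by positivity)
      (continuousOn_const.add (continuousOn_const.mul hmc)) (a := 0) (b := T) fun t ht => by
        have e := hCE Φ hΦsm hΦc t ht
        have e' : m t = m 0 - ∫ s in (0 : ℝ)..t, ∫ x, q s x * fderiv ℝ Φ x (h s x) := by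
          rw [hmΦ t ht, hmΦ 0 hT0, e]
          ring
        have hle : ‖∫ s in (0 : ℝ)..t, ∫ x, q s x * fderiv ℝ Φ x (h s x)‖ ≤
            ∫ s in (0 : ℝ)..t, C * S * (1 + 2 * m s) := by
          refine intervalIntegral.norm_integral_le_of_norm_le ht.1 ?_ ?_
          · exact Eventually.of_forall fun s hs => hmi s ⟨hs.1.le, hs.2.trans ht.2⟩
          · refine ContinuousOn.intervalIntegrable ?_
            rw [uIcc_of_le ht.1]
            exact continuousOn_const.mul (continuousOn_const.add
              (continuousOn_const.mul (hmc.mono (Icc_subset_Icc_right ht.2))))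
        rw [intervalIntegral.integral_const_mul] at hle
        have := neg_le_of_abs_le hle
        rw [e']
        linarith
    intro t ht
    have hg := hgron t ht
    have hmt : 0 ≤ m t := integral_nonneg fun x => mul_nonneg ((hq t ht).2.1 x) (hθ0 x)
    have hM0 : 0 ≤ M := integral_nonneg fun x => mul_nonneg ((hq 0 hT0).2.1 x) (by positivity)
    have h3 : (1 + 2 * m 0) * Real.exp (2 * (C * S) * (t - 0)) ≤
        (1 + 8 * M) * Real.exp (2 * (C * S) * T) := by
      rw [sub_zero]
      refine mul_le_mul (by linarith) ?_ (Real.exp_nonneg _) (by linarith)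
      exact Real.exp_le_exp.2 (mul_le_mul_of_nonneg_left ht.2 (by positivity))
    have : m t ≤ 1 + 2 * m t := by linarith
    exact this.trans (hg.trans h3)
  refine ⟨(1 + 8 * M) * Real.exp (2 * (C * S) * T), fun t ht => ?_⟩
  -- Letting `R` run through the integers, uniform bounds on growing balls give both integrability
  -- and the bound on all of space.
  have hcov : AECover volume atTop fun n : ℕ =>
      Metric.closedBall (0 : EuclideanSpace ℝ (Fin d)) ((n : ℝ) + 1) :=
    aecover_closedBall (tendsto_atTop_add_const_right _ _ tendsto_natCast_atTop_atTop)
  have hnn : ∀ x, 0 ≤ q t x * ‖x‖ ^ 2 := fun x => mul_nonneg ((hq t ht).2.1 x) (by positivity)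
  have hint : ∀ n : ℕ,
      IntegrableOn (fun x => q t x * ‖x‖ ^ 2) (Metric.closedBall 0 ((n : ℝ) + 1)) :=
    fun n => by
    refine Integrable.mul_bdd (c := ((n : ℝ) + 1) ^ 2) (hqi t ht).integrableOn
      (by fun_prop) ?_
    refine (ae_restrict_mem Metric.isClosed_closedBall.measurableSet).mono fun x hx => ?_
    rw [mem_closedBall_zero_iff] at hx
    rw [norm_pow, norm_norm]
    gcongr
  have hle : ∀ n : ℕ, ∫ x in Metric.closedBall 0 ((n : ℝ) + 1), q t x * ‖x‖ ^ 2 ≤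
      (1 + 8 * M) * Real.exp (2 * (C * S) * T) := fun n => by
    have hR : (0 : ℝ) < n + 1 := by positivity
    refine le_trans ?_ (main (n + 1) hR t ht)
    have hθ0 : ∀ x : EuclideanSpace ℝ (Fin d),
        0 ≤ q t x * (((n : ℝ) + 1) ^ 2 * (4 - φ (((n : ℝ) + 1)⁻¹ • x))) := fun x =>
      mul_nonneg ((hq t ht).2.1 x)
        (mul_nonneg (by positivity) (by linarith [hφ4 (((n : ℝ) + 1)⁻¹ • x)]))
    have hi : Integrable fun x => q t x * (((n : ℝ) + 1) ^ 2 * (4 - φ (((n : ℝ) + 1)⁻¹ • x))) := by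
      refine (hqi t ht).mul_bdd (c := 4 * ((n : ℝ) + 1) ^ 2) ?_ (Eventually.of_forall fun x => ?_)
      · have := hφ.continuous
        exact Continuous.aestronglyMeasurable (by fun_prop)
      · rw [norm_mul, Real.norm_of_nonneg (by positivity), mul_comm]
        gcongr
        rw [Real.norm_of_nonneg (by linarith [hφ4 (((n : ℝ) + 1)⁻¹ • x)])]
        linarith [hφ0 (((n : ℝ) + 1)⁻¹ • x)]
    refine le_trans ?_ (setIntegral_le_integral (s := Metric.closedBall 0 ((n : ℝ) + 1)) hi
      (Eventually.of_forall hθ0))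
    refine setIntegral_mono_on (hint n) hi.integrableOn Metric.isClosed_closedBall.measurableSet
      fun x hx => mul_le_mul_of_nonneg_left ?_ ((hq t ht).2.1 x)
    rw [mem_closedBall_zero_iff] at hx
    have hnx : ((n : ℝ) + 1) * ‖((n : ℝ) + 1)⁻¹ • x‖ = ‖x‖ := by
      rw [norm_smul, norm_inv, Real.norm_of_nonneg hR.le, mul_inv_cancel_left₀ hR.ne']
    have hnx' : ‖((n : ℝ) + 1)⁻¹ • x‖ ≤ 2 := by
      rw [norm_smul, norm_inv, Real.norm_of_nonneg hR.le, inv_mul_le_iff₀ hR]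
      linarith
    rw [← hnx, mul_pow]
    exact mul_le_mul_of_nonneg_left (hφsq' _ hnx') (by positivity)
  have hI : Integrable fun x => q t x * ‖x‖ ^ 2 :=
    hcov.integrable_of_integral_norm_bounded _ hint (Eventually.of_forall fun n => by
      simpa only [Real.norm_of_nonneg (hnn _)] using hle n)
  exact ⟨hI, le_of_tendsto (hcov.integral_tendsto_of_countably_generated hI)
    (Eventually.of_forall hle)⟩

end MomentBound

/-! ### Kullback-Leibler divergence through densities -/

section KullbackLeibler

variable {d : ℕ}

/-- The Kullback–Leibler divergence of two probability measures with positive densities. -/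
lemma klDiv_densityMeasure {ρ η : EuclideanSpace ℝ (Fin d) → ℝ}
    {μ ν : Measure (EuclideanSpace ℝ (Fin d))} [IsProbabilityMeasure μ] [IsProbabilityMeasure ν]
    (hρ : IsDensityOf ρ μ) (hη : IsDensityOf η ν) (hρ0 : ∀ x, 0 < ρ x) (hη0 : ∀ x, 0 < η x)
    (hi : Integrable fun x => ρ x * (Real.log (ρ x) - Real.log (η x))) :
    InformationTheory.klDiv μ ν ≠ ⊤ ∧
      (InformationTheory.klDiv μ ν).toReal = ∫ x, ρ x * (Real.log (ρ x) - Real.log (η x)) := by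
  have hm : Measurable fun x => ENNReal.ofReal (ρ x / η x) := (hρ.1.div hη.1).ennreal_ofReal
  -- Positivity of `η` makes the quotient a true density, which yields absolute continuity and the
  -- log-likelihood ratio together.
  have hμν : μ = ν.withDensity fun x => ENNReal.ofReal (ρ x / η x) := by
    rw [hρ.2.2, hη.2.2, densityMeasure, densityMeasure,
      ← withDensity_mul _ hη.1.ennreal_ofReal hm]
    congr 1
    funext x
    rw [Pi.mul_apply, ← ENNReal.ofReal_mul (hη0 x).le, mul_div_cancel₀ _ (hη0 x).ne']
  have hac : μ ≪ ν := hμν ▸ withDensity_absolutelyContinuous _ _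
  have hllr : llr μ ν =ᵐ[μ] fun x => Real.log (ρ x) - Real.log (η x) := by
    have : μ.rnDeriv ν =ᵐ[ν] fun x => ENNReal.ofReal (ρ x / η x) := by
      conv_lhs => rw [hμν]
      exact Measure.rnDeriv_withDensity ν hm
    filter_upwards [hac.ae_le this] with x hx
    rw [llr, hx, ENNReal.toReal_ofReal (div_pos (hρ0 x) (hη0 x)).le,
      Real.log_div (hρ0 x).ne' (hη0 x).ne']
  have hint : Integrable (llr μ ν) μ := by
    rw [integrable_congr hllr, hρ.2.2, integrable_densityMeasure_iff hρ.1 hρ.2.1]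
    exact hi
  refine ⟨InformationTheory.klDiv_ne_top_iff.2 ⟨hac, hint⟩, ?_⟩
  rw [InformationTheory.toReal_klDiv_of_measure_eq hac (by simp), integral_congr_ae hllr,
    ← integral_densityMeasure hρ.1 hρ.2.1, hρ.2.2]

end KullbackLeibler

/-! ### Removal of the cutoff -/

section Limit

variable {E : Type*} [NormedAddCommGroup E] [InnerProductSpace ℝ E] [FiniteDimensional ℝ E]
  [MeasurableSpace E] [BorelSpace E]

variable (E) in
-- Scaling one bump gives a gradient of order `1/R` supported in `‖x‖ ≤ 2R`. There `1 + ‖x‖ ≤ 3R`,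
-- since `R ≥ 1`, so the decay can be written as `1/(1 + ‖x‖)`, uniformly in `R`: exactly what
-- compensates fields of linear growth.
lemma exists_cutoff : ∃ K > 0, ∀ R : ℝ, 1 ≤ R → ∃ χ : E → ℝ, ContDiff ℝ (⊤ : ℕ∞) χ ∧
    (∀ x, 0 ≤ χ x ∧ χ x ≤ 1) ∧ (∀ x, ‖x‖ ≤ R → χ x = 1) ∧ (∀ x, 2 * R < ‖x‖ → χ x = 0) ∧
    (∀ x, ‖x‖ < R → fderiv ℝ χ x = 0) ∧ ∀ x w, |fderiv ℝ χ x w| ≤ K * ‖w‖ / (1 + ‖x‖) := by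
  let χ : ContDiffBump (0 : E) := ⟨1, 2, by norm_num, by norm_num⟩
  have hχ : ContDiff ℝ (⊤ : ℕ∞) χ := χ.contDiff
  obtain ⟨K, hK⟩ := (χ.hasCompactSupport.fderiv ℝ).exists_bound_of_continuous
    (hχ.continuous_fderiv (by simp))
  have hK0 : 0 ≤ K := (norm_nonneg _).trans (hK 0)
  refine ⟨3 * K + 1, by positivity, fun R hR => ?_⟩
  have hR0 : 0 < R := by linarith
  have hn : ∀ x : E, ‖R⁻¹ • x‖ = R⁻¹ * ‖x‖ := fun x => by
    rw [norm_smul, norm_inv, Real.norm_of_nonneg hR0.le]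
  have hone : ∀ x, ‖x‖ ≤ R → χ (R⁻¹ • x) = 1 := fun x hx =>
    χ.one_of_mem_closedBall (by
      rw [mem_closedBall_zero_iff, hn, inv_mul_le_iff₀ hR0]
      simpa [χ] using hx)
  have hsup : ∀ x, 2 * R < ‖x‖ → R⁻¹ • x ∉ tsupport χ := fun x hx h => by
    rw [χ.tsupport_eq, mem_closedBall_zero_iff, hn, inv_mul_le_iff₀ hR0] at h
    simp only [χ] at h
    linarith
  have hder : ∀ x w, fderiv ℝ (fun x => χ (R⁻¹ • x)) x w =
      R⁻¹ * fderiv ℝ χ (R⁻¹ • x) w := fun x w => by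
    have h1 : HasFDerivAt (fun x => χ (R⁻¹ • x)) _ x :=
      (hχ.differentiable (by simp) _).hasFDerivAt.comp x ((hasFDerivAt_id x).const_smul R⁻¹)
    rw [h1.fderiv]
    simp
  refine ⟨fun x => χ (R⁻¹ • x), hχ.comp (contDiff_id.const_smul R⁻¹),
    fun x => ⟨χ.nonneg, χ.le_one⟩, hone,
    fun x hx => image_eq_zero_of_notMem_tsupport (hsup x hx), fun x hx => ?_, fun x w => ?_⟩
  · have : (fun x => χ (R⁻¹ • x)) =ᶠ[𝓝 x] fun _ => 1 := by
      filter_upwards [(isOpen_lt continuous_norm continuous_const).mem_nhds hx] with y hy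
      exact hone y (le_of_lt hy)
    rw [this.fderiv_eq]
    simp
  · rw [hder, abs_mul, abs_of_pos (inv_pos.2 hR0)]
    rcases lt_or_ge (2 * R) ‖x‖ with hx | hx
    · rw [image_eq_zero_of_notMem_tsupport fun h => hsup x hx (tsupport_fderiv_subset ℝ h)]
      simp
      positivity
    · have h1 : |fderiv ℝ χ (R⁻¹ • x) w| ≤ K * ‖w‖ := (ContinuousLinearMap.le_opNorm _ _).trans
        (mul_le_mul_of_nonneg_right (hK _) (norm_nonneg _))
      rw [inv_mul_le_iff₀ hR0, mul_div_assoc', le_div_iff₀ (by positivity)]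
      calc _ ≤ K * ‖w‖ * (1 + ‖x‖) := by gcongr
        _ ≤ K * ‖w‖ * (3 * R) := by gcongr; linarith
        _ ≤ R * ((3 * K + 1) * ‖w‖) := by nlinarith [norm_nonneg w]

variable {u v : ℝ → E → ℝ} {h k : ℝ → E → E} {T S : ℝ}

/-- Evolution of the relative entropy `∫ u log (u / v)`. -/
lemma relative_entropy_evolution {L : NNReal} (hT : 0 ≤ T)
    (hum : Measurable (Function.uncurry u)) (hvm : Measurable (Function.uncurry v))
    (hhm : Measurable (Function.uncurry h)) (hkm : Measurable (Function.uncurry k))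
    (hb : LocalBounds T L u v h k) (hu : ContinuityEquation T u h) (hv : ContinuityEquation T v k)
    (hS : 0 ≤ S) (hh : ∀ t ∈ Icc 0 T, ∀ x, ‖h t x‖ ≤ S * (1 + ‖x‖))
    (hk : ∀ t ∈ Icc 0 T, ∀ x, ‖k t x‖ ≤ S * (1 + ‖x‖))
    (hlog : ∀ t ∈ Icc 0 T, ∀ x, |Real.log (u t x) - Real.log (v t x)| ≤ S * (1 + ‖x‖ ^ 2))
    (hmom : ∀ t ∈ Icc 0 T, Integrable fun x => u t x * (1 + ‖x‖ ^ 2))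
    (hmom' : Integrable (fun z : ℝ × E => u z.1 z.2 * (1 + ‖z.2‖ ^ 2))
      ((volume.restrict (Icc 0 T)).prod volume))
    (hF : Integrable (fun z : ℝ × E => fderiv ℝ (u z.1) z.2 (h z.1 z.2 - k z.1 z.2) -
      u z.1 z.2 * (fderiv ℝ (v z.1) z.2 (h z.1 z.2 - k z.1 z.2) / v z.1 z.2))
      ((volume.restrict (Icc 0 T)).prod volume)) :
    (∫ x, u T x * (Real.log (u T x) - Real.log (v T x))) -
      (∫ x, u 0 x * (Real.log (u 0 x) - Real.log (v 0 x))) =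
    ∫ z : ℝ × E, (fderiv ℝ (u z.1) z.2 (h z.1 z.2 - k z.1 z.2) -
      u z.1 z.2 * (fderiv ℝ (v z.1) z.2 (h z.1 z.2 - k z.1 z.2) / v z.1 z.2))
      ∂((volume.restrict (Icc 0 T)).prod volume) := by
  obtain ⟨K, hK, hcut⟩ := exists_cutoff E
  have hR : ∀ n : ℕ, (1 : ℝ) ≤ n + 1 := fun n => by simp
  choose χ hχ hχ01 hχ1 hχ0 hχd hχb using fun n : ℕ => hcut (n + 1) (hR n)
  set F : ℝ × E → ℝ := fun z => fderiv ℝ (u z.1) z.2 (h z.1 z.2 - k z.1 z.2) -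
      u z.1 z.2 * (fderiv ℝ (v z.1) z.2 (h z.1 z.2 - k z.1 z.2) / v z.1 z.2) with hFdef
  set W : ℕ → ℝ × E → ℝ := fun n z =>
    u z.1 z.2 * (Real.log (u z.1 z.2) - Real.log (v z.1 z.2)) * fderiv ℝ (χ n) z.2 (h z.1 z.2) +
      u z.1 z.2 * fderiv ℝ (χ n) z.2 (h z.1 z.2 - k z.1 z.2) + χ n z.2 * F z with hW
  have hmem : ∀ᵐ z ∂((volume.restrict (Icc 0 T)).prod (volume : Measure E)), z.1 ∈ Icc 0 T :=
    Measure.quasiMeasurePreserving_fst.ae (ae_restrict_mem measurableSet_Icc)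
  have hWm : ∀ n, AEStronglyMeasurable (W n) ((volume.restrict (Icc 0 T)).prod volume) :=
      fun n => by
    have d1 : Measurable fun z : ℝ × E => fderiv ℝ (χ n) z.2 :=
      ((hχ n).continuous_fderiv (by simp)).measurable.comp measurable_snd
    have m1 : Measurable fun z : ℝ × E =>
        u z.1 z.2 * (Real.log (u z.1 z.2) - Real.log (v z.1 z.2)) *
          fderiv ℝ (χ n) z.2 (h z.1 z.2) + u z.1 z.2 * fderiv ℝ (χ n) z.2 (h z.1 z.2 - k z.1 z.2) :=
      ((hum.mul (hum.log.sub hvm.log)).mul (measurable_clm_apply d1 hhm)).add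
        (hum.mul (measurable_clm_apply d1 (hhm.sub hkm)))
    exact m1.aestronglyMeasurable.add
      (((hχ n).continuous.measurable.comp measurable_snd).aestronglyMeasurable.mul
        hF.aestronglyMeasurable)
  -- The derivative of the cutoff along `h` or `h - k` is bounded uniformly in `n`, and the
  -- log-ratio grows quadratically. The second moment and `|F|` dominate all cutoffs.
  have hWb : ∀ n, ∀ᵐ z ∂((volume.restrict (Icc 0 T)).prod (volume : Measure E)),
      ‖W n z‖ ≤ (S * (K * S) + 2 * (K * S)) * (u z.1 z.2 * (1 + ‖z.2‖ ^ 2)) + ‖F z‖ := fun n => by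
    filter_upwards [hmem] with z hz
    have u0 := (hb.pos_left z.1 hz z.2).le
    have hx : 0 < 1 + ‖z.2‖ := by positivity
    have b1 : |fderiv ℝ (χ n) z.2 (h z.1 z.2)| ≤ K * S := by
      refine (hχb n _ _).trans ((div_le_iff₀ hx).2 ?_)
      rw [mul_assoc]
      exact mul_le_mul_of_nonneg_left (hh _ hz _) hK.le
    have b2 : |fderiv ℝ (χ n) z.2 (h z.1 z.2 - k z.1 z.2)| ≤ 2 * (K * S) := by
      refine (hχb n _ _).trans ((div_le_iff₀ hx).2 ?_)
      have : ‖h z.1 z.2 - k z.1 z.2‖ ≤ 2 * (S * (1 + ‖z.2‖)) :=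
        (norm_sub_le _ _).trans (by linarith [hh _ hz z.2, hk _ hz z.2])
      calc _ ≤ K * (2 * (S * (1 + ‖z.2‖))) := by gcongr
        _ = _ := by ring
    have b3 : |χ n z.2| ≤ 1 := by
      rw [abs_of_nonneg (hχ01 n _).1]
      exact (hχ01 n _).2
    have b4 := hlog _ hz z.2
    rw [Real.norm_eq_abs, Real.norm_eq_abs]
    refine (abs_add_le _ _).trans (add_le_add ((abs_add_le _ _).trans ?_) ?_)
    · rw [abs_mul, abs_mul, abs_mul, abs_of_nonneg u0, add_mul]
      refine add_le_add ?_ ?_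
      · calc _ ≤ u z.1 z.2 * (S * (1 + ‖z.2‖ ^ 2)) * (K * S) := by gcongr
          _ = _ := by ring
      · calc _ ≤ u z.1 z.2 * (2 * (K * S)) := by gcongr
          _ ≤ u z.1 z.2 * (2 * (K * S)) * (1 + ‖z.2‖ ^ 2) :=
            le_mul_of_one_le_right (by positivity) (by nlinarith [norm_nonneg z.2])
          _ = _ := by ring
    · rw [abs_mul]
      exact mul_le_of_le_one_left (abs_nonneg _) b3
  have hDi := (hmom'.const_mul (S * (K * S) + 2 * (K * S))).add hF.norm
  -- Each fixed point eventually lies where the cutoff is one and its derivative zero.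
  have hWlim : ∀ z : ℝ × E, Tendsto (fun n => W n z) atTop (𝓝 (F z)) := fun z => by
    obtain ⟨N, hN⟩ := exists_nat_gt ‖z.2‖
    refine tendsto_const_nhds.congr' ?_
    filter_upwards [eventually_ge_atTop N] with n hn
    have hlt : ‖z.2‖ < n + 1 := hN.trans (by exact_mod_cast Nat.lt_succ_of_le hn)
    simp [hW, hχd n _ hlt, hχ1 n _ hlt.le]
  have lim1 : Tendsto (fun n => ∫ z, W n z ∂((volume.restrict (Icc 0 T)).prod volume)) atTop
      (𝓝 (∫ z, F z ∂((volume.restrict (Icc 0 T)).prod volume))) :=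
    tendsto_integral_of_dominated_convergence _ hWm hDi hWb (Eventually.of_forall hWlim)
  have hWi : ∀ n, Integrable (W n) ((volume.restrict (Icc 0 T)).prod volume) := fun n =>
    hDi.mono' (hWm n) (hWb n)
  have hcut' : ∀ t ∈ Icc 0 T, Tendsto
      (fun n => ∫ x, χ n x * (u t x * (Real.log (u t x) - Real.log (v t x)))) atTop
      (𝓝 (∫ x, u t x * (Real.log (u t x) - Real.log (v t x)))) := fun t ht => by
    have hum' : Measurable (u t) := hum.comp measurable_prodMk_left
    have hvm' : Measurable (v t) := hvm.comp measurable_prodMk_left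
    refine tendsto_integral_of_dominated_convergence (fun x => S * (u t x * (1 + ‖x‖ ^ 2)))
      (fun n => ((hχ n).continuous.measurable.mul
        (hum'.mul (hum'.log.sub hvm'.log))).aestronglyMeasurable)
      ((hmom t ht).const_mul S) (fun n => Eventually.of_forall fun x => ?_)
      (Eventually.of_forall fun x => ?_)
    · have u0 := (hb.pos_left t ht x).le
      rw [norm_mul, norm_mul, Real.norm_of_nonneg u0, Real.norm_of_nonneg (hχ01 n x).1]
      calc _ ≤ 1 * (u t x * (S * (1 + ‖x‖ ^ 2))) := by
            gcongr
            · exact (hχ01 n x).2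
            · exact hlog t ht x
        _ = _ := by ring
    · obtain ⟨N, hN⟩ := exists_nat_gt ‖x‖
      refine tendsto_const_nhds.congr' ?_
      filter_upwards [eventually_ge_atTop N] with n hn
      have hlt : ‖x‖ < n + 1 := hN.trans (by exact_mod_cast Nat.lt_succ_of_le hn)
      rw [hχ1 n _ hlt.le, one_mul]
  have hev : ∀ n, (∫ x, χ n x * (u T x * (Real.log (u T x) - Real.log (v T x)))) -
      (∫ x, χ n x * (u 0 x * (Real.log (u 0 x) - Real.log (v 0 x)))) =
      ∫ z, W n z ∂((volume.restrict (Icc 0 T)).prod volume) := fun n => by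
    have := (entropy_evolution hT ((hχ n).of_le (by simp)) (hχ0 n) hum hvm hhm hkm hb hu hv).2
    rw [this, intervalIntegral.integral_of_le hT, ← integral_Icc_eq_integral_Ioc,
      integral_prod _ (hWi n)]
    rfl
  refine tendsto_nhds_unique ?_ lim1
  have := (hcut' T ⟨hT, le_rfl⟩).sub (hcut' 0 ⟨le_rfl, hT⟩)
  exact this.congr hev

end Limit

/-! ### Hypotheses in the form of Lipschitz fields -/

section Assembly

variable {d : ℕ} {T σ : ℝ} {f s : EuclideanSpace ℝ (Fin d) → ℝ → EuclideanSpace ℝ (Fin d)}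
  {g g' : ℝ → ℝ}

lemma IsLipschitzField.of_le {L L' : ℝ} (hf : IsLipschitzField f 0 T L) (h : L ≤ L') :
    IsLipschitzField f 0 T L' where
  measurable := hf.measurable
  nonneg := hf.nonneg.trans h
  lipschitz x y t ht := (hf.lipschitz x y t ht).trans
    (mul_le_mul_of_nonneg_right h (norm_nonneg _))
  growth x t ht := (hf.growth x t ht).trans (mul_le_mul_of_nonneg_right h (by positivity))

lemma exists_isLipschitzField (hf : Measurable (Function.uncurry f))
    (hgr : ∃ C > 0, ∀ x, ∀ t ∈ Icc (0 : ℝ) T, ‖f x t‖ ≤ C * (1 + ‖x‖))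
    (hlip : ∃ C > 0, ∀ x y, ∀ t ∈ Icc (0 : ℝ) T, ‖f x t - f y t‖ ≤ C * ‖x - y‖) :
    ∃ L, IsLipschitzField f 0 T L := by
  obtain ⟨C, hC, h1⟩ := hgr
  obtain ⟨C', hC', h2⟩ := hlip
  refine ⟨max C C', hf, hC.le.trans (le_max_left _ _), fun x y t ht => ?_, fun x t ht => ?_⟩
  · exact (h2 x y t ht).trans (mul_le_mul_of_nonneg_right (le_max_right _ _) (norm_nonneg _))
  · exact (h1 x t ht).trans (mul_le_mul_of_nonneg_right (le_max_left _ _) (by positivity))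

lemma IsLipschitzField.exists_odeField {L L' : ℝ} (hf : IsLipschitzField f 0 T L)
    (hs : IsLipschitzField s 0 T L') (hg : Continuous g) :
    ∃ L'', IsLipschitzField (odeField f g s) 0 T L'' := by
  obtain ⟨M, hM⟩ := isCompact_Icc.exists_bound_of_continuousOn (hg.continuousOn (s := Icc 0 T))
  have hc : ∀ t ∈ Icc 0 T, ‖(1 / 2) * g t ^ 2‖ ≤ 1 / 2 * |M| ^ 2 := fun t ht => by
    rw [norm_mul, norm_pow, Real.norm_of_nonneg (by norm_num : (0 : ℝ) ≤ 1 / 2)]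
    have := (hM t ht).trans (le_abs_self M)
    gcongr
  have hL := hf.nonneg
  have hL' := hs.nonneg
  refine ⟨L + 1 / 2 * |M| ^ 2 * L', ?_, by positivity, fun x y t ht => ?_, fun x t ht => ?_⟩
  · exact hf.measurable.sub
      ((((hg.measurable.comp measurable_snd).pow_const 2).const_mul (1 / 2)).smul hs.measurable)
  · have e : odeField f g s x t - odeField f g s y t =
        (f x t - f y t) - ((1 / 2) * g t ^ 2) • (s x t - s y t) := by
      simp only [odeField, smul_sub]
      abel
    rw [e, add_mul]
    refine (norm_sub_le _ _).trans (add_le_add (hf.lipschitz x y t ht) ?_)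
    rw [norm_smul, mul_assoc (1 / 2 * |M| ^ 2)]
    exact mul_le_mul (hc t ht) (hs.lipschitz x y t ht) (norm_nonneg _) (by positivity)
  · rw [add_mul]
    refine (norm_sub_le _ _).trans (add_le_add (hf.growth x t ht) ?_)
    rw [norm_smul, mul_assoc (1 / 2 * |M| ^ 2)]
    exact mul_le_mul (hc t ht) (hs.growth x t ht) (norm_nonneg _) (by positivity)

lemma IsForwardDiffusion.congr {Ω : Type*} [mΩ : MeasurableSpace Ω]
    {ℱ : Filtration (Icc (0 : ℝ) T) mΩ} {P : Measure Ω}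
    {X : ℝ → Ω → EuclideanSpace ℝ (Fin d)} (hX : IsForwardDiffusion T f g ℱ P X)
    (hg : ∀ t ∈ Icc 0 T, g' t = g t) : IsForwardDiffusion T f g' ℱ P X where
  adapted := hX.adapted
  continuous_paths := hX.continuous_paths
  martingale φ hφ hφc := by
    convert hX.martingale φ hφ hφc using 4 with t ω
    refine intervalIntegral.integral_congr fun u hu => ?_
    rw [uIcc_of_le t.2.1] at hu
    simp only [generator, hg u ⟨hu.1, hu.2.trans t.2.2⟩]

/-- The ScoreODE is integrated from the terminal time; additivity of the integral rewrites it as an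
equation started at time zero. -/
lemma IsScoreODESolution.isSolution {Ω : Type*} [MeasurableSpace Ω] {P : Measure Ω}
    {Y : ℝ → Ω → EuclideanSpace ℝ (Fin d)} (hT : 0 ≤ T) (hY : IsScoreODESolution T σ f g s P Y)
    (hg : ∀ t ∈ Icc 0 T, g' t = g t) {L : ℝ} (hL : IsLipschitzField (odeField f g' s) 0 T L) :
    ∀ᵐ ω ∂P, IsSolution (odeField f g' s) 0 T fun t => Y t ω := by
  filter_upwards [hY.continuous_paths, hY.equation] with ω hc he
  have h0 : (0 : ℝ) ∈ Icc 0 T := ⟨le_rfl, hT⟩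
  have hTT : T ∈ Icc 0 T := ⟨hT, le_rfl⟩
  have he' : ∀ t ∈ Icc 0 T, Y t ω = Y T ω - ∫ u in t..T, odeField f g' s (Y u ω) u :=
    fun t ht => by
    rw [he t ht]
    congr 1
    refine intervalIntegral.integral_congr fun u hu => ?_
    rw [uIcc_of_le ht.2] at hu
    simp only [odeField, hg u ⟨ht.1.trans hu.1, hu.2⟩]
  refine ⟨hc, fun t ht => ?_⟩
  have := intervalIntegral.integral_add_adjacent_intervals
    (hL.intervalIntegrable hc h0 ht) (hL.intervalIntegrable hc ht hTT)
  rw [he' t ht, he' 0 h0, ← this]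
  abel

lemma norm_gradient {ρ : EuclideanSpace ℝ (Fin d) → ℝ} (x : EuclideanSpace ℝ (Fin d)) :
    ‖gradient ρ x‖ = ‖fderiv ℝ ρ x‖ :=
  (InnerProductSpace.toDual ℝ _).symm.norm_map _

lemma weightedIntegral_eq {q : ℝ → EuclideanSpace ℝ (Fin d) → ℝ}
    {F : ℝ → EuclideanSpace ℝ (Fin d) → ℝ} (hT : 0 ≤ T)
    (hqm : ∀ t ∈ Icc 0 T, Measurable (q t)) (hq0 : ∀ t ∈ Icc 0 T, ∀ x, 0 ≤ q t x)
    (hF : ConvergesAbsolutely T g q F) :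
    weightedIntegral T g q F = 1 / 2 * ∫ z : ℝ × EuclideanSpace ℝ (Fin d),
      g z.1 ^ 2 * (q z.1 z.2 * F z.1 z.2) ∂((volume.restrict (Icc (0 : ℝ) T)).prod volume) := by
  rw [weightedIntegral, integral_prod _ hF, intervalIntegral.integral_of_le hT,
    ← integral_Icc_eq_integral_Ioc]
  congr 1
  refine setIntegral_congr_fun measurableSet_Icc fun t ht => ?_
  simp only
  rw [integral_densityMeasure (hqm t ht) (hq0 t ht), integral_const_mul]

end Assembly

/-! ### Uniform local bounds and integrability on space-time -/

section Bounds

variable {d : ℕ} {T : ℝ}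

/-- Uniform bounds for the scores and the logarithms of the marginal densities of a continuous
process. -/
lemma exists_score_and_log_bound_of_process {Ω : Type*} [MeasurableSpace Ω] {P : Measure Ω}
    [IsProbabilityMeasure P] {X : ℝ → Ω → EuclideanSpace ℝ (Fin d)}
    {q : ℝ → EuclideanSpace ℝ (Fin d) → ℝ} (hT : 0 ≤ T)
    (hXm : ∀ t ∈ Icc 0 T, Measurable (X t))
    (hXc : ∀ᵐ ω ∂P, ContinuousOn (fun t => X t ω) (Icc 0 T))
    (hq : ∀ t ∈ Icc (0 : ℝ) T, IsDensityOf (q t) (P.map (X t)))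
    (hq_pos : ∀ t ∈ Icc (0 : ℝ) T, ∀ x, 0 < q t x)
    (hq_C1 : ∀ t ∈ Icc (0 : ℝ) T, ContDiff ℝ 1 (q t)) {C Λ : ℝ} (hC : 0 ≤ C) (hΛ : 0 ≤ Λ)
    (hq_grad : ∀ x, ∀ t ∈ Icc (0 : ℝ) T, ‖gradient (q t) x‖ ^ 2 ≤ C * (1 + ‖x‖))
    (hq_lip : ∀ x y, ∀ t ∈ Icc (0 : ℝ) T, ‖score (q t) x - score (q t) y‖ ≤ Λ * ‖x - y‖) :
    ∃ S > 0, ∀ t ∈ Icc 0 T, (∀ x, ‖score (q t) x‖ ≤ S * (1 + ‖x‖)) ∧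
      ∀ x, |Real.log (q t x)| ≤ S * (1 + ‖x‖ ^ 2) := by
  obtain ⟨R, hR, htight⟩ := exists_tight hT hXm hXc
  obtain ⟨S, hS, hbound⟩ := exists_score_and_log_bound (d := d) R (1 + C * (1 + R)) Λ hR
    (by positivity) hΛ
  refine ⟨S, hS, fun t ht => hbound (q t) (hq_C1 t ht) (hq_pos t ht) ?_ ?_ (fun x hx => ?_)
    fun x y => hq_lip x y t ht⟩
  · rw [← (hq t ht).2.2]
    exact Measure.isProbabilityMeasure_map (hXm t ht).aemeasurable
  · rw [← (hq t ht).2.2]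
    exact htight t ht
  · have h1 := hq_grad x t ht
    have h2 : C * (1 + ‖x‖) ≤ C * (1 + R) := by gcongr
    nlinarith [sq_nonneg (‖gradient (q t) x‖ - 1)]

/-- A bound on the logarithm over a ball confines a density between `exp(-B)` and `exp B`, which
gives the upper and the positive lower bound together. -/
lemma localBounds_of_log_bound {u v : ℝ → EuclideanSpace ℝ (Fin d) → ℝ}
    {h k : EuclideanSpace ℝ (Fin d) → ℝ → EuclideanSpace ℝ (Fin d)} {L S C : ℝ}
    (hu : ∀ t ∈ Icc 0 T, ContDiff ℝ 1 (u t)) (hv : ∀ t ∈ Icc 0 T, ContDiff ℝ 1 (v t))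
    (hu0 : ∀ t ∈ Icc 0 T, ∀ x, 0 < u t x) (hv0 : ∀ t ∈ Icc 0 T, ∀ x, 0 < v t x)
    (hh : IsLipschitzField h 0 T L) (hk : IsLipschitzField k 0 T L) (hS : 0 ≤ S) (hC : 0 ≤ C)
    (hul : ∀ t ∈ Icc 0 T, ∀ x, |Real.log (u t x)| ≤ S * (1 + ‖x‖ ^ 2))
    (hvl : ∀ t ∈ Icc 0 T, ∀ x, |Real.log (v t x)| ≤ S * (1 + ‖x‖ ^ 2))
    (hgr : ∀ x, ∀ t ∈ Icc (0 : ℝ) T, ‖gradient (u t) x‖ ^ 2 ≤ C * (1 + ‖x‖)) :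
    LocalBounds T L.toNNReal u v (fun t x => h x t) fun t x => k x t where
  contDiff_left := hu
  contDiff_right := hv
  pos_left := hu0
  pos_right := hv0
  lipschitz_left t ht := LipschitzWith.of_dist_le_mul fun x y => by
    rw [dist_eq_norm, dist_eq_norm, Real.coe_toNNReal _ hh.nonneg]
    exact hh.lipschitz x y t ht
  lipschitz_right t ht := LipschitzWith.of_dist_le_mul fun x y => by
    rw [dist_eq_norm, dist_eq_norm, Real.coe_toNNReal _ hk.nonneg]
    exact hk.lipschitz x y t ht
  bounds r := by
    set B := S * (1 + r ^ 2)
    have hmem : ∀ a y : ℝ, 0 ≤ y → y ≤ r → 0 < a → |Real.log a| ≤ S * (1 + y ^ 2) →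
        a ∈ Icc (Real.exp (-B)) (Real.exp B) := fun a y hy hyr ha hl => by
      have hB : |Real.log a| ≤ B := hl.trans (mul_le_mul_of_nonneg_left (by nlinarith) hS)
      rw [mem_Icc, ← Real.le_log_iff_exp_le ha, ← Real.log_le_iff_le_exp ha]
      exact abs_le.1 hB
    have hL := hh.nonneg
    refine ⟨Real.exp (-B), Real.exp B + (1 + C * (1 + |r|)) + L * (1 + |r|), Real.exp_pos _,
      fun t ht y hy => ?_⟩
    have hr : ‖y‖ ≤ |r| := hy.trans (le_abs_self r)
    have h1 : Real.exp B ≤ Real.exp B + (1 + C * (1 + |r|)) + L * (1 + |r|) := by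
      rw [add_assoc]
      exact le_add_of_nonneg_right (by positivity)
    have h2 : 1 + C * (1 + |r|) ≤ Real.exp B + (1 + C * (1 + |r|)) + L * (1 + |r|) := by
      rw [add_right_comm]
      exact le_add_of_nonneg_left (by positivity)
    have h3 : L * (1 + ‖y‖) ≤ Real.exp B + (1 + C * (1 + |r|)) + L * (1 + |r|) :=
      (mul_le_mul_of_nonneg_left (by linarith) hL).trans (le_add_of_nonneg_left (by positivity))
    refine ⟨Icc_subset_Icc_right h1 (hmem _ _ (norm_nonneg y) hy (hu0 t ht y) (hul t ht y)),
      Icc_subset_Icc_right h1 (hmem _ _ (norm_nonneg y) hy (hv0 t ht y) (hvl t ht y)),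
      le_trans ?_ h2, (hh.growth y t ht).trans h3, (hk.growth y t ht).trans h3⟩
    rw [← norm_gradient]
    have h4 := hgr y t ht
    have h5 : C * (1 + ‖y‖) ≤ C * (1 + |r|) := by gcongr
    nlinarith [sq_nonneg (‖gradient (u t) y‖ - 1)]

lemma integrable_prod_of_integral_le {E : Type*} [MeasurableSpace E] {μ : Measure E} [SFinite μ]
    {G : ℝ × E → ℝ} (hG : Measurable G) {K : ℝ}
    (h : ∀ t ∈ Icc 0 T, Integrable (fun x => G (t, x)) μ ∧ ∫ x, ‖G (t, x)‖ ∂μ ≤ K) :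
    Integrable G ((volume.restrict (Icc 0 T)).prod μ) := by
  rw [integrable_prod_iff hG.aestronglyMeasurable]
  refine ⟨(ae_restrict_mem measurableSet_Icc).mono fun t ht => (h t ht).1, ?_⟩
  refine Integrable.of_bound hG.norm.stronglyMeasurable.integral_prod_right'.aestronglyMeasurable K
    ((ae_restrict_mem measurableSet_Icc).mono fun t ht => ?_)
  rw [Real.norm_of_nonneg (integral_nonneg fun x => norm_nonneg _)]
  exact (h t ht).2

lemma ae_fst_mem_Icc {E : Type*} [MeasurableSpace E] {μ : Measure E} [SFinite μ] :
    ∀ᵐ z ∂((volume.restrict (Icc 0 T)).prod μ), z.1 ∈ Icc 0 T :=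
  Measure.quasiMeasurePreserving_fst.ae (ae_restrict_mem measurableSet_Icc)

end Bounds

/-! ### The integrands of the three functionals -/

section Integrands

variable {d : ℕ} {T : ℝ} {s : EuclideanSpace ℝ (Fin d) → ℝ → EuclideanSpace ℝ (Fin d)}
  {g : ℝ → ℝ} {q p : ℝ → EuclideanSpace ℝ (Fin d) → ℝ}

lemma diffIntegrand_eq (t : ℝ) (x : EuclideanSpace ℝ (Fin d)) :
    diffIntegrand s q p t x = odeIntegrand s q p t x - smIntegrand s q t x := by
  rw [diffIntegrand, odeIntegrand, smIntegrand, ← real_inner_self_eq_norm_sq, ← inner_sub_right]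
  congr 1
  abel

/-- The left side is `q ⟨∇log q - ∇log p, w⟩`; reversing the difference to match `odeIntegrand`
produces the minus sign. -/
lemma fderiv_sub_eq_odeIntegrand {t : ℝ} {x w : EuclideanSpace ℝ (Fin d)}
    (hq : ContDiff ℝ 1 (q t)) (hp : ContDiff ℝ 1 (p t)) (hq0 : ∀ x, 0 < q t x)
    (hp0 : ∀ x, 0 < p t x) (hw : w = ((1 / 2) * g t ^ 2) • (s x t - score (q t) x)) :
    fderiv ℝ (q t) x w - q t x * (fderiv ℝ (p t) x w / p t x) =
      -(1 / 2) * (g t ^ 2 * (q t x * odeIntegrand s q p t x)) := by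
  rw [← mul_div_cancel₀ (fderiv ℝ (q t) x w) (hq0 x).ne', ← inner_score hq hq0,
    ← inner_score hp hp0, hw, odeIntegrand, inner_smul_right, inner_smul_right,
    inner_sub_right (s x t - _), real_inner_comm (s x t - _), real_inner_comm (s x t - _)]
  ring

/-- Both `s` and the score of `q` grow linearly, so their squared difference is integrable by the
second moment. -/
lemma convergesAbsolutely_smIntegrand {L L' : ℝ} (hs : IsLipschitzField s 0 T L)
    (hsc : IsLipschitzField (fun x t => score (q t) x) 0 T L') (hg : Continuous g)
    (hqm : Measurable (Function.uncurry q)) (hq0 : ∀ t ∈ Icc 0 T, ∀ x, 0 ≤ q t x)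
    (hmom : Integrable (fun z : ℝ × EuclideanSpace ℝ (Fin d) => q z.1 z.2 * (1 + ‖z.2‖ ^ 2))
      ((volume.restrict (Icc 0 T)).prod volume)) :
    ConvergesAbsolutely T g q (smIntegrand s q) := by
  obtain ⟨G, hG⟩ := isCompact_Icc.exists_bound_of_continuousOn (hg.continuousOn (s := Icc 0 T))
  have hmeas : Measurable fun z : ℝ × EuclideanSpace ℝ (Fin d) =>
      g z.1 ^ 2 * (q z.1 z.2 * ‖s z.2 z.1 - score (q z.1) z.2‖ ^ 2) :=
    ((hg.measurable.comp measurable_fst).pow_const 2).mul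
      (hqm.mul (((hs.measurable.sub hsc.measurable).comp measurable_swap).norm.pow_const 2))
  refine (hmom.const_mul (2 * (G * (L + L')) ^ 2)).mono' hmeas.aestronglyMeasurable
    (ae_fst_mem_Icc.mono fun z hz => ?_)
  have hqz := hq0 _ hz z.2
  rw [smIntegrand, Real.norm_of_nonneg (by positivity)]
  have h1 : g z.1 ^ 2 ≤ G ^ 2 := by
    rw [← sq_abs]
    exact pow_le_pow_left₀ (abs_nonneg _) (hG _ hz) 2
  have h2 : ‖s z.2 z.1 - score (q z.1) z.2‖ ≤ (L + L') * (1 + ‖z.2‖) := by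
    rw [add_mul]
    exact (norm_sub_le _ _).trans (add_le_add (hs.growth _ _ hz) (hsc.growth _ _ hz))
  have h3 : ‖s z.2 z.1 - score (q z.1) z.2‖ ^ 2 ≤ (L + L') ^ 2 * (2 * (1 + ‖z.2‖ ^ 2)) := by
    refine (pow_le_pow_left₀ (norm_nonneg _) h2 2).trans ?_
    rw [mul_pow]
    exact mul_le_mul_of_nonneg_left (by nlinarith [sq_nonneg (1 - ‖z.2‖)]) (sq_nonneg _)
  calc g z.1 ^ 2 * (q z.1 z.2 * ‖s z.2 z.1 - score (q z.1) z.2‖ ^ 2)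
      ≤ G ^ 2 * (q z.1 z.2 * ((L + L') ^ 2 * (2 * (1 + ‖z.2‖ ^ 2)))) := by gcongr
    _ = 2 * (G * (L + L')) ^ 2 * (q z.1 z.2 * (1 + ‖z.2‖ ^ 2)) := by ring

end Integrands

end ScoreODE

/-! ### The main theorem -/

set_option maxHeartbeats 400000 in
theorem mainTheorem1 {d : ℕ} (T σ : ℝ) (hT : 0 < T) (hσ : 0 < σ)
    (f s : EuclideanSpace ℝ (Fin d) → ℝ → EuclideanSpace ℝ (Fin d)) (g : ℝ → ℝ)
    (hf_meas : Measurable (Function.uncurry f)) (hs_meas : Measurable (Function.uncurry s))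
    -- the forward diffusion and its marginal densities `q_t`
    {Ω : Type*} [mΩ : MeasurableSpace Ω] (P : Measure Ω) [IsProbabilityMeasure P]
    (ℱ : Filtration (Icc (0 : ℝ) T) mΩ) (X : ℝ → Ω → EuclideanSpace ℝ (Fin d))
    (hX : ScoreODE.IsForwardDiffusion T f g ℱ P X)
    (q : ℝ → EuclideanSpace ℝ (Fin d) → ℝ)
    (hq : ∀ t ∈ Icc (0 : ℝ) T, ScoreODE.IsDensityOf (q t) (P.map (X t)))
    -- the ScoreODE and its marginal densities `p_t`
    {Ω' : Type*} [MeasurableSpace Ω'] (P' : Measure Ω') [IsProbabilityMeasure P']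
    (Y : ℝ → Ω' → EuclideanSpace ℝ (Fin d))
    (hY : ScoreODE.IsScoreODESolution T σ f g s P' Y)
    (p : ℝ → EuclideanSpace ℝ (Fin d) → ℝ)
    (hp : ∀ t ∈ Icc (0 : ℝ) T, ScoreODE.IsDensityOf (p t) (P'.map (Y t)))
    -- the scores `∇ log q_t`, `∇ log p_t` and the integral `J_ODE` make sense
    (hq_pos : ∀ t ∈ Icc (0 : ℝ) T, ∀ x, 0 < q t x)
    (hq_C1 : ∀ t ∈ Icc (0 : ℝ) T, ContDiff ℝ 1 (q t))
    (hp_C1 : ∀ t ∈ Icc (0 : ℝ) T, ContDiff ℝ 1 (p t))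
    (hJ : ScoreODE.ConvergesAbsolutely T g q (ScoreODE.odeIntegrand s q p))
    -- the regularity assumptions
    (hq0_C3 : ContDiff ℝ 3 (q 0))
    (hq0_moment : Integrable (fun x => ‖x‖ ^ 2) (ScoreODE.densityMeasure (q 0)))
    (hf_C2 : ∀ t ∈ Icc (0 : ℝ) T, ContDiff ℝ 2 (fun x => f x t))
    (hf_growth : ∃ C > 0, ∀ x, ∀ t ∈ Icc (0 : ℝ) T, ‖f x t‖ ≤ C * (1 + ‖x‖))
    (hf_lip : ∃ C > 0, ∀ x y, ∀ t ∈ Icc (0 : ℝ) T, ‖f x t - f y t‖ ≤ C * ‖x - y‖)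
    (hg_cont : ContinuousOn g (Icc 0 T)) (hg_pos : ∀ t ∈ Icc (0 : ℝ) T, 0 < |g t|)
    (hq_L2 : ∀ O : Set (EuclideanSpace ℝ (Fin d)), IsOpen O → Bornology.IsBounded O →
      ∫⁻ t in Icc (0 : ℝ) T, ∫⁻ x in O,
        ENNReal.ofReal (‖q t x‖ ^ 2 + d * g t ^ 2 * ‖gradient (q t) x‖ ^ 2) < ⊤)
    (hq_grad : ∃ C > 0, ∀ x, ∀ t ∈ Icc (0 : ℝ) T, ‖gradient (q t) x‖ ^ 2 ≤ C * (1 + ‖x‖))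
    (hq_lip : ∃ C > 0, ∀ x y, ∀ t ∈ Icc (0 : ℝ) T,
      ‖ScoreODE.score (q t) x - ScoreODE.score (q t) y‖ ≤ C * ‖x - y‖)
    (hs_growth : ∃ C > 0, ∀ x, ∀ t ∈ Icc (0 : ℝ) T, ‖s x t‖ ≤ C * (1 + ‖x‖))
    (hs_lip : ∃ C > 0, ∀ x y, ∀ t ∈ Icc (0 : ℝ) T, ‖s x t - s y t‖ ≤ C * ‖x - y‖)
    (h_decay : ∀ t ∈ Icc (0 : ℝ) T, ∃ k : ℝ, 0 < k ∧
      q t =O[Bornology.cobounded (EuclideanSpace ℝ (Fin d))] (fun x => Real.exp (-‖x‖ ^ k)) ∧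
      p t =O[Bornology.cobounded (EuclideanSpace ℝ (Fin d))] (fun x => Real.exp (-‖x‖ ^ k))) :
    -- all the quantities are finite and well defined
    InformationTheory.klDiv (P.map (X 0)) (P'.map (Y 0)) ≠ ⊤ ∧
    InformationTheory.klDiv (P.map (X T)) (P'.map (Y T)) ≠ ⊤ ∧
    ScoreODE.ConvergesAbsolutely T g q (ScoreODE.smIntegrand s q) ∧
    ScoreODE.ConvergesAbsolutely T g q (ScoreODE.diffIntegrand s q p) ∧
    -- the two formulas
    (InformationTheory.klDiv (P.map (X 0)) (P'.map (Y 0))).toReal =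
      (InformationTheory.klDiv (P.map (X T)) (P'.map (Y T))).toReal +
        ScoreODE.JODE T g s q p ∧
    (InformationTheory.klDiv (P.map (X 0)) (P'.map (Y 0))).toReal =
      (InformationTheory.klDiv (P.map (X T)) (P'.map (Y T))).toReal +
        ScoreODE.JSM T g s q + ScoreODE.JDiff T g s q p := by

  have h0T : (0 : ℝ) ∈ Icc 0 T := ⟨le_rfl, hT.le⟩
  have hTT : T ∈ Icc 0 T := ⟨hT.le, le_rfl⟩
  have hXm : ∀ t ∈ Icc 0 T, Measurable (X t) := fun t ht =>
    (hX.adapted ⟨t, ht⟩).mono (ℱ.le _) le_rfl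
  have hprX : ∀ t ∈ Icc 0 T, IsProbabilityMeasure (P.map (X t)) := fun t ht =>
    Measure.isProbabilityMeasure_map (hXm t ht).aemeasurable
  have hprY : ∀ t ∈ Icc 0 T, IsProbabilityMeasure (P'.map (Y t)) := fun t ht =>
    Measure.isProbabilityMeasure_map (hY.measurable t ht).aemeasurable
  obtain ⟨Cg, hCg, hgrad⟩ := hq_grad
  obtain ⟨Λ, hΛ, hlip⟩ := hq_lip
  -- time-extended data
  set g' : ℝ → ℝ := IccExtend hT.le ((Icc 0 T).domRestrict g) with hg'
  have hg'c : Continuous g' := hg_cont.domRestrict.Icc_extend'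
  have hgg : ∀ t ∈ Icc 0 T, g' t = g t := fun t ht => IccExtend_of_mem hT.le _ ht
  -- Freezing time outside `[0,T]` yields families that are `C¹` in space at every real time and
  -- measurable jointly on the whole space-time.
  set q' : ℝ → EuclideanSpace ℝ (Fin d) → ℝ := fun t => q (projIcc 0 T hT.le t) with hq'
  set p' : ℝ → EuclideanSpace ℝ (Fin d) → ℝ := fun t => p (projIcc 0 T hT.le t) with hp'
  have hqq : ∀ t ∈ Icc 0 T, q' t = q t := fun t ht => by simp only [hq', projIcc_of_mem hT.le ht]
  have hpp : ∀ t ∈ Icc 0 T, p' t = p t := fun t ht => by simp only [hp', projIcc_of_mem hT.le ht]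
  have hq'm : Measurable (Function.uncurry q') := ScoreODE.measurable_uncurry_density hT.le hXm
    hX.continuous_paths hq fun t ht => (hq_C1 t ht).continuous
  have hp'm : Measurable (Function.uncurry p') := ScoreODE.measurable_uncurry_density hT.le
    hY.measurable hY.continuous_paths hp fun t ht => (hp_C1 t ht).continuous
  have hscm : Measurable (Function.uncurry fun t => ScoreODE.score (q' t)) :=
    ScoreODE.measurable_uncurry_score hq'm (fun t => hq_C1 _ (projIcc 0 T hT.le t).2)
      fun t => hq_pos _ (projIcc 0 T hT.le t).2
  obtain ⟨S₁, hS₁, hqb⟩ := ScoreODE.exists_score_and_log_bound_of_process hT.le hXm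
    hX.continuous_paths hq hq_pos hq_C1 hCg.le hΛ.le hgrad hlip
  -- the vector fields
  obtain ⟨Lf, hLf⟩ := ScoreODE.exists_isLipschitzField hf_meas hf_growth hf_lip
  obtain ⟨Ls, hLs⟩ := ScoreODE.exists_isLipschitzField hs_meas hs_growth hs_lip
  obtain ⟨Lc, hLc⟩ := ScoreODE.exists_isLipschitzField (T := T)
    (f := fun x t => ScoreODE.score (q' t) x) (hscm.comp measurable_swap)
    ⟨S₁, hS₁, fun x t ht => by rw [hqq t ht]; exact (hqb t ht).1 x⟩
    ⟨Λ, hΛ, fun x y t ht => by rw [hqq t ht]; exact hlip x y t ht⟩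
  obtain ⟨L₁, hL₁⟩ := hLf.exists_odeField hLc hg'c
  obtain ⟨L₂, hL₂⟩ := hLf.exists_odeField hLs hg'c
  have hh := hL₁.of_le (le_max_left L₁ L₂)
  have hk := hL₂.of_le (le_max_right L₁ L₂)
  set L := max L₁ L₂
  set h := ScoreODE.odeField f g' fun x t => ScoreODE.score (q' t) x with hh_def
  set k := ScoreODE.odeField f g' s with hk_def
  have hsol := hY.isSolution hT.le hgg hk
  -- the bounds for `p`
  obtain ⟨S₂, hS₂, hpb⟩ := ScoreODE.exists_abs_log_density_flow_le hσ hk hY.measurable hsol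
    hY.terminal_law hp fun t ht => (hp_C1 t ht).continuous
  have hp_pos : ∀ t ∈ Icc (0 : ℝ) T, ∀ x, 0 < p t x := fun t ht x => (hpb t ht x).1
  -- continuity equations
  have hCEq : ScoreODE.ContinuityEquation T q fun t x => h x t := by
    refine (ScoreODE.continuityEquation_of_diffusion hT.le (hX.congr hgg) hq hLf hg'c hq_pos
      hq_C1).congr (fun t ht => rfl) fun t ht => ?_
    funext x
    simp only [hh_def, ScoreODE.odeField, hqq t ht]
  have hCEp := ScoreODE.continuityEquation_of_flow hT.le hk hY.measurable hsol hp
  have hCEq' := hCEq.congr hqq fun t _ => rfl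
  have hCEp' := hCEp.congr hpp fun t _ => rfl
  -- moments
  have hmom0 := (ScoreODE.integrable_densityMeasure_iff (hq 0 h0T).1 (hq 0 h0T).2.1 _).1 hq0_moment
  obtain ⟨K, hK⟩ := ScoreODE.exists_second_moment_bound hT.le hXm hX.continuous_paths hq hCEq
    hh.nonneg (fun t ht x => hh.growth x t ht) hmom0
  have hmom : ∀ t ∈ Icc 0 T, (Integrable fun x => q t x * (1 + ‖x‖ ^ 2)) ∧
      ∫ x, q t x * (1 + ‖x‖ ^ 2) ≤ 1 + K := fun t ht => by
    have := hprX t ht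
    have e : (fun x => q t x * (1 + ‖x‖ ^ 2)) = fun x => q t x + q t x * ‖x‖ ^ 2 := by
      funext x
      ring
    rw [e, integral_add (hq t ht).integrable (hK t ht).1, (hq t ht).integral_eq_one]
    exact ⟨(hq t ht).integrable.add (hK t ht).1, by linarith [(hK t ht).2]⟩
  have hmom' : Integrable (fun z : ℝ × EuclideanSpace ℝ (Fin d) => q' z.1 z.2 * (1 + ‖z.2‖ ^ 2))
      ((volume.restrict (Icc 0 T)).prod volume) := by
    refine ScoreODE.integrable_prod_of_integral_le (K := 1 + K)
      (hq'm.mul ((measurable_snd.norm.pow_const 2).const_add 1)) fun t ht => ?_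
    simp only [hqq t ht]
    refine ⟨(hmom t ht).1, ?_⟩
    simp_rw [Real.norm_of_nonneg (mul_nonneg ((hq t ht).2.1 _)
      (by positivity : (0 : ℝ) ≤ 1 + ‖_‖ ^ 2))]
    exact (hmom t ht).2
  have hlog : ∀ t ∈ Icc 0 T, ∀ x,
      |Real.log (q t x) - Real.log (p t x)| ≤ (S₁ + S₂) * (1 + ‖x‖ ^ 2) := fun t ht x => by
    rw [add_mul]
    exact (abs_sub _ _).trans (add_le_add ((hqb t ht).2 x) (hpb t ht x).2)
  -- the Kullback–Leibler divergences
  have hKL : ∀ t ∈ Icc 0 T, InformationTheory.klDiv (P.map (X t)) (P'.map (Y t)) ≠ ⊤ ∧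
      (InformationTheory.klDiv (P.map (X t)) (P'.map (Y t))).toReal =
        ∫ x, q t x * (Real.log (q t x) - Real.log (p t x)) := fun t ht => by
    have := hprX t ht
    have := hprY t ht
    refine ScoreODE.klDiv_densityMeasure (hq t ht) (hp t ht) (hq_pos t ht) (hp_pos t ht) ?_
    refine ((hmom t ht).1.const_mul (S₁ + S₂)).mono'
      ((hq t ht).1.mul ((hq t ht).1.log.sub (hp t ht).1.log)).aestronglyMeasurable
      (Eventually.of_forall fun x => ?_)
    rw [norm_mul, Real.norm_of_nonneg ((hq t ht).2.1 x), mul_left_comm]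
    exact mul_le_mul_of_nonneg_left (hlog t ht x) ((hq t ht).2.1 x)
  -- the entropy production
  have hprod : ∀ z : ℝ × EuclideanSpace ℝ (Fin d), z.1 ∈ Icc 0 T →
      fderiv ℝ (q' z.1) z.2 (h z.2 z.1 - k z.2 z.1) -
        q' z.1 z.2 * (fderiv ℝ (p' z.1) z.2 (h z.2 z.1 - k z.2 z.1) / p' z.1 z.2) =
      -(1 / 2) * (g z.1 ^ 2 * (q z.1 z.2 * ScoreODE.odeIntegrand s q p z.1 z.2)) := fun z hz => by
    rw [hqq _ hz, hpp _ hz]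
    refine ScoreODE.fderiv_sub_eq_odeIntegrand (hq_C1 _ hz) (hp_C1 _ hz) (hq_pos _ hz)
      (hp_pos _ hz) ?_
    simp only [hh_def, hk_def, ScoreODE.odeField, hgg _ hz, hqq _ hz, smul_sub]
    abel
  have hae : ∀ᵐ z ∂((volume.restrict (Icc 0 T)).prod
      (volume : Measure (EuclideanSpace ℝ (Fin d)))), z.1 ∈ Icc 0 T := ScoreODE.ae_fst_mem_Icc
  have hprod_ae := hae.mono hprod
  -- The entropy production is `-½` times the integrand of `J_ODE`, so its integrability is the
  -- assumed absolute convergence.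
  have hF := (integrable_congr hprod_ae).2 (hJ.const_mul (-(1 / 2)))
  have key := ScoreODE.relative_entropy_evolution (h := fun t x => h x t) (k := fun t x => k x t)
    hT.le hq'm hp'm
    (hh.measurable.comp measurable_swap) (hk.measurable.comp measurable_swap)
    (ScoreODE.localBounds_of_log_bound (S := S₁ + S₂) (C := Cg)
      (fun t ht => by rw [hqq t ht]; exact hq_C1 t ht)
      (fun t ht => by rw [hpp t ht]; exact hp_C1 t ht)
      (fun t ht => by rw [hqq t ht]; exact hq_pos t ht)
      (fun t ht => by rw [hpp t ht]; exact hp_pos t ht) hh hk (by positivity) hCg.le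
      (fun t ht x => by
        rw [hqq t ht]
        exact ((hqb t ht).2 x).trans (mul_le_mul_of_nonneg_right (by linarith) (by positivity)))
      (fun t ht x => by
        rw [hpp t ht]
        exact (hpb t ht x).2.trans (mul_le_mul_of_nonneg_right (by linarith) (by positivity)))
      (fun x t ht => by rw [hqq t ht]; exact hgrad x t ht)) hCEq' hCEp' (S := L + (S₁ + S₂))
    (by have := hh.nonneg; positivity)
    (fun t ht x => (hh.growth x t ht).trans
      (mul_le_mul_of_nonneg_right (by linarith) (by positivity)))
    (fun t ht x => (hk.growth x t ht).trans
      (mul_le_mul_of_nonneg_right (by linarith) (by positivity)))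
    (fun t ht x => by
      rw [hqq t ht, hpp t ht]
      exact (hlog t ht x).trans
        (mul_le_mul_of_nonneg_right (by linarith [hh.nonneg]) (by positivity)))
    (fun t ht => by rw [hqq t ht]; exact (hmom t ht).1) hmom' hF
  have hqm : ∀ t ∈ Icc 0 T, Measurable (q t) := fun t ht => (hq t ht).1
  have hq0 : ∀ t ∈ Icc 0 T, ∀ x, 0 ≤ q t x := fun t ht => (hq t ht).2.1
  -- `key` now says that the divergence at `T` minus the divergence at `0` equals `-J_ODE`.
  rw [hqq T hTT, hqq 0 h0T, hpp T hTT, hpp 0 h0T, integral_congr_ae hprod_ae, integral_const_mul,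
    ← (hKL T hTT).2, ← (hKL 0 h0T).2] at key
  have hode : (InformationTheory.klDiv (P.map (X 0)) (P'.map (Y 0))).toReal =
      (InformationTheory.klDiv (P.map (X T)) (P'.map (Y T))).toReal +
        ScoreODE.JODE T g s q p := by
    rw [ScoreODE.JODE, ScoreODE.weightedIntegral_eq hT.le hqm hq0 hJ]
    linarith
  -- score matching
  have hsm : ScoreODE.ConvergesAbsolutely T g q (ScoreODE.smIntegrand s q) := by
    have := ScoreODE.convergesAbsolutely_smIntegrand hLs hLc hg'c hq'm
      (fun t ht x => by rw [hqq t ht]; exact hq0 t ht x) hmom'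
    exact this.congr (hae.mono fun z hz => by
      simp only [hgg _ hz, hqq _ hz, ScoreODE.smIntegrand])
  have hsplit' : (fun z : ℝ × EuclideanSpace ℝ (Fin d) =>
      g z.1 ^ 2 * (q z.1 z.2 * ScoreODE.diffIntegrand s q p z.1 z.2)) = fun z =>
      g z.1 ^ 2 * (q z.1 z.2 * ScoreODE.odeIntegrand s q p z.1 z.2) -
        g z.1 ^ 2 * (q z.1 z.2 * ScoreODE.smIntegrand s q z.1 z.2) := by
    funext z
    rw [ScoreODE.diffIntegrand_eq]
    ring
  have hdiff : ScoreODE.ConvergesAbsolutely T g q (ScoreODE.diffIntegrand s q p) := by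
    rw [ScoreODE.ConvergesAbsolutely, hsplit']
    exact hJ.sub hsm
  refine ⟨(hKL 0 h0T).1, (hKL T hTT).1, hsm, hdiff, hode, ?_⟩
  rw [hode, ScoreODE.JODE, ScoreODE.JSM, ScoreODE.JDiff,
    ScoreODE.weightedIntegral_eq hT.le hqm hq0 hJ, ScoreODE.weightedIntegral_eq hT.le hqm hq0 hsm,
    ScoreODE.weightedIntegral_eq hT.le hqm hq0 hdiff, hsplit', integral_sub hJ hsm]
  ring
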